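/- All matroids are finite. A *binary* matroid is one that is the vector matroid of a matrix over $\mathrm{GF}(2)$. For a binary matroid $M$ and a set $H\subseteq E(M)$, the *splitting matroid* $M_H$ is the vector matroid of the matrix $A_H$ obtained from a matrix $A$ over $\mathrm{GF}(2)$ representing $M$ by adding one new row, with entry $1$ in the columns labelled by the elements of $H$ and $0$ elsewhere (it does not depend on the choice of $A$). A *gammoid* is a matroid isomorphic to a restriction of a strict gammoid, that is, of a matroid on the vertex set of a finite digraph $D$ whose independent sets are the vertex sets that can be linked by pairwise vertex-disjoint directed paths into a fixed set $T$ of vertices of $D$; a *binary gammoid* is a matroid that is both binary and a gammoid. For a multigraph $G$, $M(G)$ denotes its cycle matroid, whose elements are the edges of $G$ and whose independent sets are the forests. Let $Q_2,Q_3,Q_4$ be the following multigraphs with vertices $0,1,2$ and six edges: - $Q_2$: one edge $12$, two parallel edges $01$, two parallel edges $02$, and a loop at the vertex $0$; - $Q_3$: one edge $12$, two parallel edges $01$, two parallel edges $02$, and a loop at the vertex $2$; - $Q_4$: two parallel edges $12$, two parallel edges $01$, and two parallel edges $02$. **Corollary.** Let $M$ be a binary gammoid. Then $M_H$ is a binary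 gammoid for every $H\subseteq E(M)$ with $|H|\ge 2$ if and only if, for each $i\in\{2,3,4\}$, $M$ has no minor isomorphic to $M(Q_i)$. -/

import Mathlib

open Set

/-! ### Vector matroids and binary matroids -/

namespace Matroid

/-- Augmentation for finite linearly independent subfamilies of a family of vectors. -/
theorem linearIndepOn_augment {α F W : Type*} [Field F] [AddCommGroup W] [Module F W]
    (v : α → W) {I J : Set α} (hI : LinearIndepOn F v I) (hIf : I.Finite)
    (hJ : LinearIndepOn F v J) (hJf : J.Finite) (hlt : I.ncard < J.ncard) :
    ∃ e ∈ J, e ∉ I ∧ LinearIndepOn F v (insert e I) := by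
  by_contra! hcon
  have hsub : v '' J ⊆ Submodule.span F (v '' I) := by
    rintro _ ⟨e, he, rfl⟩
    by_cases heI : e ∈ I
    · exact Submodule.subset_span (mem_image_of_mem v heI)
    · by_contra hn
      exact hcon e he heI ((linearIndepOn_insert heI).2 ⟨hI, hn⟩)
  have hle : Submodule.span F (v '' J) ≤ Submodule.span F (v '' I) :=
    Submodule.span_le.2 hsub
  have := hIf.fintype
  have := hJf.fintype
  have h1 := finrank_span_eq_card hI
  have h2 := finrank_span_eq_card hJ
  have e1 : range (fun x : I ↦ v x) = v '' I := by rw [image_eq_range]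
  have e2 : range (fun x : J ↦ v x) = v '' J := by rw [image_eq_range]
  rw [e1] at h1
  rw [e2] at h2
  have : Module.Finite F (Submodule.span F (v '' I)) :=
    Module.Finite.span_of_finite F (hIf.image v)
  have h3 := Submodule.finrank_mono hle
  rw [h1, h2, ← Nat.card_eq_fintype_card, ← Nat.card_eq_fintype_card, Nat.card_coe_set_eq,
    Nat.card_coe_set_eq] at h3
  omega

/-- The vector matroid on `E` of a matrix `A` whose columns are labelled by the elements: a set is
independent if the columns that it labels are linearly independent (as a family, so that two
equal columns are dependent). Columns with a label outside `E` play no role. -/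
def vectorMatroid {α m F : Type*} [Field F] (A : Matrix m α F) (E : Set α) : Matroid α :=
  (IndepMatroid.ofFinitaryCardAugment E
    (fun I ↦ I ⊆ E ∧ LinearIndepOn F (fun e i ↦ A i e) I)
    ⟨empty_subset _, linearIndepOn_empty _ _⟩
    (fun _ _ hJ hIJ ↦ ⟨hIJ.trans hJ.1, hJ.2.mono hIJ⟩)
    (fun _ _ hI hIf hJ hJf hlt ↦ by
      obtain ⟨e, heJ, heI, hi⟩ := linearIndepOn_augment _ hI.2 hIf hJ.2 hJf hlt
      exact ⟨e, heJ, heI, insert_subset (hJ.1 heJ) hI.1, hi⟩)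
    (fun I h ↦ ⟨fun e he ↦ (h {e} (by simpa using he) (finite_singleton e)).1 rfl,
      linearIndepOn_of_finite I fun J hJ hJf ↦ (h J hJ hJf).2⟩)
    (fun _ hI ↦ hI.1)).matroid

theorem vectorMatroid_ground {α m F : Type*} [Field F] (A : Matrix m α F) (E : Set α) :
    (vectorMatroid A E).E = E := rfl

theorem vectorMatroid_indep_iff {α m F : Type*} [Field F] (A : Matrix m α F) (E I : Set α) :
    (vectorMatroid A E).Indep I ↔ I ⊆ E ∧ LinearIndepOn F (fun e i ↦ A i e) I := Iff.rfl

/-- A matroid is binary if it is the vector matroid of a matrix over `GF(2)`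
(with finitely many rows, which is no restriction for matroids on finite sets). -/
def IsBinary {α : Type*} (M : Matroid α) : Prop :=
  ∃ (m : ℕ) (A : Matrix (Fin m) α (ZMod 2)), M = vectorMatroid A M.E

/-! ### The splitting matroid -/

open Classical in
/-- The matrix `A_H`: one more row is added to `A`, with entry `1` in the columns labelled by
`H` and `0` elsewhere. -/
noncomputable def splittingMatrix {α m : Type*} (A : Matrix m α (ZMod 2)) (H : Set α) :
    Matrix (m ⊕ Unit) α (ZMod 2) :=
  Matrix.fromRows A (Matrix.of fun (_ : Unit) (e : α) ↦ if e ∈ H then 1 else 0)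

/-- The splitting matroid `M_H` of a binary matroid `M` with respect to a set `H`: the vector
matroid of `A_H`, for a matrix `A` over `GF(2)` that represents `M`. By `splitting_eq` below, it
does not depend on the choice of `A`. -/
noncomputable def splitting {α : Type*} (M : Matroid α) (hM : M.IsBinary) (H : Set α) :
    Matroid α :=
  vectorMatroid (splittingMatrix hM.choose_spec.choose H) M.E

/-- Over `GF(2)`, a finite family is linearly independent iff no nonempty subfamily sums to `0`. -/
theorem linearIndepOn_zmod_two_iff {α W : Type*} [AddCommGroup W] [Module (ZMod 2) W]
    (v : α → W) (I : Set α) :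
    LinearIndepOn (ZMod 2) v I ↔
      ∀ S : Finset α, (S : Set α) ⊆ I → ∑ e ∈ S, v e = 0 → S = ∅ := by
  classical
  rw [linearIndepOn_iff']
  constructor
  · intro h S hS hsum
    by_contra hne
    obtain ⟨e, he⟩ := Finset.nonempty_iff_ne_empty.2 hne
    have := h S (fun _ ↦ 1) hS (by simpa using hsum) e he
    exact one_ne_zero this
  · intro h S g hS hsum e he
    by_contra hge
    have key : ∀ x : ZMod 2, x = 0 ∨ x = 1 := by decide
    have hS' : S.filter (fun e ↦ g e ≠ 0) = ∅ := by
      refine h _ (fun x hx ↦ hS (Finset.mem_of_subset (Finset.filter_subset _ _) hx)) ?_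
      rw [Finset.sum_filter]
      refine (Finset.sum_congr rfl fun x _ ↦ ?_).trans hsum
      rcases key (g x) with h0 | h1
      · rw [h0, zero_smul, if_neg (by simp)]
      · rw [h1, one_smul, if_pos one_ne_zero]
    have : e ∈ S.filter (fun e ↦ g e ≠ 0) := by simp [he, hge]
    simp [hS'] at this

/-- Two families with values in `GF(2)`-spaces that have the same independent sets have the same
vanishing sums. -/
theorem sum_eq_zero_of_same_indep {α W W' : Type*} [AddCommGroup W] [Module (ZMod 2) W]
    [AddCommGroup W'] [Module (ZMod 2) W'] (v : α → W) (w : α → W') (E : Set α)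
    (h : ∀ I ⊆ E, LinearIndepOn (ZMod 2) v I ↔ LinearIndepOn (ZMod 2) w I) (S : Finset α)
    (hSE : (S : Set α) ⊆ E) (hS : ∑ e ∈ S, v e = 0) : ∑ e ∈ S, w e = 0 := by
  classical
  induction S using Finset.strongInduction with
  | H S ih =>
    by_cases hne : S = ∅
    · simp [hne]
    -- a nonempty subset of `S` of vanishing `w`-sum
    have hdep : ¬ LinearIndepOn (ZMod 2) w (S : Set α) := by
      rw [← h _ hSE, linearIndepOn_zmod_two_iff]
      intro h'
      exact hne (h' S subset_rfl hS)
    rw [linearIndepOn_zmod_two_iff] at hdep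
    push Not at hdep
    obtain ⟨T, hTS, hT, hTne⟩ := hdep
    have hTS' : T ⊆ S := by exact_mod_cast hTS
    -- a nonempty subset of `T` of vanishing `v`-sum
    have hdep2 : ¬ LinearIndepOn (ZMod 2) v (T : Set α) := by
      rw [h _ (hTS.trans hSE), linearIndepOn_zmod_two_iff]
      intro h'
      exact hTne.ne_empty (h' T subset_rfl hT)
    rw [linearIndepOn_zmod_two_iff] at hdep2
    push Not at hdep2
    obtain ⟨U, hUT, hU, hUne⟩ := hdep2
    have hUT' : U ⊆ T := by exact_mod_cast hUT
    have hUS := hUT'.trans hTS'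
    by_cases hUeq : U = S
    · rw [← Finset.Subset.antisymm hTS' (hUeq ▸ hUT')]
      exact hT
    have hUss : U ⊂ S := lt_of_le_of_ne hUS hUeq
    have h1 : ∑ e ∈ S \ U, v e = 0 := by
      have := Finset.sum_sdiff (f := v) hUS
      rw [hU, hS, add_zero] at this
      exact this
    have h2 := ih U hUss ((Finset.coe_subset.2 hUS).trans hSE) hU
    have h3 := ih (S \ U) (Finset.sdiff_ssubset hUS hUne)
      ((Finset.coe_subset.2 Finset.sdiff_subset).trans hSE) h1
    rw [← Finset.sum_sdiff (f := w) hUS, h2, h3, add_zero]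

/-- The vanishing sums of columns of `A_H` depend only on the matroid represented by `A`. -/
theorem sum_splittingMatrix_eq_zero {α n n' : Type*} (C : Matrix n α (ZMod 2))
    (C' : Matrix n' α (ZMod 2)) (H E : Set α)
    (hCC : ∀ I ⊆ E, LinearIndepOn (ZMod 2) (fun e i ↦ C i e) I ↔
      LinearIndepOn (ZMod 2) (fun e i ↦ C' i e) I)
    (S : Finset α) (hS : (S : Set α) ⊆ E)
    (hsum : ∑ e ∈ S, (fun i ↦ splittingMatrix C H i e) = 0) :
    ∑ e ∈ S, (fun i ↦ splittingMatrix C' H i e) = 0 := by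
  have h1 : ∑ e ∈ S, (fun i ↦ C i e) = 0 := by
    funext i
    have := congrFun hsum (Sum.inl i)
    simpa [splittingMatrix] using this
  have h2 := sum_eq_zero_of_same_indep _ _ E hCC S hS h1
  funext i
  rcases i with i | i
  · have := congrFun h2 i
    simpa [splittingMatrix] using this
  · have := congrFun hsum (Sum.inr i)
    simpa [splittingMatrix] using this

/-- The splitting matroid does not depend on the choice of the representing matrix. -/
theorem splitting_eq {α m : Type*} (M : Matroid α) (hM : M.IsBinary) (H : Set α)
    (A : Matrix m α (ZMod 2)) (hA : M = vectorMatroid A M.E) :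
    M.splitting hM H = vectorMatroid (splittingMatrix A H) M.E := by
  have hB := hM.choose_spec.choose_spec
  rw [splitting]
  set B := hM.choose_spec.choose with hBdef
  have hAB : ∀ I ⊆ M.E, LinearIndepOn (ZMod 2) (fun e i ↦ A i e) I ↔
      LinearIndepOn (ZMod 2) (fun e i ↦ B i e) I := by
    intro I hI
    have h1 := vectorMatroid_indep_iff A M.E I
    have h2 := vectorMatroid_indep_iff B M.E I
    rw [← hA] at h1
    rw [← hB] at h2
    rw [h1] at h2
    simpa [hI] using h2
  refine Matroid.ext_indep rfl fun I hI ↦ ?_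
  rw [vectorMatroid_ground] at hI
  rw [vectorMatroid_indep_iff, vectorMatroid_indep_iff, linearIndepOn_zmod_two_iff,
    linearIndepOn_zmod_two_iff]
  refine and_congr_right fun _ ↦ ⟨fun h S hS hsum ↦ ?_, fun h S hS hsum ↦ ?_⟩
  · exact h S hS (sum_splittingMatrix_eq_zero A B H M.E hAB S (hS.trans hI) hsum)
  · exact h S hS (sum_splittingMatrix_eq_zero B A H M.E (fun J hJ ↦ (hAB J hJ).symm) S (hS.trans hI) hsum)

end Matroid

/-! ### Gammoids -/

/-- `p` is the vertex sequence of a directed path of `D` from `x` to a vertex of `T`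
(possibly of length zero, if `x` lies in `T`). -/
def Digraph.IsPathInto {V : Type*} (D : Digraph V) (x : V) (T : Set V) (p : List V) : Prop :=
  p.IsChain D.Adj ∧ p.Nodup ∧ p.head? = some x ∧ ∃ t ∈ T, p.getLast? = some t

/-- `X` is linked into `T` in `D`: there are pairwise vertex-disjoint directed paths, one from each
vertex of `X`, that end in `T`. -/
def Digraph.IsLinkedInto {V : Type*} (D : Digraph V) (X T : Set V) : Prop :=
  ∃ p : V → List V, (∀ x ∈ X, D.IsPathInto x T (p x)) ∧
    ∀ x ∈ X, ∀ y ∈ X, x ≠ y → (p x).Disjoint (p y)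

/-- A gammoid is a matroid isomorphic to a restriction of a strict gammoid: there are a finite
digraph `D`, a set `T` of its vertices, and an injection `φ` of the ground set into the vertices,
such that a subset of the ground set is independent iff its image is linked into `T` in `D`.
(So the ground set of a gammoid is finite.) -/
def Matroid.IsGammoid {α : Type*} (M : Matroid α) : Prop :=
  ∃ (V : Type) (_ : Finite V) (D : Digraph V) (T : Set V) (φ : α → V), InjOn φ M.E ∧
    ∀ I ⊆ M.E, M.Indep I ↔ D.IsLinkedInto (φ '' I) T

/-! ### Cycle matroids of graphs -/

namespace Graph

/-- `C` is the edge set of a cycle of the multigraph `G`: its edges are `e 0, …, e k` and there are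
distinct vertices `v 0, …, v k` such that `e i` joins `v i` to `v (i + 1)`, with indices modulo
`k + 1`. A loop is a cycle (`k = 0`), and so are two parallel edges (`k = 1`). -/
def IsCycleSet {V E : Type*} (G : Graph V E) (C : Set E) : Prop :=
  ∃ (k : ℕ) (v : Fin (k + 1) → V) (e : Fin (k + 1) → E), v.Injective ∧ e.Injective ∧
    (∀ i, G.IsLink (e i) (v i) (v (i + 1))) ∧ C = range e

/-- A set of edges of `G` is a forest if it contains no cycle. -/
def IsForest {V E : Type*} (G : Graph V E) (I : Set E) : Prop :=
  I ⊆ G.edgeSet ∧ ∀ C, G.IsCycleSet C → ¬ C ⊆ I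

open Classical in
/-- The incidence vector modulo `2` of an edge (zero for a loop). -/
noncomputable def incVec {V E : Type*} (G : Graph V E) (e : E) : V →₀ ZMod 2 :=
  if h : ∃ x y, G.IsLink e x y then
    Finsupp.single h.choose 1 + Finsupp.single h.choose_spec.choose 1 else 0

theorem incVec_eq {V E : Type*} {G : Graph V E} {e : E} {x y : V} (h : G.IsLink e x y) :
    G.incVec e = Finsupp.single x 1 + Finsupp.single y 1 := by
  have h' : ∃ x y, G.IsLink e x y := ⟨x, y, h⟩
  rw [incVec, dif_pos h']
  have key : ∀ a b : V, G.IsLink e a b → Finsupp.single a (1 : ZMod 2) + Finsupp.single b 1 =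
      Finsupp.single x 1 + Finsupp.single y 1 := by
    intro a b hab
    rcases hab.eq_and_eq_or_eq_and_eq h with ⟨rfl, rfl⟩ | ⟨rfl, rfl⟩
    · rfl
    · rw [add_comm]
  exact key _ _ h'.choose_spec.choose_spec

/-- A nonempty finite set of edges whose incidence vectors sum to zero contains a cycle. -/
theorem exists_isCycleSet_of_sum_eq_zero {V E : Type*} (G : Graph V E) (S : Finset E)
    (hSE : (S : Set E) ⊆ G.edgeSet) (hne : S.Nonempty) (hsum : ∑ e ∈ S, G.incVec e = 0) :
    ∃ C, G.IsCycleSet C ∧ C ⊆ (S : Set E) := by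
  classical
  by_cases hloop : ∃ e ∈ S, ∃ x, G.IsLink e x x
  · obtain ⟨e, heS, x, hx⟩ := hloop
    refine ⟨_, ⟨0, fun _ ↦ x, fun _ ↦ e, ?_, ?_, fun _ ↦ hx, rfl⟩, ?_⟩
    · exact fun a b _ ↦ Fin.ext (by omega)
    · exact fun a b _ ↦ Fin.ext (by omega)
    · rintro _ ⟨_, rfl⟩
      exact heS
  push Not at hloop
  have h10 : (1 : ZMod 2) ≠ 0 := by decide
  -- every edge of `S` can be continued at each of its ends
  have hnext : ∀ (e : E) (x y : V), e ∈ S → G.IsLink e x y →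
      ∃ (f : E) (z : V), f ∈ S ∧ f ≠ e ∧ G.IsLink f y z := by
    intro e x y heS hxy
    by_contra! hcon
    have hval : ∀ f ∈ S, f ≠ e → G.incVec f y = 0 := by
      intro f hf hfe
      obtain ⟨a, b, hab⟩ := G.exists_isLink_of_mem_edgeSet (hSE hf)
      have ha : a ≠ y := by
        rintro rfl
        exact hcon f b hf hfe hab
      have hb : b ≠ y := by
        rintro rfl
        exact hcon f a hf hfe hab.symm
      rw [incVec_eq hab]
      simp [ha, hb]
    have hxy' : x ≠ y := by
      rintro rfl
      exact hloop e heS _ hxy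
    have h1 : (∑ f ∈ S, G.incVec f) y = G.incVec e y := by
      rw [Finsupp.finsetSum_apply]
      exact Finset.sum_eq_single_of_mem e heS hval
    rw [hsum, incVec_eq hxy] at h1
    simp [hxy'] at h1
  -- an infinite walk in `S` that never goes back along the edge just used
  let P := {p : E × V × V // p.1 ∈ S ∧ G.IsLink p.1 p.2.1 p.2.2}
  have hstep : ∀ p : P, ∃ q : P, q.1.1 ≠ p.1.1 ∧ q.1.2.1 = p.1.2.2 := by
    rintro ⟨⟨e, x, y⟩, he, hxy⟩
    obtain ⟨f, z, hf, hfe, hyz⟩ := hnext e x y he hxy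
    exact ⟨⟨⟨f, y, z⟩, hf, hyz⟩, hfe, rfl⟩
  choose next hn1 hn2 using hstep
  obtain ⟨e₀, he₀⟩ := hne
  obtain ⟨x₀, y₀, h₀⟩ := G.exists_isLink_of_mem_edgeSet (hSE he₀)
  let w : ℕ → P := fun n ↦ next^[n] ⟨⟨e₀, x₀, y₀⟩, he₀, h₀⟩
  have hw : ∀ n, w (n + 1) = next (w n) := fun n ↦ Function.iterate_succ_apply' _ _ _
  let ed : ℕ → E := fun n ↦ (w n).1.1
  let vt : ℕ → V := fun n ↦ (w n).1.2.1
  have hedS : ∀ n, ed n ∈ S := fun n ↦ (w n).2.1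
  have hlink : ∀ n, G.IsLink (ed n) (vt n) (vt (n + 1)) := by
    intro n
    have h1 : vt (n + 1) = (w n).1.2.2 := by
      change (w (n + 1)).1.2.1 = _
      rw [hw, hn2]
    rw [h1]
    exact (w n).2.2
  have hedne : ∀ n, ed (n + 1) ≠ ed n := by
    intro n
    change (w (n + 1)).1.1 ≠ _
    rw [hw]
    exact hn1 _
  -- some vertex is repeated
  have hrep : ∃ k : ℕ, ∃ i : ℕ, vt i = vt (i + (k + 1)) := by
    have hfin : (range vt).Finite := by
      refine Set.Finite.subset (S.finite_toSet.biUnion (t := fun e ↦ {x | G.Inc e x}) ?_) ?_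
      · intro e he
        obtain ⟨a, b, hab⟩ := G.exists_isLink_of_mem_edgeSet (hSE he)
        refine Set.Finite.subset (Set.toFinite {a, b}) fun x hx ↦ ?_
        simpa using Graph.Inc.eq_or_eq_of_isLink hx hab
      · rintro _ ⟨n, rfl⟩
        exact mem_biUnion (hedS n) (hlink n).inc_left
    have hni : ¬ vt.Injective := fun hinj ↦ infinite_range_of_injective hinj hfin
    simp only [Function.Injective, not_forall] at hni
    obtain ⟨a, b, hab, hne'⟩ := hni
    rcases lt_or_gt_of_ne hne' with hlt | hlt
    · exact ⟨b - a - 1, a, by rw [hab]; congr 1; omega⟩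
    · exact ⟨a - b - 1, b, by rw [← hab]; congr 1; omega⟩
  -- take the shortest repetition
  let k := Nat.find hrep
  obtain ⟨i, hi⟩ : ∃ i : ℕ, vt i = vt (i + (k + 1)) := Nat.find_spec hrep
  have hmin : ∀ a b, a < b → b < a + (k + 1) → vt a ≠ vt b := by
    intro a b hab hbk heq
    exact Nat.find_min hrep (m := b - a - 1) (by change _ < k; omega)
      ⟨a, by rw [heq]; congr 1; omega⟩
  have hvinj : ∀ a b : ℕ, a < k + 1 → b < k + 1 → vt (i + a) = vt (i + b) → a = b := by
    intro a b ha hb hab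
    rcases lt_trichotomy a b with h | h | h
    · exact (hmin _ _ (by omega) (by omega) hab).elim
    · exact h
    · exact (hmin _ _ (by omega) (by omega) hab.symm).elim
  have hedlt : ∀ a b : ℕ, a < b → b < k + 1 → ed (i + a) ≠ ed (i + b) := by
    intro a b hab hb heq
    have h1 := hlink (i + a)
    rw [heq] at h1
    rcases h1.eq_and_eq_or_eq_and_eq (hlink (i + b)) with ⟨h2, -⟩ | ⟨-, h2⟩
    · exact hab.ne (hvinj a b (by omega) hb h2)
    · have h3 := hvinj (a + 1) b (by omega) hb h2
      subst h3
      exact hedne (i + a) heq.symm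
  refine ⟨_, ⟨k, fun a ↦ vt (i + a), fun a ↦ ed (i + a), ?_, ?_, ?_, rfl⟩, ?_⟩
  · intro a b hab
    exact Fin.ext (hvinj a b a.2 b.2 hab)
  · intro a b hab
    rcases lt_trichotomy (a : ℕ) b with h | h | h
    · exact (hedlt a b h b.2 hab).elim
    · exact Fin.ext h
    · exact (hedlt b a h a.2 hab.symm).elim
  · intro a
    have h1 := hlink (i + a)
    by_cases ha : a = Fin.last k
    · subst ha
      have h2 : ((Fin.last k + 1 : Fin (k + 1)) : ℕ) = 0 := by simp
      change G.IsLink _ _ (vt (i + ((Fin.last k + 1 : Fin (k + 1)) : ℕ)))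
      rw [h2, add_zero, hi]
      exact h1
    · have h2 : ((a + 1 : Fin (k + 1)) : ℕ) = a + 1 :=
        Fin.val_add_one_of_lt (Fin.lt_last_iff_ne_last.2 ha)
      change G.IsLink _ _ (vt (i + ((a + 1 : Fin (k + 1)) : ℕ)))
      rw [h2]
      exact h1
  · rintro _ ⟨a, rfl⟩
    exact hedS _

/-- A set of edges is a forest iff its incidence vectors modulo `2` are linearly independent. -/
theorem isForest_iff {V E : Type*} (G : Graph V E) (I : Set E) :
    G.IsForest I ↔ I ⊆ G.edgeSet ∧ LinearIndepOn (ZMod 2) G.incVec I := by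
  classical
  rw [IsForest, Matroid.linearIndepOn_zmod_two_iff]
  refine and_congr_right fun hI ↦ ⟨fun h S hS hsum ↦ ?_, ?_⟩
  · by_contra hne
    obtain ⟨C, hC, hCS⟩ := G.exists_isCycleSet_of_sum_eq_zero S (hS.trans hI)
      (Finset.nonempty_iff_ne_empty.2 hne) hsum
    exact h C hC (hCS.trans hS)
  · rintro h C ⟨k, v, e, -, he, hlink, rfl⟩ hCI
    have h2 : (2 : ZMod 2) = 0 := by decide
    have := h (Finset.univ.image e) (by simpa using hCI) (by
      rw [Finset.sum_image (fun a _ b _ hab ↦ he hab)]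
      simp_rw [fun i ↦ incVec_eq (hlink i)]
      have h3 : ∑ i, Finsupp.single (v (i + 1)) (1 : ZMod 2) = ∑ i, Finsupp.single (v i) 1 :=
        Equiv.sum_comp (Equiv.addRight (1 : Fin (k + 1)))
          (fun i ↦ Finsupp.single (v i) (1 : ZMod 2))
      rw [Finset.sum_add_distrib, h3, ← two_smul (ZMod 2), h2, zero_smul])
    rw [Finset.image_eq_empty] at this
    exact Finset.univ_nonempty.ne_empty this

/-- The cycle matroid `M(G)` of a multigraph `G`: its elements are the edges of `G` and its
independent sets are the forests. -/
def cycleMatroid {V E : Type*} (G : Graph V E) : Matroid E :=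
  (IndepMatroid.ofFinitaryCardAugment G.edgeSet G.IsForest
    (by simp [isForest_iff])
    (fun _ _ hJ hIJ ↦ ⟨hIJ.trans hJ.1, fun C hC hCI ↦ hJ.2 C hC (hCI.trans hIJ)⟩)
    (fun _ _ hI hIf hJ hJf hlt ↦ by
      rw [isForest_iff] at hI hJ
      obtain ⟨e, heJ, heI, hi⟩ := Matroid.linearIndepOn_augment _ hI.2 hIf hJ.2 hJf hlt
      exact ⟨e, heJ, heI, (isForest_iff _ _).2 ⟨insert_subset (hJ.1 heJ) hI.1, hi⟩⟩)
    (fun I h ↦ ⟨fun e he ↦ (h {e} (by simpa using he) (finite_singleton e)).1 rfl,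
      fun C hC hCI ↦ (h C hCI (by
        obtain ⟨k, v, e, -, -, -, rfl⟩ := hC
        exact finite_range e)).2 C hC subset_rfl⟩)
    (fun _ hI ↦ hI.1)).matroid

theorem cycleMatroid_ground {V E : Type*} (G : Graph V E) : G.cycleMatroid.E = G.edgeSet := rfl

theorem cycleMatroid_indep_iff {V E : Type*} (G : Graph V E) (I : Set E) :
    G.cycleMatroid.Indep I ↔ G.IsForest I := Iff.rfl

/-- The multigraph with all of `V` as vertices and all of `E` as edges, in which the edge `e` has
the unordered pair `ends e` of ends. -/
def ofEnds {V E : Type*} (ends : E → Sym2 V) : Graph V E where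
  vertexSet := univ
  IsLink e x y := ends e = s(x, y)
  edgeSet := univ
  isLink_symm := fun e _ ↦ ⟨fun x y h ↦ by rw [h, Sym2.eq_swap]⟩
  eq_or_eq_of_isLink_of_isLink := by
    intro e x y v w h h'
    rw [h, Sym2.eq_iff] at h'
    tauto
  edge_mem_iff_exists_isLink := fun e ↦
    ⟨fun _ ↦ by
      induction h : ends e with
      | _ x y => exact ⟨x, y, rfl⟩, fun _ ↦ mem_univ _⟩
  left_mem_of_isLink := fun _ _ _ _ ↦ mem_univ _

end Graph

/-- The graph `Q₂`: a triangle on the vertices `0, 1, 2` in which the sides `01` and `02` are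
doubled, with a loop at the common vertex `0` of the doubled sides. -/
def graphQ2 : Graph (Fin 3) (Fin 6) :=
  Graph.ofEnds ![s(1, 2), s(0, 1), s(0, 1), s(0, 2), s(0, 2), s(0, 0)]

/-- The graph `Q₃`: a triangle on the vertices `0, 1, 2` in which the sides `01` and `02` are
doubled, with a loop at the vertex `2`. -/
def graphQ3 : Graph (Fin 3) (Fin 6) :=
  Graph.ofEnds ![s(1, 2), s(0, 1), s(0, 1), s(0, 2), s(0, 2), s(2, 2)]

/-- The graph `Q₄`: a triangle on the vertices `0, 1, 2` in which all three sides are doubled. -/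
def graphQ4 : Graph (Fin 3) (Fin 6) :=
  Graph.ofEnds ![s(1, 2), s(1, 2), s(0, 1), s(0, 1), s(0, 2), s(0, 2)]

/-- `M` has a minor isomorphic to `N`. -/
def Matroid.HasMinorIso {α β : Type*} (M : Matroid α) (N : Matroid β) : Prop :=
  ∃ M' : Matroid α, M' ≤m M ∧ ∃ e : M'.E ≃ N.E, M'.mapSetEquiv e = N

/-! The core is that a binary matroid is a gammoid exactly when it has no `M(K₄)`-minor. Everything
is expressed by the cycle space `C` and the cocycle space `R`, which are orthogonal complements over
`GF(2)`. Deleting an element shortens `C` and punctures `R`, and contracting does the opposite. An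
`M(K₄)`-minor is then recorded by a finite certificate: three vectors of `C` and three of `R`.

Gammoids exclude `M(K₄)`: a linking amounts to a transversal of a set family that avoids the linked
set. Comparing two transversals along alternating paths gives `HasInjectiveExchange`, which passes
to minors and fails in `M(K₄)`, where two elements of one basis compete for the same partner.

Conversely, a nonempty binary matroid without `M(K₄)`-minor has a circuit or cocircuit of size at
most two (`OrthoPair.exists_hasShortVector`). It therefore arises from a smaller one by adding a
loop, a coloop, a parallel or a series element, and each of these additions can be made in a family
of sets. The existence of the short vector is proved by induction in a stronger form, with a
prescribed element to avoid: if there is no short vector at all, every element lies in two otherwise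
disjoint triangles and in two otherwise disjoint triads, and these assemble into `M(K₄)`.

Splitting by `H` replaces `C` by the vectors of `C` orthogonal to the indicator `h` of `H`, hence
`R` by `R ∪ (R + h)`. If this creates an `M(K₄)`-minor, the three stars of the certificate lie in
`R` up to multiples `t k` of `h`, with `t ≠ 0`. The corresponding minor of `M` is the quotient of
`M(K₄)` by the point `t` of the Fano plane: extend `M(K₄)` by `t`, then contract `t`. Conversely,
from such a quotient minor, splitting along a star `k₀` with `t k₀ = 1` restores `M(K₄)`.

`M(K₄)` is the Fano plane minus one point. The quotient by the missing point has three parallel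
pairs and is `M(Q₄)`; the quotient by any other point has a loop, two parallel pairs and a single
element, and is `M(Q₂) = M(Q₃)`. -/

/-! ### Linkings and matchings -/

namespace Digraph

variable {V : Type*}

/-- Pairwise disjoint paths from `X` into `T` give a matching of the vertices outside `T`: each of
them is matched to its successor on its path, or to itself if it lies on none of the paths. -/
theorem IsLinkedInto.exists_matching {D : Digraph V} {X T : Set V} (h : D.IsLinkedInto X T) :
    ∃ f : {v // v ∉ T} → V, f.Injective ∧ (∀ v, f v = v ∨ D.Adj v (f v)) ∧ ∀ v, f v ∉ X := by
  classical
  obtain ⟨p, hp, hdisj⟩ := h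
  have huniq : ∀ x ∈ X, ∀ y ∈ X, ∀ v, v ∈ p x → v ∈ p y → x = y := by
    intro x hx y hy v hvx hvy
    by_contra hne
    exact hdisj x hx y hy hne hvx hvy
  let S : V → V → Prop := fun v w ↦ ∃ x ∈ X, ∃ n, (p x)[n]? = some v ∧ (p x)[n + 1]? = some w
  have hmem : ∀ {x : V} {n : ℕ} {v : V}, (p x)[n]? = some v → v ∈ p x :=
    fun h ↦ List.mem_of_getElem? h
  have hidx : ∀ x ∈ X, ∀ (m n : ℕ) (v : V), (p x)[m]? = some v → (p x)[n]? = some v → m = n := by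
    intro x hx m n v hm hn
    have hlt : m < (p x).length := (List.getElem?_eq_some_iff.1 hm).1
    exact (List.getElem?_inj hlt (hp x hx).2.1).1 (hm.trans hn.symm)
  have hadj : ∀ v w, S v w → D.Adj v w := by
    rintro v w ⟨x, hx, n, hv, hw⟩
    obtain ⟨h1, rfl⟩ := List.getElem?_eq_some_iff.1 hv
    obtain ⟨h2, rfl⟩ := List.getElem?_eq_some_iff.1 hw
    exact List.isChain_iff_getElem.1 (hp x hx).1 n h2
  have hinj : ∀ v v' w, S v w → S v' w → v = v' := by
    rintro v v' w ⟨x, hx, n, hv, hw⟩ ⟨y, hy, m, hv', hw'⟩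
    obtain rfl := huniq x hx y hy w (hmem hw) (hmem hw')
    have := hidx x hx _ _ _ hw hw'
    obtain rfl : n = m := by omega
    rw [hv] at hv'
    exact Option.some_injective _ hv'
  have hhead : ∀ x ∈ X, (p x)[0]? = some x := by
    intro x hx
    rw [← List.head?_eq_getElem?]
    exact (hp x hx).2.2.1
  have hX : ∀ v w, S v w → w ∉ X := by
    rintro v w ⟨x, hx, n, hv, hw⟩ hwX
    obtain rfl := huniq x hx w hwX w (hmem hw) (hmem (hhead w hwX))
    have := hidx x hx _ _ _ hw (hhead x hx)
    omega
  have hon : ∀ v w, S v w → ∃ x ∈ X, w ∈ p x := by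
    rintro v w ⟨x, hx, n, hv, hw⟩
    exact ⟨x, hx, hmem hw⟩
  have hsucc : ∀ v, v ∉ T → (∃ x ∈ X, v ∈ p x) → ∃ w, S v w := by
    rintro v hvT ⟨x, hx, hv⟩
    obtain ⟨n, hn⟩ := List.mem_iff_getElem?.1 hv
    obtain ⟨t, ht, hlast⟩ := (hp x hx).2.2.2
    obtain ⟨hlt, rfl⟩ := List.getElem?_eq_some_iff.1 hn
    have hlt' : n + 1 < (p x).length := by
      by_contra hcon
      rw [List.getLast?_eq_getElem?, show (p x).length - 1 = n by omega, hn] at hlast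
      exact hvT (Option.some_injective _ hlast ▸ ht)
    exact ⟨(p x)[n + 1], x, hx, n, hn, List.getElem?_eq_getElem hlt'⟩
  have hex : ∀ v : {v // v ∉ T}, ∃ w, S v w ∨ (w = v ∧ ¬ ∃ x ∈ X, (v : V) ∈ p x) := by
    intro v
    by_cases hv : ∃ x ∈ X, (v : V) ∈ p x
    · obtain ⟨w, hw⟩ := hsucc v v.2 hv
      exact ⟨w, Or.inl hw⟩
    · exact ⟨v, Or.inr ⟨rfl, hv⟩⟩
  choose f hf using hex
  refine ⟨f, fun v v' hvv ↦ Subtype.ext ?_, fun v ↦ ?_, fun v hv ↦ ?_⟩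
  · rcases hf v with h | ⟨h, hn⟩ <;> rcases hf v' with h' | ⟨h', hn'⟩
    · exact hinj _ _ _ h (hvv ▸ h')
    · exact (hn' (by rw [← h', ← hvv]; exact hon _ _ h)).elim
    · exact (hn (by rw [← h, hvv]; exact hon _ _ h')).elim
    · rw [← h, ← h', hvv]
  · rcases hf v with h | ⟨h, -⟩
    · exact Or.inr (hadj _ _ h)
    · exact Or.inl h
  · rcases hf v with h | ⟨h, hn⟩
    · exact hX _ _ h hv
    · rw [h] at hv
      exact hn ⟨v, hv, hmem (hhead v hv)⟩

/-- A matching of the vertices outside `T` that avoids `X` gives pairwise disjoint paths from `X`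
into `T`, namely the orbits of the vertices of `X`. -/
theorem IsLinkedInto.of_matching [Finite V] {D : Digraph V} {X T : Set V} (f : {v // v ∉ T} → V)
    (hf : f.Injective) (hadj : ∀ v, f v = v ∨ D.Adj v (f v)) (hX : ∀ v, f v ∉ X) :
    D.IsLinkedInto X T := by
  classical
  let g : V → V := fun v ↦ if h : v ∉ T then f ⟨v, h⟩ else v
  have hg : ∀ v (h : v ∉ T), g v = f ⟨v, h⟩ := fun v h ↦ dif_pos h
  have hginj : ∀ v w, v ∉ T → w ∉ T → g v = g w → v = w := by
    intro v w hv hw h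
    rw [hg v hv, hg w hw] at h
    exact congrArg Subtype.val (hf h)
  have hgX : ∀ v, v ∉ T → g v ∉ X := fun v hv ↦ hg v hv ▸ hX _
  have hit : ∀ n v, g^[n + 1] v = g (g^[n] v) := fun n v ↦ Function.iterate_succ_apply' g n v
  -- Trace two orbits backwards from a common point. Since `g` is injective off `T`, both indices
  -- decrease together until one is `0`; if the other were still positive, a vertex of `X` would be
  -- a value of `g`, against `hgX`.
  have hcore : ∀ x ∈ X, ∀ y ∈ X, ∀ m n : ℕ, (∀ i < m, g^[i] x ∉ T) → (∀ i < n, g^[i] y ∉ T) →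
      g^[m] x = g^[n] y → m = n ∧ x = y := by
    intro x hx y hy m
    induction m with
    | zero =>
      intro n _ hn h
      cases n with
      | zero => exact ⟨rfl, h⟩
      | succ n =>
        rw [hit] at h
        exact (hgX _ (hn n (by omega)) (h ▸ hx)).elim
    | succ m ih =>
      intro n hm hn h
      cases n with
      | zero =>
        rw [hit] at h
        exact (hgX _ (hm m (by omega)) (by rw [h]; exact hy)).elim
      | succ n =>
        rw [hit, hit] at h
        obtain ⟨h1, h2⟩ := ih n (fun i hi ↦ hm i (by omega)) (fun i hi ↦ hn i (by omega))
          (hginj _ _ (hm m (by omega)) (hn n (by omega)) h)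
        exact ⟨by omega, h2⟩
  -- By `hcore` with `y = x`, an orbit that never meets `T` would have pairwise distinct terms,
  -- which is impossible in a finite vertex set.
  have hreach : ∀ x ∈ X, ∃ n, g^[n] x ∈ T := by
    intro x hx
    by_contra! hcon
    have hinj : Function.Injective fun n ↦ g^[n] x := fun m n h ↦
      (hcore x hx x hx m n (fun i _ ↦ hcon i) (fun i _ ↦ hcon i) h).1
    exact not_injective_infinite_finite _ hinj
  let N : V → ℕ := fun x ↦ if h : ∃ n, g^[n] x ∈ T then Nat.find h else 0
  have hN : ∀ x ∈ X, g^[N x] x ∈ T := by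
    intro x hx
    simp only [N, dif_pos (hreach x hx)]
    exact Nat.find_spec (hreach x hx)
  have hNmin : ∀ x ∈ X, ∀ i < N x, g^[i] x ∉ T := by
    intro x hx i hi
    simp only [N, dif_pos (hreach x hx)] at hi
    exact Nat.find_min (hreach x hx) hi
  have hcore' : ∀ x ∈ X, ∀ y ∈ X, ∀ m n : ℕ, m ≤ N x → n ≤ N y → g^[m] x = g^[n] y →
      m = n ∧ x = y := fun x hx y hy m n hm hn ↦
    hcore x hx y hy m n (fun i hi ↦ hNmin x hx i (by omega)) (fun i hi ↦ hNmin y hy i (by omega))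
  refine ⟨fun x ↦ (List.range (N x + 1)).map fun i ↦ g^[i] x, fun x hx ↦ ⟨?_, ?_, ?_, ?_⟩, ?_⟩
  · rw [List.isChain_map, List.isChain_range_succ]
    intro i hi
    have hiT := hNmin x hx i hi
    change D.Adj (g^[i] x) (g^[i + 1] x)
    have h1 : g^[i + 1] x ≠ g^[i] x := fun h ↦ by
      have := (hcore' x hx x hx (i + 1) i (by omega) (by omega) h).1
      omega
    rw [hit, hg _ hiT] at h1 ⊢
    exact (hadj ⟨_, hiT⟩).resolve_left h1
  · refine List.Nodup.map_on ?_ List.nodup_range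
    intro m hm n hn h
    rw [List.mem_range] at hm hn
    exact (hcore' x hx x hx m n (by omega) (by omega) h).1
  · simp
  · refine ⟨_, hN x hx, ?_⟩
    rw [List.getLast?_map, List.getLast?_range]
    simp
  · intro x hx y hy hne v hv hv'
    simp only [List.mem_map, List.mem_range] at hv hv'
    obtain ⟨m, hm, rfl⟩ := hv
    obtain ⟨n, hn, h⟩ := hv'
    exact hne (hcore' x hx y hy m n (by omega) (by omega) h.symm).2

end Digraph

/-! ### Gammoids as avoidance of transversals, and injective exchange -/

/-- The sets `I ⊆ E` with property `P` are those whose image under an injection into a finite set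
`V` can be avoided by some transversal of a fixed family of subsets of `V`. -/
def IsMatchingRepresentable {α : Type*} (E : Set α) (P : Set α → Prop) : Prop :=
  ∃ (V J : Type) (_ : Finite V) (A : J → Set V) (φ : α → V), InjOn φ E ∧
    ∀ I ⊆ E, P I ↔ ∃ f : J → V, f.Injective ∧ (∀ j, f j ∈ A j) ∧ ∀ j, f j ∉ φ '' I

namespace Matroid

variable {α : Type*} {M N : Matroid α}

theorem IsGammoid.isMatchingRepresentable (h : M.IsGammoid) :
    IsMatchingRepresentable M.E M.Indep := by
  obtain ⟨V, hV, D, T, φ, hφ, h⟩ := h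
  refine ⟨V, {v // v ∉ T}, hV, fun v ↦ {w | w = v ∨ D.Adj v w}, φ, hφ, fun I hI ↦ ?_⟩
  rw [h I hI]
  exact ⟨fun h ↦ h.exists_matching, fun ⟨f, h1, h2, h3⟩ ↦ .of_matching f h1 h2 h3⟩

/-- Independence of the empty set supplies one transversal `f₀`. Draw arcs from `f₀ j` to all
members of `A j` and let `T` be the complement of the range of `f₀`: matchings of the vertices
outside `T` are then the transversals of the family. A matching may fix a vertex, which is harmless
because `f₀ j ∈ A j`. -/
theorem IsGammoid.of_isMatchingRepresentable (h : IsMatchingRepresentable M.E M.Indep) :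
    M.IsGammoid := by
  obtain ⟨V, J, hV, A, φ, hφ, h⟩ := h
  obtain ⟨f₀, hf₀, hA₀, -⟩ := (h ∅ (empty_subset _)).1 M.empty_indep
  let D : Digraph V := ⟨fun v w ↦ ∃ j, f₀ j = v ∧ w ∈ A j⟩
  refine ⟨V, hV, D, (range f₀)ᶜ, φ, hφ, fun I hI ↦ ?_⟩
  have hnot : ∀ j, f₀ j ∉ (range f₀)ᶜ := fun j hj ↦ hj ⟨j, rfl⟩
  rw [h I hI]
  constructor
  · rintro ⟨f, hf, hA, hX⟩
    have hex : ∀ v : {v // v ∉ (range f₀)ᶜ}, ∃ j, f₀ j = v := fun v ↦ not_not.1 v.2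
    choose k hk using hex
    refine .of_matching (fun v ↦ f (k v)) (fun v w hvw ↦ Subtype.ext ?_) (fun v ↦ ?_)
      (fun v ↦ hX _)
    · rw [← hk v, ← hk w, hf hvw]
    · exact Or.inr ⟨k v, hk v, hA _⟩
  · intro hl
    obtain ⟨f, hf, hadj, hX⟩ := hl.exists_matching
    refine ⟨fun j ↦ f ⟨f₀ j, hnot j⟩, fun i j hij ↦ ?_, fun j ↦ ?_, fun j ↦ hX _⟩
    · exact hf₀ (congrArg Subtype.val (hf hij))
    · rcases hadj ⟨f₀ j, hnot j⟩ with h' | ⟨i, hi, hmem⟩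
      · exact (congrArg (· ∈ A j) h').mpr (hA₀ j)
      · exact hf₀ hi ▸ hmem

theorem IsGammoid.finite_ground (h : M.IsGammoid) : M.E.Finite := by
  obtain ⟨V, hV, D, T, φ, hφ, -⟩ := h
  exact Set.Finite.of_finite_image (Set.toFinite _) hφ

/-- The injective exchange property: each element `x` of an independent set `I` that is spanned by
another independent set `J`, but not in `J`, can be exchanged symmetrically with an element `ψ x`
of `J`, where `ψ` is injective. -/
def HasInjectiveExchange (M : Matroid α) : Prop :=
  ∀ I J, M.Indep I → M.Indep J → ∃ ψ : α → α,
    InjOn ψ {x ∈ I \ J | ¬ M.Indep (insert x J)} ∧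
    ∀ x ∈ I \ J, ¬ M.Indep (insert x J) → ψ x ∈ J \ I ∧
      M.Indep (insert (ψ x) (I \ {x})) ∧ M.Indep (insert x (J \ {ψ x}))

/-- Take transversals `f₁`, `f₂` avoiding `I₁`, `I₂`. The arcs `f₂ j → f₁ j` have in-degree and
out-degree at most one, and `φ x` is an initial vertex for `x ∈ I₁`. If the path from `φ x` does not
end in a suitable `φ y` with `y ∈ I₂`, swapping along it shows that `x` can be added to `I₂`;
otherwise `y` is the partner of `x`. Different initial vertices have different ends, whence
injectivity. -/
theorem IsGammoid.hasInjectiveExchange (h : M.IsGammoid) : M.HasInjectiveExchange := by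
  classical
  intro I₁ I₂ hI₁ hI₂
  have hE₁ := hI₁.subset_ground
  have hE₂ := hI₂.subset_ground
  obtain ⟨V, J, hV, A, φ, hφ, h⟩ := h.isMatchingRepresentable
  obtain ⟨f₁, hf₁, hA₁, hav₁⟩ := (h _ hE₁).1 hI₁
  obtain ⟨f₂, hf₂, hA₂, hav₂⟩ := (h _ hE₂).1 hI₂
  let s : V → V → Prop := fun v w ↦ ∃ j, f₂ j = v ∧ f₁ j = w
  have hfun : Relator.RightUnique s := by
    rintro a b c ⟨i, hi, rfl⟩ ⟨j, hj, rfl⟩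
    rw [hf₂ (hi.trans hj.symm)]
  have hcofun : Relator.RightUnique (Function.swap s) := by
    rintro a b c ⟨i, rfl, hi⟩ ⟨j, rfl, hj⟩
    rw [hf₁ (hi.trans hj.symm)]
  have hterm : ∀ u v, u ∉ range f₂ → Relation.ReflTransGen s u v → u = v := by
    intro u v hu huv
    rcases huv.cases_head with h | ⟨w, ⟨j, hj, -⟩, -⟩
    · exact h
    · exact (hu ⟨j, hj⟩).elim
  have hinit : ∀ u v, v ∉ range f₁ → Relation.ReflTransGen s u v → u = v := by
    intro u v hu huv
    rcases huv.cases_tail with h | ⟨w, -, ⟨j, -, hj⟩⟩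
    · exact h.symm
    · exact (hu ⟨j, hj⟩).elim
  have hI₁f : ∀ x ∈ I₁, φ x ∉ range f₁ := by
    rintro x hx ⟨j, hj⟩
    exact hav₁ j ⟨x, hx, hj.symm⟩
  have hI₂f : ∀ x ∈ I₂, φ x ∉ range f₂ := by
    rintro x hx ⟨j, hj⟩
    exact hav₂ j ⟨x, hx, hj.symm⟩
  have key : ∀ x ∈ I₁ \ I₂, ¬ M.Indep (insert x I₂) → ∃ y ∈ I₂ \ I₁,
      Relation.ReflTransGen s (φ x) (φ y) ∧
      M.Indep (insert y (I₁ \ {x})) ∧ M.Indep (insert x (I₂ \ {y})) := by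
    intro x hx hdep
    have hxE := hE₁ hx.1
    let O : Set V := {v | Relation.ReflTransGen s (φ x) v}
    have hO₁ : ∀ j, f₂ j ∈ O → f₁ j ∈ O := fun j hj ↦
      Relation.ReflTransGen.tail (b := f₂ j) hj ⟨j, rfl, rfl⟩
    have hO₂ : ∀ j, f₁ j ∈ O → f₂ j ∈ O := by
      intro j hj
      rcases Relation.ReflTransGen.cases_tail hj with h | ⟨w, hw, ⟨i, rfl, hi⟩⟩
      · exact (hI₁f x hx.1 ⟨j, h⟩).elim
      · rwa [← hf₁ hi]
    have hxO : φ x ∈ O := Relation.ReflTransGen.refl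
    have hend : ∀ u ∈ O, ∀ v ∈ O, u ∉ range f₂ → v ∉ range f₂ → u = v := by
      intro u hu v hv hu' hv'
      rcases Relation.ReflTransGen.total_of_right_unique hfun hu hv with h | h
      · exact hterm _ _ hu' h
      · exact (hterm _ _ hv' h).symm
    -- Swap the transversals along the path `O`: `g₂` leaves `φ x` free and may occupy the end of
    -- the path, whereas `g₁` leaves the end free and may occupy `φ x`.
    let g₂ : J → V := fun j ↦ if f₂ j ∈ O then f₁ j else f₂ j
    let g₁ : J → V := fun j ↦ if f₂ j ∈ O then f₂ j else f₁ j
    have hg₂ : g₂.Injective := by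
      intro i j hij
      by_cases hi : f₂ i ∈ O <;> by_cases hj : f₂ j ∈ O <;> simp only [g₂, hi, hj, if_true, if_false] at hij
      · exact hf₁ hij
      · exact (hj (hij ▸ hO₁ i hi)).elim
      · exact (hi (hij ▸ hO₁ j hj)).elim
      · exact hf₂ hij
    have hg₁ : g₁.Injective := by
      intro i j hij
      by_cases hi : f₂ i ∈ O <;> by_cases hj : f₂ j ∈ O <;> simp only [g₁, hi, hj, if_true, if_false] at hij
      · exact hf₂ hij
      · exact (hj (hO₂ j (hij ▸ hi))).elim
      · exact (hi (hO₂ i (hij ▸ hj))).elim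
      · exact hf₁ hij
    have hgA₂ : ∀ j, g₂ j ∈ A j := by
      intro j
      by_cases hj : f₂ j ∈ O <;> simp only [g₂, hj, if_true, if_false, hA₁, hA₂]
    have hgA₁ : ∀ j, g₁ j ∈ A j := by
      intro j
      by_cases hj : f₂ j ∈ O <;> simp only [g₁, hj, if_true, if_false, hA₁, hA₂]
    have hg₂x : ∀ j, g₂ j ≠ φ x := by
      intro j hjx
      by_cases hj : f₂ j ∈ O <;> simp only [g₂, hj, if_true, if_false] at hjx
      · exact hI₁f x hx.1 ⟨j, hjx⟩
      · exact hj (hjx ▸ hxO)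
    obtain ⟨y, hy, hyO, j₀, hj₀⟩ : ∃ y ∈ I₂, φ y ∈ O ∧ ∃ j, f₁ j = φ y := by
      by_contra! hcon
      refine hdep ((h _ (insert_subset hxE hE₂)).2 ⟨g₂, hg₂, hgA₂, ?_⟩)
      rintro j ⟨y, rfl | hy, hyj⟩
      · exact hg₂x j hyj.symm
      by_cases hj : f₂ j ∈ O <;> simp only [g₂, hj, if_true, if_false] at hyj
      · exact hcon y hy (hyj ▸ hO₁ j hj) j hyj.symm
      · exact hI₂f y hy ⟨j, hyj.symm⟩
    have hy₁ : y ∉ I₁ := fun hy₁ ↦ hI₁f y hy₁ ⟨j₀, hj₀⟩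
    refine ⟨y, ⟨hy, hy₁⟩, hyO, ?_, ?_⟩
    · refine (h _ (insert_subset (hE₂ hy) (sdiff_subset.trans hE₁))).2 ⟨g₁, hg₁, hgA₁, ?_⟩
      rintro j ⟨z, rfl | hz, hzj⟩
      · by_cases hj : f₂ j ∈ O <;> simp only [g₁, hj, if_true, if_false] at hzj
        · exact hI₂f z hy ⟨j, hzj.symm⟩
        · exact hj (hO₂ j (hzj ▸ hyO))
      · by_cases hj : f₂ j ∈ O <;> simp only [g₁, hj, if_true, if_false] at hzj
        · have := hinit _ _ (hI₁f z hz.1) (show Relation.ReflTransGen s (φ x) (φ z) from hzj ▸ hj)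
          exact hz.2 (hφ hxE (hE₁ hz.1) this).symm
        · exact hI₁f z hz.1 ⟨j, hzj.symm⟩
    · refine (h _ (insert_subset hxE (sdiff_subset.trans hE₂))).2 ⟨g₂, hg₂, hgA₂, ?_⟩
      rintro j ⟨z, rfl | hz, hzj⟩
      · exact hg₂x j hzj.symm
      · by_cases hj : f₂ j ∈ O <;> simp only [g₂, hj, if_true, if_false] at hzj
        · have := hend _ (hzj ▸ hO₁ j hj : φ z ∈ O) _ hyO (hI₂f z hz.1) (hI₂f y hy)
          exact hz.2 (hφ (hE₂ hz.1) (hE₂ hy) this)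
        · exact hI₂f z hz.1 ⟨j, hzj.symm⟩
  choose! ψ hψ using key
  refine ⟨ψ, ?_, fun x hx hdep ↦ ⟨(hψ x hx hdep).1, (hψ x hx hdep).2.2⟩⟩
  rintro x ⟨hx, hdx⟩ x' ⟨hx', hdx'⟩ heq
  have h₁ := (hψ x hx hdx).2.1
  have h₂ := (hψ x' hx' hdx').2.1
  rw [← heq] at h₂
  refine hφ (hE₁ hx.1) (hE₁ hx'.1) ?_
  -- Of two paths with a common end, one continues the other backwards; but nothing enters `φ x` or
  -- `φ x'`, so the starting points coincide.
  rcases Relation.ReflTransGen.total_of_right_unique hcofun h₁.swap h₂.swap with h | h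
  · exact (hinit _ _ (hI₁f x hx.1) h.swap).symm
  · exact hinit _ _ (hI₁f x' hx'.1) h.swap

theorem HasInjectiveExchange.delete (h : M.HasInjectiveExchange) (D : Set α) :
    (M ＼ D).HasInjectiveExchange := by
  intro I J hI hJ
  rw [delete_indep_iff] at hI hJ
  obtain ⟨ψ, hψ, h⟩ := h I J hI.1 hJ.1
  have hdep : ∀ x ∈ I \ J, ¬ (M ＼ D).Indep (insert x J) → ¬ M.Indep (insert x J) := by
    intro x hx hd hi
    refine hd (delete_indep_iff.2 ⟨hi, ?_⟩)
    rw [disjoint_insert_left]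
    exact ⟨fun hxD ↦ disjoint_left.1 hI.2 hx.1 hxD, hJ.2⟩
  refine ⟨ψ, hψ.mono fun x hx ↦
    show _ ∧ _ from ⟨hx.1, hdep x hx.1 hx.2⟩, fun x hx hd ↦ ?_⟩
  obtain ⟨h1, h2, h3⟩ := h x hx (hdep x hx hd)
  refine ⟨h1, delete_indep_iff.2 ⟨h2, ?_⟩, delete_indep_iff.2 ⟨h3, ?_⟩⟩
  · rw [disjoint_insert_left]
    exact ⟨fun hxD ↦ disjoint_left.1 hJ.2 h1.1 hxD, hI.2.mono_left sdiff_subset⟩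
  · rw [disjoint_insert_left]
    exact ⟨fun hxD ↦ disjoint_left.1 hI.2 hx.1 hxD, hJ.2.mono_left sdiff_subset⟩

/-- Contracting `K` is contracting a basis `L` of `K` and deleting the rest. For the independent set
`L`, exchange between `I ∪ L` and `J ∪ L` works: `ψ x` avoids `I ∪ L`, so it never falls into `L`.
-/
theorem HasInjectiveExchange.contract (h : M.HasInjectiveExchange) (K : Set α) :
    (M ／ K).HasInjectiveExchange := by
  obtain ⟨L, hL⟩ := M.exists_isBasis' K
  rw [hL.contract_eq_contract_delete]
  refine HasInjectiveExchange.delete ?_ _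
  intro I J hI hJ
  rw [hL.indep.contract_indep_iff] at hI hJ
  obtain ⟨ψ, hψ, h⟩ := h _ _ hI.2 hJ.2
  have hmem : ∀ x ∈ I \ J, x ∈ (I ∪ L) \ (J ∪ L) := fun x hx ↦
    ⟨Or.inl hx.1, fun h ↦ h.elim hx.2 fun h ↦ disjoint_left.1 hI.1 hx.1 h⟩
  have hdep : ∀ x ∈ I \ J, ¬ (M ／ L).Indep (insert x J) → ¬ M.Indep (insert x (J ∪ L)) := by
    intro x hx hd hi
    refine hd (hL.indep.contract_indep_iff.2 ⟨?_, by rwa [insert_union]⟩)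
    rw [disjoint_insert_left]
    exact ⟨disjoint_left.1 hI.1 hx.1, hJ.1⟩
  refine ⟨ψ, hψ.mono fun x hx ↦
    show _ ∧ _ from ⟨hmem x hx.1, hdep x hx.1 hx.2⟩, fun x hx hd ↦ ?_⟩
  obtain ⟨h1, h2, h3⟩ := h x (hmem x hx) (hdep x hx hd)
  have hψL : ψ x ∉ L := fun hL ↦ h1.2 (Or.inr hL)
  have hxL := disjoint_left.1 hI.1 hx.1
  refine ⟨⟨h1.1.resolve_right hψL, fun hI ↦ h1.2 (Or.inl hI)⟩, ?_, ?_⟩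
  · refine hL.indep.contract_indep_iff.2 ⟨?_, ?_⟩
    · rw [disjoint_insert_left]
      exact ⟨hψL, hI.1.mono_left sdiff_subset⟩
    · rwa [union_sdiff_distrib, sdiff_singleton_eq_self hxL, ← insert_union] at h2
  · refine hL.indep.contract_indep_iff.2 ⟨?_, ?_⟩
    · rw [disjoint_insert_left]
      exact ⟨hxL, hJ.1.mono_left sdiff_subset⟩
    · rwa [union_sdiff_distrib, sdiff_singleton_eq_self hψL, ← insert_union] at h3

end Matroid

/-! ### Extensions of matching representations -/

namespace IsMatchingRepresentable

variable {α : Type*} {E : Set α} {P Q : Set α → Prop} {a e : α}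

/-- The new point `none` gets a set of its own, `{none}`, so that every transversal occupies it. -/
theorem loop_extension (h : IsMatchingRepresentable E P)
    (hQ : ∀ I ⊆ insert e E, Q I ↔ e ∉ I ∧ P I) : IsMatchingRepresentable (insert e E) Q := by
  classical
  obtain ⟨V, J, hV, A, φ, hφ, h⟩ := h
  refine ⟨Option V, Option J, inferInstance, fun j ↦ j.elim {none} fun j ↦ some '' A j,
    fun i ↦ if i = e then none else some (φ i), ?_, fun I hI ↦ ?_⟩
  · intro i hi j hj hij
    by_cases h1 : i = e <;> by_cases h2 : j = e <;> simp [h1, h2] at hij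
    · rw [h1, h2]
    · exact hφ (hi.resolve_left h1) (hj.resolve_left h2) hij
  rw [hQ I hI]
  constructor
  · rintro ⟨heI, hP⟩
    have hIE : I ⊆ E := fun i hi ↦ (hI hi).resolve_left fun h ↦ heI (h ▸ hi)
    obtain ⟨f, hf, hA, hX⟩ := (h I hIE).1 hP
    refine ⟨fun j ↦ j.map f, Option.map_injective hf, ?_, ?_⟩
    · rintro (_ | j)
      · rfl
      · exact ⟨_, hA j, rfl⟩
    · rintro (_ | j) ⟨i, hi, hij⟩
      · by_cases h1 : i = e <;> simp [h1] at hij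
        exact heI (h1 ▸ hi)
      · by_cases h1 : i = e <;> simp [h1] at hij
        exact hX j ⟨i, hi, hij⟩
  · rintro ⟨f, hf, hA, hX⟩
    have heI : e ∉ I := fun heI ↦ hX none ⟨e, heI, by simpa using (hA none).symm⟩
    have hIE : I ⊆ E := fun i hi ↦ (hI hi).resolve_left fun h ↦ heI (h ▸ hi)
    refine ⟨heI, (h I hIE).2 ?_⟩
    have hA' : ∀ j, ∃ v ∈ A j, some v = f (some j) := fun j ↦ hA (some j)
    choose g hgA hg using hA'
    refine ⟨g, fun i j hij ↦ ?_, hgA, ?_⟩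
    · exact Option.some_injective _ (hf (by rw [← hg, ← hg, hij]))
    · rintro j ⟨i, hi, hij⟩
      refine hX (some j) ⟨i, hi, ?_⟩
      rw [← hg, ← hij]
      have hie : i ≠ e := fun h ↦ heI (h ▸ hi)
      exact if_neg hie

/-- The new point lies in none of the sets, so it is always avoided. -/
theorem coloop_extension (h : IsMatchingRepresentable E P)
    (hQ : ∀ I ⊆ insert e E, Q I ↔ P (I \ {e})) : IsMatchingRepresentable (insert e E) Q := by
  classical
  obtain ⟨V, J, hV, A, φ, hφ, h⟩ := h
  refine ⟨Option V, J, inferInstance, fun j ↦ some '' A j,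
    fun i ↦ if i = e then none else some (φ i), ?_, fun I hI ↦ ?_⟩
  · intro i hi j hj hij
    by_cases h1 : i = e <;> by_cases h2 : j = e <;> simp [h1, h2] at hij
    · rw [h1, h2]
    · exact hφ (hi.resolve_left h1) (hj.resolve_left h2) hij
  have hIE : I \ {e} ⊆ E := fun i hi ↦ (hI hi.1).resolve_left hi.2
  rw [hQ I hI, h _ hIE]
  constructor
  · rintro ⟨f, hf, hA, hX⟩
    refine ⟨fun j ↦ some (f j), fun i j hij ↦ hf (Option.some_injective _ hij),
      fun j ↦ ⟨_, hA j, rfl⟩, ?_⟩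
    rintro j ⟨i, hi, hij⟩
    by_cases h1 : i = e <;> simp [h1] at hij
    exact hX j ⟨i, ⟨hi, h1⟩, hij⟩
  · rintro ⟨f, hf, hA, hX⟩
    choose g hgA hg using hA
    refine ⟨g, fun i j hij ↦ hf (by rw [← hg, ← hg, hij]), hgA, ?_⟩
    rintro j ⟨i, hi, hij⟩
    refine hX j ⟨i, hi.1, ?_⟩
    rw [← hg, ← hij]
    exact if_neg hi.2

/-- The additional set consists of the points of `e` and `a`, so one of them is always occupied. If
`e` has to be avoided, the set takes `φ a`, and the other representatives must avoid `φ a` as well.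
-/
theorem parallel_extension (h : IsMatchingRepresentable E P) (he : e ∉ E) (ha : a ∈ E)
    (hQ : ∀ I ⊆ insert e E,
      Q I ↔ (e ∉ I ∧ P I) ∨ (e ∈ I ∧ a ∉ I ∧ P (insert a (I \ {e})))) :
    IsMatchingRepresentable (insert e E) Q := by
  classical
  obtain ⟨V, J, hV, A, φ, hφ, h⟩ := h
  have hae : a ≠ e := fun h ↦ he (h ▸ ha)
  refine ⟨Option V, Option J, inferInstance,
    fun j ↦ j.elim {none, some (φ a)} fun j ↦ some '' A j,
    fun i ↦ if i = e then none else some (φ i), ?_, fun I hI ↦ ?_⟩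
  · intro i hi j hj hij
    by_cases h1 : i = e <;> by_cases h2 : j = e <;> simp [h1, h2] at hij
    · rw [h1, h2]
    · exact hφ (hi.resolve_left h1) (hj.resolve_left h2) hij
  have hIE : I \ {e} ⊆ E := fun i hi ↦ (hI hi.1).resolve_left hi.2
  have hIE' : insert a (I \ {e}) ⊆ E := insert_subset ha hIE
  rw [hQ I hI]
  constructor
  · rintro (⟨heI, hP⟩ | ⟨heI, haI, hP⟩)
    · rw [← sdiff_singleton_eq_self heI] at hP
      obtain ⟨f, hf, hA, hX⟩ := (h _ hIE).1 hP
      refine ⟨fun j ↦ j.map f, Option.map_injective hf, ?_, ?_⟩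
      · rintro (_ | j)
        · exact Or.inl rfl
        · exact ⟨_, hA j, rfl⟩
      · rintro (_ | j) ⟨i, hi, hij⟩
        · by_cases h1 : i = e <;> simp [h1] at hij
          exact heI (h1 ▸ hi)
        · by_cases h1 : i = e <;> simp [h1] at hij
          exact hX j ⟨i, ⟨hi, h1⟩, hij⟩
    · obtain ⟨f, hf, hA, hX⟩ := (h _ hIE').1 hP
      refine ⟨fun j ↦ j.elim (some (φ a)) fun j ↦ some (f j), ?_, ?_, ?_⟩
      · rintro (_ | i) (_ | j) hij
        · rfl
        · exact (hX j ⟨a, Or.inl rfl, Option.some_injective _ hij⟩).elim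
        · exact (hX i ⟨a, Or.inl rfl, (Option.some_injective _ hij).symm⟩).elim
        · rw [hf (Option.some_injective _ hij)]
      · rintro (_ | j)
        · exact Or.inr rfl
        · exact ⟨_, hA j, rfl⟩
      · rintro (_ | j) ⟨i, hi, hij⟩
        · by_cases h1 : i = e <;> simp [h1] at hij
          exact haI (hφ (hIE ⟨hi, h1⟩) ha hij ▸ hi)
        · by_cases h1 : i = e <;> simp [h1] at hij
          exact hX j ⟨i, Or.inr ⟨hi, h1⟩, hij⟩
  · rintro ⟨f, hf, hA, hX⟩
    have hA' : ∀ j, ∃ v ∈ A j, some v = f (some j) := fun j ↦ hA (some j)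
    choose g hgA hg using hA'
    have hginj : g.Injective := fun i j hij ↦
      Option.some_injective _ (hf (by rw [← hg, ← hg, hij]))
    have hgX : ∀ j, g j ∉ φ '' (I \ {e}) := by
      rintro j ⟨i, hi, hij⟩
      refine hX (some j) ⟨i, hi.1, ?_⟩
      rw [← hg, ← hij]
      exact if_neg hi.2
    by_cases heI : e ∈ I
    · have hnone : f none = some (φ a) := (hA none).resolve_left fun h ↦
        hX none ⟨e, heI, by rw [h]; simp⟩
      refine Or.inr ⟨heI, fun haI ↦ ?_, (h _ hIE').2 ⟨g, hginj, hgA, ?_⟩⟩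
      · exact hX none ⟨a, haI, by rw [hnone]; simp [hae]⟩
      · rintro j ⟨i, rfl | hi, hij⟩
        · have := hf ((hg j).symm.trans ((congrArg some hij.symm).trans hnone.symm))
          cases this
        · exact hgX j ⟨i, hi, hij⟩
    · rw [sdiff_singleton_eq_self heI] at hgX hIE
      exact Or.inl ⟨heI, (h _ hIE).2 ⟨g, hginj, hgA, hgX⟩⟩

/-- Both `a` and `e` move to fresh points, while the old place `φ a` stays as an unlabelled point;
the additional set consists of these three. Only if `a` and `e` both have to be avoided must it take
`φ a`, so that the other representatives are kept off `φ a`, as if avoiding the old `a`. -/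
theorem series_extension (h : IsMatchingRepresentable E P) (he : e ∉ E) (ha : a ∈ E)
    (hQ : ∀ I ⊆ insert e E,
      Q I ↔ (a ∈ I ∧ e ∈ I ∧ P (I \ {e})) ∨ (¬ (a ∈ I ∧ e ∈ I) ∧ P (I \ {a, e}))) :
    IsMatchingRepresentable (insert e E) Q := by
  classical
  obtain ⟨V, J, hV, A, φ, hφ, h⟩ := h
  have hae : a ≠ e := fun h ↦ he (h ▸ ha)
  let φ' : α → V ⊕ Bool := fun i ↦
    if i = e then .inr true else if i = a then .inr false else .inl (φ i)
  have hφe : φ' e = .inr true := if_pos rfl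
  have hφa : φ' a = .inr false := (if_neg hae).trans (if_pos rfl)
  have hφi : ∀ i, i ≠ e → i ≠ a → φ' i = .inl (φ i) := fun i h1 h2 ↦
    (if_neg h1).trans (if_neg h2)
  refine ⟨V ⊕ Bool, Option J, inferInstance,
    fun j ↦ j.elim {.inl (φ a), .inr true, .inr false} fun j ↦ .inl '' A j, φ', ?_,
    fun I hI ↦ ?_⟩
  · intro i hi j hj hij
    by_cases h1 : i = e <;> by_cases h2 : j = e <;> by_cases h3 : i = a <;>
      by_cases h4 : j = a <;> simp [φ', h1, h2, h3, h4, hae] at hij ⊢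
    exact hφ (hi.resolve_left h1) (hj.resolve_left h2) hij
  have hIE : I \ {e} ⊆ E := fun i hi ↦ (hI hi.1).resolve_left hi.2
  have hIE' : I \ {a, e} ⊆ E := fun i hi ↦ hIE ⟨hi.1, fun h ↦ hi.2 (Or.inr h)⟩
  have hinl : ∀ {i v}, φ' i = .inl v → (i ≠ e ∧ i ≠ a) ∧ φ i = v := by
    intro i v h
    by_cases h1 : i = e
    · rw [h1, hφe] at h
      cases h
    by_cases h2 : i = a
    · rw [h2, hφa] at h
      cases h
    rw [hφi i h1 h2] at h
    exact ⟨⟨h1, h2⟩, Sum.inl_injective h⟩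
  rw [hQ I hI]
  constructor
  · rintro (⟨haI, heI, hP⟩ | ⟨hae', hP⟩)
    · obtain ⟨f, hf, hA, hX⟩ := (h _ hIE).1 hP
      refine ⟨fun j ↦ j.elim (.inl (φ a)) fun j ↦ .inl (f j), ?_, ?_, ?_⟩
      · rintro (_ | i) (_ | j) hij
        · rfl
        · exact (hX j ⟨a, ⟨haI, hae⟩, Sum.inl_injective hij⟩).elim
        · exact (hX i ⟨a, ⟨haI, hae⟩, (Sum.inl_injective hij).symm⟩).elim
        · rw [hf (Sum.inl_injective hij)]
      · rintro (_ | j)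
        · exact Or.inl rfl
        · exact ⟨_, hA j, rfl⟩
      · rintro (_ | j) ⟨i, hi, hij⟩
        · obtain ⟨⟨h1, h2⟩, h3⟩ := hinl hij
          exact h2 (hφ (hIE ⟨hi, h1⟩) ha h3)
        · obtain ⟨⟨h1, h2⟩, h3⟩ := hinl hij
          exact hX j ⟨i, ⟨hi, h1⟩, h3⟩
    · obtain ⟨f, hf, hA, hX⟩ := (h _ hIE').1 hP
      obtain ⟨b, hb⟩ : ∃ b : Bool, .inr b ∉ φ' '' I := by
        by_cases haI : a ∈ I
        · refine ⟨true, ?_⟩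
          rintro ⟨i, hi, h⟩
          by_cases h1 : i = e
          · exact hae' ⟨haI, h1 ▸ hi⟩
          · by_cases h2 : i = a <;> simp [φ', h1, h2, hae] at h
        · refine ⟨false, ?_⟩
          rintro ⟨i, hi, h⟩
          by_cases h2 : i = a
          · exact haI (h2 ▸ hi)
          · by_cases h1 : i = e <;> simp [φ', h1, h2] at h
      refine ⟨fun j ↦ j.elim (.inr b) fun j ↦ .inl (f j), ?_, ?_, ?_⟩
      · rintro (_ | i) (_ | j) hij
        · rfl
        · cases hij
        · cases hij
        · rw [hf (Sum.inl_injective hij)]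
      · rintro (_ | j)
        · cases b <;> simp
        · exact ⟨_, hA j, rfl⟩
      · rintro (_ | j) hj
        · exact hb hj
        · obtain ⟨i, hi, hij⟩ := hj
          obtain ⟨⟨h1, h2⟩, h3⟩ := hinl hij
          exact hX j ⟨i, ⟨hi, fun h ↦ h.elim h2 h1⟩, h3⟩
  · rintro ⟨f, hf, hA, hX⟩
    have hA' : ∀ j, ∃ v ∈ A j, .inl v = f (some j) := fun j ↦ hA (some j)
    choose g hgA hg using hA'
    have hginj : g.Injective := fun i j hij ↦
      Option.some_injective _ (hf (by rw [← hg, ← hg, hij]))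
    have hgX : ∀ j, g j ∉ φ '' (I \ {a, e}) := by
      rintro j ⟨i, hi, hij⟩
      refine hX (some j) ⟨i, hi.1, ?_⟩
      rw [← hg, ← hij]
      exact hφi i (fun h ↦ hi.2 (Or.inr h)) fun h ↦ hi.2 (Or.inl h)
    by_cases hae' : a ∈ I ∧ e ∈ I
    · refine Or.inl ⟨hae'.1, hae'.2, (h _ hIE).2 ⟨g, hginj, hgA, ?_⟩⟩
      rintro j ⟨i, hi, hij⟩
      by_cases hia : i = a
      · rcases hA none with h0 | h0 | h0
        · have := hf ((hg j).symm.trans ((congrArg Sum.inl (hia ▸ hij).symm).trans h0.symm))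
          cases this
        · exact hX none ⟨e, hae'.2, hφe.trans h0.symm⟩
        · exact hX none ⟨a, hae'.1, hφa.trans h0.symm⟩
      · exact hgX j ⟨i, ⟨hi.1, fun h ↦ h.elim hia hi.2⟩, hij⟩
    · exact Or.inr ⟨hae', (h _ hIE').2 ⟨g, hginj, hgA, hgX⟩⟩

end IsMatchingRepresentable

/-! ### Orthogonal pairs of binary codes -/

/-- `C` and `R` are orthogonal complements of each other, as sets of vectors over `GF(2)` whose
coordinates are indexed by `E`; the values of the vectors outside `E` play no role. For a binary
matroid on `E`, these are the cycle space and the cocycle space. -/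
structure OrthoPair {α : Type*} (E : Finset α) (C R : Set (α → ZMod 2)) : Prop where
  mem_left : ∀ c, c ∈ C ↔ ∀ r ∈ R, ∑ i ∈ E, r i * c i = 0
  mem_right : ∀ r, r ∈ R ↔ ∀ c ∈ C, ∑ i ∈ E, r i * c i = 0

/-- The vectors that agree outside `D` with a vector of `C` that vanishes on `D`. -/
def shortenCode {α : Type*} (C : Set (α → ZMod 2)) (D : Set α) : Set (α → ZMod 2) :=
  {c | ∃ c' ∈ C, (∀ i ∈ D, c' i = 0) ∧ ∀ i ∉ D, c' i = c i}

/-- The vectors that agree outside `D` with a vector of `C`. -/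
def punctureCode {α : Type*} (C : Set (α → ZMod 2)) (D : Set α) : Set (α → ZMod 2) :=
  {c | ∃ c' ∈ C, ∀ i ∉ D, c' i = c i}

theorem ZMod.eq_zero_or_eq_one_of_two : ∀ x : ZMod 2, x = 0 ∨ x = 1 := by decide

theorem ZMod.ne_zero_iff_of_two : ∀ x : ZMod 2, x ≠ 0 ↔ x = 1 := by decide

namespace OrthoPair

variable {α : Type*} {E : Finset α} {C R : Set (α → ZMod 2)} {c c' r : α → ZMod 2} {a b e : α}

theorem symm (h : OrthoPair E C R) : OrthoPair E R C :=
  ⟨fun r ↦ by simpa only [mul_comm] using h.mem_right r,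
    fun c ↦ by simpa only [mul_comm] using h.mem_left c⟩

theorem sum_eq_zero (h : OrthoPair E C R) (hr : r ∈ R) (hc : c ∈ C) : ∑ i ∈ E, r i * c i = 0 :=
  (h.mem_left c).1 hc r hr

theorem zero_mem (h : OrthoPair E C R) : 0 ∈ C := (h.mem_left 0).2 (by simp)

theorem add_mem (h : OrthoPair E C R) (hc : c ∈ C) (hc' : c' ∈ C) : c + c' ∈ C := by
  refine (h.mem_left _).2 fun r hr ↦ ?_
  simp only [Pi.add_apply, mul_add, Finset.sum_add_distrib]
  rw [h.sum_eq_zero hr hc, h.sum_eq_zero hr hc', add_zero]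

theorem smul_mem (h : OrthoPair E C R) (t : ZMod 2) (hc : c ∈ C) : t • c ∈ C := by
  rcases ZMod.eq_zero_or_eq_one_of_two t with rfl | rfl
  · rw [zero_smul]
    exact h.zero_mem
  · rwa [one_smul]

theorem congr_mem (h : OrthoPair E C R) (hc : c ∈ C) (hcc : ∀ i ∈ E, c i = c' i) : c' ∈ C := by
  refine (h.mem_left _).2 fun r hr ↦ ?_
  rw [← h.sum_eq_zero hr hc]
  exact Finset.sum_congr rfl fun i hi ↦ by rw [hcc i hi]

theorem delete_singleton [DecidableEq α] (h : OrthoPair E C R) (he : e ∈ E) :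
    OrthoPair (E.erase e) (shortenCode C {e}) (punctureCode R {e}) := by
  have hsum : ∀ f : α → ZMod 2, ∑ i ∈ E, f i = f e + ∑ i ∈ E.erase e, f i := fun f ↦
    (Finset.add_sum_erase E f he).symm
  have horth : ∀ c ∈ shortenCode C {e}, ∀ r ∈ punctureCode R {e},
      ∑ i ∈ E.erase e, r i * c i = 0 := by
    rintro c ⟨c', hc', h0, hcc⟩ r ⟨r', hr', hrr⟩
    have := h.sum_eq_zero hr' hc'
    rw [hsum, h0 e rfl, mul_zero, zero_add] at this
    rw [← this]
    refine Finset.sum_congr rfl fun i hi ↦ ?_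
    have hie : i ∉ ({e} : Set α) := Finset.ne_of_mem_erase hi
    rw [hcc i hie, hrr i hie]
  refine ⟨fun c ↦ ⟨horth c, fun hc ↦ ⟨Function.update c e 0, ?_, ?_, ?_⟩⟩,
    fun r ↦ ⟨fun hr c hc ↦ horth c hc r hr, fun hr ↦ ?_⟩⟩
  · refine (h.mem_left _).2 fun r hr ↦ ?_
    rw [hsum, Function.update_self, mul_zero, zero_add, ← hc r ⟨r, hr, fun _ _ ↦ rfl⟩]
    refine Finset.sum_congr rfl fun i hi ↦ ?_
    rw [Function.update_of_ne (Finset.ne_of_mem_erase hi)]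
  · rintro i rfl
    exact Function.update_self ..
  · intro i hi
    exact Function.update_of_ne hi ..
  -- The vector `r` is orthogonal to the vectors of `C` that vanish at `e`. If some `c₀` in `C` has
  -- `c₀ e = 1`, choosing the value of `r` at `e` to make it orthogonal to `c₀` suffices, since any
  -- `c` with `c e = 1` differs from `c₀` by a vector vanishing at `e`.
  by_cases hex : ∃ c₀ ∈ C, c₀ e = 1
  · obtain ⟨c₀, hc₀, h₀⟩ := hex
    refine ⟨Function.update r e (∑ i ∈ E.erase e, r i * c₀ i), (h.mem_right _).2 fun c hc ↦ ?_,
      fun i hi ↦ Function.update_of_ne hi ..⟩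
    have hupd : ∑ i ∈ E.erase e, Function.update r e (∑ i ∈ E.erase e, r i * c₀ i) i * c i =
        ∑ i ∈ E.erase e, r i * c i := Finset.sum_congr rfl fun i hi ↦ by
      rw [Function.update_of_ne (Finset.ne_of_mem_erase hi)]
    rw [hsum, Function.update_self, hupd]
    rcases ZMod.eq_zero_or_eq_one_of_two (c e) with h1 | h1
    · rw [h1, mul_zero, zero_add]
      exact hr c ⟨c, hc, fun i hi ↦ hi ▸ h1, fun _ _ ↦ rfl⟩
    · have := hr (c₀ + c) ⟨c₀ + c, h.add_mem hc₀ hc, fun i hi ↦ ?_, fun _ _ ↦ rfl⟩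
      · simpa only [h1, mul_one, Pi.add_apply, mul_add, Finset.sum_add_distrib] using this
      · rw [show i = e from hi, Pi.add_apply, h₀, h1]
        rfl
  · push Not at hex
    refine ⟨r, (h.mem_right _).2 fun c hc ↦ ?_, fun _ _ ↦ rfl⟩
    have h0 : c e = 0 := (ZMod.eq_zero_or_eq_one_of_two _).resolve_right (hex c hc)
    rw [hsum, h0, mul_zero, zero_add]
    exact hr c ⟨c, hc, fun i hi ↦ hi ▸ h0, fun _ _ ↦ rfl⟩

theorem contract_singleton [DecidableEq α] (h : OrthoPair E C R) (he : e ∈ E) :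
    OrthoPair (E.erase e) (punctureCode C {e}) (shortenCode R {e}) :=
  (h.symm.delete_singleton he).symm

theorem sum_support [DecidableEq α] {S : Finset α} (hS : S ⊆ E) (hr : ∀ i ∈ S, r i = 1)
    (hr0 : ∀ i ∈ E, i ∉ S → r i = 0) (c : α → ZMod 2) :
    ∑ i ∈ E, r i * c i = ∑ i ∈ S, c i := by
  rw [← Finset.sum_subset hS fun i hi hiS ↦ by rw [hr0 i hi hiS, zero_mul]]
  exact Finset.sum_congr rfl fun i hi ↦ by rw [hr i hi, one_mul]

end OrthoPair

/-! ### Short vectors, triples and certificates -/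

/-- `C` has a vector whose support is `{a, b}`. -/
def HasShortVector {α : Type*} (E : Finset α) (C : Set (α → ZMod 2)) (a b : α) : Prop :=
  a ∈ E ∧ b ∈ E ∧ ∃ c ∈ C, c a = 1 ∧ c b = 1 ∧ ∀ i ∈ E, i ≠ a → i ≠ b → c i = 0

/-- `C` has a vector whose support is the three-element set `{a, b, d}`. -/
def HasTriple {α : Type*} (E : Finset α) (C : Set (α → ZMod 2)) (a b d : α) : Prop :=
  (a ∈ E ∧ b ∈ E ∧ d ∈ E) ∧ (a ≠ b ∧ a ≠ d ∧ b ≠ d) ∧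
    ∃ c ∈ C, c a = 1 ∧ c b = 1 ∧ c d = 1 ∧ ∀ i ∈ E, i ≠ a → i ≠ b → i ≠ d → c i = 0

/-- Three triangles of `K₄`. -/
def k4Cycles : Fin 3 → Fin 6 → ZMod 2 :=
  ![![1, 1, 0, 1, 0, 0], ![1, 0, 1, 0, 1, 0], ![0, 1, 1, 0, 0, 1]]

/-- Three vertex stars of `K₄`. -/
def k4Cocycles : Fin 3 → Fin 6 → ZMod 2 :=
  ![![1, 1, 1, 0, 0, 0], ![1, 0, 0, 1, 1, 0], ![0, 1, 0, 1, 0, 1]]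

/-- A certificate that the binary matroid on `E` with cycle space `C` and cocycle space `R` has a
minor isomorphic to `M(K₄)`: outside the six elements `x j`, one may contract the elements where
all the vectors `r k` vanish and delete the others. -/
def HasK4Certificate {α : Type*} (E : Finset α) (C R : Set (α → ZMod 2)) : Prop :=
  ∃ (x : Fin 6 → α) (c r : Fin 3 → α → ZMod 2), x.Injective ∧ (∀ j, x j ∈ E) ∧
    (∀ k, c k ∈ C) ∧ (∀ k, r k ∈ R) ∧ (∀ k j, c k (x j) = k4Cycles k j) ∧
    (∀ k j, r k (x j) = k4Cocycles k j) ∧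
    ∀ i ∈ E, i ∉ range x → (∀ k, c k i = 0) ∨ ∀ k, r k i = 0

section

variable {α : Type*} {E : Finset α} {C R : Set (α → ZMod 2)} {c c' r : α → ZMod 2} {a b d e : α}

/-- `M(K₄)` is self-dual: transposing the edges `2` and `3` exchanges the three chosen triangles
with the three chosen stars. -/
theorem HasK4Certificate.symm (h : HasK4Certificate E C R) : HasK4Certificate E R C := by
  obtain ⟨x, c, r, hx, hxE, hc, hr, hcx, hrx, h0⟩ := h
  refine ⟨x ∘ Equiv.swap 2 3, r, c, hx.comp (Equiv.injective _), fun j ↦ hxE _, hr, hc,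
    fun k j ↦ (hrx k _).trans ?_, fun k j ↦ (hcx k _).trans ?_, fun i hi hix ↦ (h0 i hi ?_).symm⟩
  · revert k j
    decide
  · revert k j
    decide
  · rwa [EquivLike.range_comp] at hix

/-- The lifted cycles vanish at `e`, so `e` is simply one more element that may be deleted.
Contraction is covered by duality. -/
theorem HasK4Certificate.of_delete [DecidableEq α]
    (h : HasK4Certificate (E.erase e) (shortenCode C {e}) (punctureCode R {e})) :
    HasK4Certificate E C R := by
  obtain ⟨x, c, r, hx, hxE, hc, hr, hcx, hrx, h0⟩ := h
  choose c' hc' hc0 hcc using hc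
  choose r' hr' hrr using hr
  have hxe : ∀ j, x j ∉ ({e} : Set α) := fun j ↦ Finset.ne_of_mem_erase (hxE j)
  refine ⟨x, c', r', hx, fun j ↦ Finset.mem_of_mem_erase (hxE j), hc', hr',
    fun k j ↦ by rw [hcc k _ (hxe j), hcx], fun k j ↦ by rw [hrr k _ (hxe j), hrx],
    fun i hi hix ↦ ?_⟩
  by_cases hie : i = e
  · exact Or.inl fun k ↦ hc0 k i hie
  · have hie' : i ∉ ({e} : Set α) := hie
    refine (h0 i (Finset.mem_erase.2 ⟨hie, hi⟩) hix).imp (fun h k ↦ ?_) fun h k ↦ ?_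
    · rw [hcc k i hie', h k]
    · rw [hrr k i hie', h k]

theorem HasShortVector.symm (h : HasShortVector E C a b) : HasShortVector E C b a := by
  obtain ⟨ha, hb, c, hc, hca, hcb, h0⟩ := h
  exact ⟨hb, ha, c, hc, hcb, hca, fun i hi h1 h2 ↦ h0 i hi h2 h1⟩

theorem HasTriple.swap (h : HasTriple E C a b d) : HasTriple E C a d b := by
  obtain ⟨⟨h1, h2, h3⟩, ⟨h4, h5, h6⟩, c, hc, h7, h8, h9, h0⟩ := h
  exact ⟨⟨h1, h3, h2⟩, ⟨h5, h4, h6.symm⟩, c, hc, h7, h9, h8, fun i hi g1 g2 g3 ↦ h0 i hi g1 g3 g2⟩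

theorem HasShortVector.of_delete [DecidableEq α]
    (h : HasShortVector (E.erase e) (shortenCode C {e}) a b) : HasShortVector E C a b := by
  obtain ⟨ha, hb, c, ⟨c', hc', h0', hcc⟩, hca, hcb, h0⟩ := h
  refine ⟨Finset.mem_of_mem_erase ha, Finset.mem_of_mem_erase hb, c', hc', ?_, ?_, ?_⟩
  · rw [hcc a (Finset.ne_of_mem_erase ha), hca]
  · rw [hcc b (Finset.ne_of_mem_erase hb), hcb]
  · intro i hi hia hib
    by_cases hie : i = e
    · exact h0' i hie
    · rw [hcc i hie]
      exact h0 i (Finset.mem_erase.2 ⟨hie, hi⟩) hia hib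

theorem HasShortVector.of_contract [DecidableEq α]
    (h : HasShortVector (E.erase e) (punctureCode C {e}) a b) : HasShortVector E C a b ∨
      ∃ c ∈ C, c a = 1 ∧ c b = 1 ∧ c e = 1 ∧ ∀ i ∈ E, i ≠ a → i ≠ b → i ≠ e → c i = 0 := by
  obtain ⟨ha, hb, c, ⟨c', hc', hcc⟩, hca, hcb, h0⟩ := h
  have h1 : c' a = 1 := by rw [hcc a (Finset.ne_of_mem_erase ha), hca]
  have h2 : c' b = 1 := by rw [hcc b (Finset.ne_of_mem_erase hb), hcb]
  have h3 : ∀ i ∈ E, i ≠ a → i ≠ b → i ≠ e → c' i = 0 := by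
    intro i hi hia hib hie
    rw [hcc i hie]
    exact h0 i (Finset.mem_erase.2 ⟨hie, hi⟩) hia hib
  rcases ZMod.eq_zero_or_eq_one_of_two (c' e) with he | he
  · refine Or.inl ⟨Finset.mem_of_mem_erase ha, Finset.mem_of_mem_erase hb, c', hc', h1, h2, ?_⟩
    intro i hi hia hib
    by_cases hie : i = e
    · rw [hie, he]
    · exact h3 i hi hia hib hie
  · exact Or.inr ⟨c', hc', h1, h2, he, h3⟩

namespace OrthoPair

/-- If all of `R` vanished at `a`, the unit vector at `a` would be orthogonal to `R` and hence
belong to `C`; the short vector with both ends `a` is a loop. -/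
theorem exists_eq_one (h : OrthoPair E C R) (ha : a ∈ E) (hC : ¬ HasShortVector E C a a) :
    ∃ r ∈ R, r a = 1 := by
  classical
  by_contra! hcon
  refine hC ⟨ha, ha, Pi.single a 1, (h.mem_left _).2 fun r hr ↦ ?_, by simp, by simp, ?_⟩
  · rw [Finset.sum_eq_single_of_mem a ha fun i _ hia ↦ by simp [hia]]
    simpa using (ZMod.eq_zero_or_eq_one_of_two _).resolve_right (hcon r hr)
  · intro i _ hia _
    simp [hia]

theorem exists_add_eq_one (h : OrthoPair E C R) (ha : a ∈ E) (hb : b ∈ E) (hab : a ≠ b)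
    (hC : ¬ HasShortVector E C a b) : ∃ r ∈ R, r a + r b = 1 := by
  classical
  by_contra! hcon
  refine hC ⟨ha, hb, fun i ↦ if i = a ∨ i = b then 1 else 0, (h.mem_left _).2 fun r hr ↦ ?_,
    by simp, by simp, ?_⟩
  · have h1 := sum_support (S := {a, b}) (E := E) (r := fun i ↦ if i = a ∨ i = b then 1 else 0)
      (by simp [Finset.insert_subset_iff, ha, hb]) (by simp) (by simp) r
    simp only [mul_comm] at h1 ⊢
    rw [h1, Finset.sum_pair hab]
    exact (ZMod.eq_zero_or_eq_one_of_two _).resolve_right (hcon r hr)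
  · intro i _ h1 h2
    simp [h1, h2]

theorem shortVector_orth (h : OrthoPair E C R) (hab : HasShortVector E C a b) (hne : a ≠ b)
    (hr : r ∈ R) : r a + r b = 0 := by
  classical
  obtain ⟨ha, hb, c, hc, hca, hcb, h0⟩ := hab
  rw [← h.symm.sum_eq_zero hc hr, sum_support (S := {a, b}), Finset.sum_pair hne]
  · simp [Finset.insert_subset_iff, ha, hb]
  · simp [hca, hcb]
  · simp only [Finset.mem_insert, Finset.mem_singleton, not_or]
    exact fun i hi hn ↦ h0 i hi hn.1 hn.2

theorem loop_orth (h : OrthoPair E C R) (ha : HasShortVector E C a a) (hr : r ∈ R) : r a = 0 := by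
  classical
  obtain ⟨ha, -, c, hc, hca, -, h0⟩ := ha
  rw [← h.symm.sum_eq_zero hc hr, sum_support (S := {a}), Finset.sum_singleton]
  · simp [ha]
  · simp [hca]
  · simp only [Finset.mem_singleton]
    exact fun i hi hn ↦ h0 i hi hn hn

theorem triple_orth (h : OrthoPair E C R) (hT : HasTriple E R a b d) (hc : c ∈ C) :
    c a + c b + c d = 0 := by
  classical
  obtain ⟨⟨ha, hb, hd⟩, ⟨hab, had, hbd⟩, r, hr, hra, hrb, hrd, h0⟩ := hT
  rw [← h.sum_eq_zero hr hc, sum_support (S := {a, b, d}),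
    Finset.sum_insert (by simp [hab, had]), Finset.sum_pair hbd, add_assoc]
  · simp [Finset.insert_subset_iff, ha, hb, hd]
  · simp [hra, hrb, hrd]
  · simp only [Finset.mem_insert, Finset.mem_singleton, not_or]
    exact fun i hi hn ↦ h0 i hi hn.1 hn.2.1 hn.2.2

end OrthoPair

end

/-! ### Binary matroids without `M(K₄)`-minor -/

namespace OrthoPair

variable {α : Type*} {E : Finset α} {C R : Set (α → ZMod 2)} {c c' r : α → ZMod 2} {a b d e x : α}

/-- `C` or `R` has a vector with one or two nonzero coordinates, all of them different from `x`. -/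
def _root_.HasShortVectorAvoiding (E : Finset α) (C R : Set (α → ZMod 2)) (x : α) : Prop :=
  ∃ a b, a ≠ x ∧ b ≠ x ∧ (HasShortVector E C a b ∨ HasShortVector E R a b)

theorem _root_.HasShortVectorAvoiding.symm (h : HasShortVectorAvoiding E C R x) :
    HasShortVectorAvoiding E R C x := by
  obtain ⟨a, b, ha, hb, h⟩ := h
  exact ⟨a, b, ha, hb, h.symm⟩

set_option synthInstance.maxSize 2000 in
set_option synthInstance.maxHeartbeats 200000 in
-- Write `E = {x, a, b}`. Without a short vector avoiding `x`, a vector of `R` is determined on `E`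
-- by its value at `x`, so `R` has at most one nonzero vector there. Yet the absence of short
-- vectors of `C` provides vectors of `R` nonzero at `a`, nonzero at `b`, and with different values
-- at `a` and `b`.
theorem hasShortVectorAvoiding_of_card_eq_three [DecidableEq α] (h : OrthoPair E C R)
    (hE : E.card = 3) (hx : x ∈ E) : HasShortVectorAvoiding E C R x := by
  by_contra hno
  have hno' : ∀ a b, a ≠ x → b ≠ x → ¬ HasShortVector E C a b ∧ ¬ HasShortVector E R a b :=
    fun a b ha hb ↦ ⟨fun h ↦ hno ⟨a, b, ha, hb, Or.inl h⟩, fun h ↦ hno ⟨a, b, ha, hb, Or.inr h⟩⟩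
  obtain ⟨a, b, hab, hE'⟩ : ∃ a b, a ≠ b ∧ E.erase x = {a, b} := by
    rw [← Finset.card_eq_two, Finset.card_erase_of_mem hx, hE]
  have ha : a ∈ E.erase x := by simp [hE']
  have hb : b ∈ E.erase x := by simp [hE']
  obtain ⟨hax, ha⟩ := Finset.mem_erase.1 ha
  obtain ⟨hbx, hb⟩ := Finset.mem_erase.1 hb
  have hmem : ∀ i ∈ E, i = x ∨ i = a ∨ i = b := by
    intro i hi
    by_cases hix : i = x
    · exact Or.inl hix
    · have : i ∈ E.erase x := Finset.mem_erase.2 ⟨hix, hi⟩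
      rw [hE'] at this
      simpa [hix] using this
  have hR : ∀ r ∈ R, r x = 0 → r a = 0 ∧ r b = 0 := by
    intro r hr hrx
    rcases ZMod.eq_zero_or_eq_one_of_two (r a) with h1 | h1 <;>
      rcases ZMod.eq_zero_or_eq_one_of_two (r b) with h2 | h2
    · exact ⟨h1, h2⟩
    · refine ((hno' b b hbx hbx).2 ⟨hb, hb, r, hr, h2, h2, fun i hi hib _ ↦ ?_⟩).elim
      rcases hmem i hi with rfl | rfl | rfl
      exacts [hrx, h1, (hib rfl).elim]
    · refine ((hno' a a hax hax).2 ⟨ha, ha, r, hr, h1, h1, fun i hi hia _ ↦ ?_⟩).elim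
      rcases hmem i hi with rfl | rfl | rfl
      exacts [hrx, (hia rfl).elim, h2]
    · refine ((hno' a b hax hbx).2 ⟨ha, hb, r, hr, h1, h2, fun i hi hia hib ↦ ?_⟩).elim
      rcases hmem i hi with rfl | rfl | rfl
      exacts [hrx, (hia rfl).elim, (hib rfl).elim]
  obtain ⟨r₁, hr₁, h₁⟩ := h.exists_eq_one ha (hno' a a hax hax).1
  obtain ⟨r₂, hr₂, h₂⟩ := h.exists_eq_one hb (hno' b b hbx hbx).1
  obtain ⟨r₃, hr₃, h₃⟩ := h.exists_add_eq_one ha hb hab (hno' a b hax hbx).1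
  have e₁ := hR r₁ hr₁
  have e₂ := hR r₂ hr₂
  have e₃ := hR r₃ hr₃
  have e₁₂ := hR _ (h.symm.add_mem hr₁ hr₂)
  have e₁₃ := hR _ (h.symm.add_mem hr₁ hr₃)
  simp only [Pi.add_apply] at e₁₂ e₁₃
  revert h₁ h₂ h₃ e₁ e₂ e₃ e₁₂ e₁₃
  generalize r₁ x = x₁, r₁ a = a₁, r₁ b = b₁, r₂ x = x₂, r₂ a = a₂, r₂ b = b₂, r₃ x = x₃,
    r₃ a = a₃, r₃ b = b₃
  rintro rfl rfl
  revert x₁ b₁ x₂ a₂ x₃ a₃ b₃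
  decide

/-- If `x` lies in the support of a vector of `C` with at most two nonzero coordinates, then a
short vector that avoids `x` can be found after the deletion of `x`. -/
theorem hasShortVectorAvoiding_of_hasShortVector [DecidableEq α] (h : OrthoPair E C R)
    (hE : 1 < E.card) (hxb : HasShortVector E C x b)
    (ih : ∀ y ∈ E.erase x, HasShortVectorAvoiding (E.erase x) (shortenCode C {x})
      (punctureCode R {x}) y) : HasShortVectorAvoiding E C R x := by
  -- If `b ≠ x`, the element to be avoided after the deletion is `b`; if `b = x` any element will
  -- do.
  obtain ⟨y, hy, hyb⟩ : ∃ y ∈ E.erase x, b ≠ x → y = b := by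
    by_cases hbx : b = x
    · have : (E.erase x).Nonempty := by
        rw [← Finset.card_pos, Finset.card_erase_of_mem hxb.1]
        omega
      obtain ⟨y, hy⟩ := this
      exact ⟨y, hy, fun h ↦ (h hbx).elim⟩
    · exact ⟨b, Finset.mem_erase.2 ⟨hbx, hxb.2.1⟩, fun _ ↦ rfl⟩
  obtain ⟨p, q, hp, hq, hpq | hpq⟩ := ih y hy
  · exact ⟨p, q, Finset.ne_of_mem_erase hpq.1, Finset.ne_of_mem_erase hpq.2.1,
      Or.inl hpq.of_delete⟩
  have hpx := Finset.ne_of_mem_erase hpq.1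
  have hqx := Finset.ne_of_mem_erase hpq.2.1
  rcases hpq.of_contract with hpq' | ⟨r, hr, hrp, hrq, hrx, h0⟩
  · exact ⟨p, q, hpx, hqx, Or.inr hpq'⟩
  -- The remaining vector `r` of `R` contains `x` but not `b`, so it meets the support of the short
  -- vector of `C` in `x` alone, against orthogonality.
  exfalso
  by_cases hbx : b = x
  · subst hbx
    have := h.loop_orth hxb hr
    rw [hrx] at this
    exact one_ne_zero this
  · have := h.shortVector_orth hxb (Ne.symm hbx) hr
    obtain rfl := hyb hbx
    rw [hrx, h0 y hxb.2.1 hp.symm hq.symm hbx, add_zero] at this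
    exact one_ne_zero this

/-- If `C` and `R` have no short vectors, but become so after the deletion of `e`, then `e` lies in
two triads that are otherwise disjoint. -/
theorem exists_triples [DecidableEq α] (h : OrthoPair E C R) (he : e ∈ E)
    (hno : ∀ a b, ¬ HasShortVector E C a b ∧ ¬ HasShortVector E R a b) (hE : 1 < E.card)
    (ih : ∀ y ∈ E.erase e, HasShortVectorAvoiding (E.erase e) (shortenCode C {e})
      (punctureCode R {e}) y) :
    ∃ a b p q, HasTriple E R e a b ∧ HasTriple E R e p q ∧ a ≠ p ∧ a ≠ q ∧ b ≠ p ∧ b ≠ q := by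
  -- A short vector of the deletion cannot come from `C`, nor from a vector of `R` vanishing at `e`;
  -- it is therefore a triad through `e` with `e` removed.
  have step : ∀ y ∈ E.erase e, ∃ a b, a ≠ y ∧ b ≠ y ∧ HasTriple E R e a b := by
    intro y hy
    obtain ⟨a, b, hay, hby, hab | hab⟩ := ih y hy
    · exact ((hno a b).1 hab.of_delete).elim
    obtain ⟨hae, ha⟩ := Finset.mem_erase.1 hab.1
    obtain ⟨hbe, hb⟩ := Finset.mem_erase.1 hab.2.1
    rcases hab.of_contract with hab' | ⟨r, hr, hra, hrb, hre, h0⟩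
    · exact ((hno a b).2 hab').elim
    refine ⟨a, b, hay, hby, ⟨he, ha, hb⟩, ⟨hae.symm, hbe.symm, ?_⟩, r, hr, hre, hra, hrb,
      fun i hi h1 h2 h3 ↦ h0 i hi h2 h3 h1⟩
    rintro rfl
    exact (hno e a).2 ⟨he, ha, r, hr, hre, hra, fun i hi h1 h2 ↦ h0 i hi h2 h2 h1⟩
  -- Two triads sharing `e` and `b` would have the short vector on `{a, q}` as their sum.
  have hdisj : ∀ a b q, HasTriple E R e a b → HasTriple E R e b q → a = q := by
    rintro a b q ⟨⟨-, ha, hb⟩, ⟨hea, heb, hab⟩, r, hr, h1, h2, h3, h0⟩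
      ⟨⟨-, -, hq⟩, ⟨-, heq, hbq⟩, r', hr', h1', h2', h3', h0'⟩
    by_contra haq
    refine (hno a q).2 ⟨ha, hq, r + r', h.symm.add_mem hr hr', ?_, ?_, fun i hi hia hiq ↦ ?_⟩
    · rw [Pi.add_apply, h2, h0' a ha hea.symm hab haq, add_zero]
    · rw [Pi.add_apply, h3', h0 q hq heq.symm (Ne.symm haq) hbq.symm, zero_add]
    · rw [Pi.add_apply]
      by_cases hie : i = e
      · rw [hie, h1, h1']
        rfl
      by_cases hib : i = b
      · rw [hib, h3, h2']
        rfl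
      rw [h0 i hi hie hia hib, h0' i hi hie hib hiq, add_zero]
  have hne : (E.erase e).Nonempty := by
    rw [← Finset.card_pos, Finset.card_erase_of_mem he]
    omega
  obtain ⟨y, hy⟩ := hne
  obtain ⟨a, b, -, -, hab⟩ := step y hy
  obtain ⟨p, q, hpa, hqa, hpq⟩ := step a (Finset.mem_erase.2 ⟨hab.2.1.1.symm, hab.1.2.1⟩)
  refine ⟨a, b, p, q, hab, hpq, hpa.symm, hqa.symm, ?_, ?_⟩
  · rintro rfl
    exact hqa (hdisj _ _ _ hab hpq).symm
  · rintro rfl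
    exact hpa (hdisj _ _ _ hab hpq.swap).symm

/-- Triangles and triads meet evenly. Hence each of the two triangles through `e` has exactly one
further element in each of the triads `{e, a, b}` and `{e, u, v}`, and with suitable labels the
triangles are `{e, a, u}` and `{e, b, v}`. A triangle through `a` avoiding `e` must contain `b`; it
is `{a, b, f}` with a new `f`. The six elements are then labelled as the edges of `K₄`, and the
others, on which all three triangles vanish, may be deleted. -/
theorem hasK4Certificate_of_triples [DecidableEq α] (h : OrthoPair E C R) (he : e ∈ E)
    (hno : ∀ a, ¬ HasShortVector E C a a)
    (hR : ∃ a b p q, HasTriple E R e a b ∧ HasTriple E R e p q ∧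
      a ≠ p ∧ a ≠ q ∧ b ≠ p ∧ b ≠ q)
    (hC : ∀ e ∈ E, ∃ a b p q, HasTriple E C e a b ∧ HasTriple E C e p q ∧
      a ≠ p ∧ a ≠ q ∧ b ≠ p ∧ b ≠ q) : HasK4Certificate E C R := by
  obtain ⟨p, q, s, t, hT₁, hT₂, hps, hpt, hqs, hqt⟩ := hC e he
  obtain ⟨-, ⟨hep, heq, hpq⟩, c₁, hc₁, hc₁e, hc₁p, hc₁q, hc₁0⟩ := hT₁
  obtain ⟨-, ⟨hes, het, hst⟩, c₂, hc₂, hc₂e, hc₂s, hc₂t, hc₂0⟩ := hT₂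
  -- label the two triads through `e` so that the first triangle contains `a` and `u`
  have label : ∀ a b, HasTriple E R e a b → ∃ a' b', HasTriple E R e a' b' ∧ c₁ a' = 1 ∧
      c₁ b' = 0 ∧ (a' = a ∧ b' = b ∨ a' = b ∧ b' = a) := by
    intro a b hab
    have := h.triple_orth hab hc₁
    rw [hc₁e] at this
    rcases ZMod.eq_zero_or_eq_one_of_two (c₁ a) with h1 | h1 <;>
      rcases ZMod.eq_zero_or_eq_one_of_two (c₁ b) with h2 | h2 <;> rw [h1, h2] at this
    · exact absurd this (by decide)
    · exact ⟨b, a, hab.swap, h2, h1, Or.inr ⟨rfl, rfl⟩⟩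
    · exact ⟨a, b, hab, h1, h2, Or.inl ⟨rfl, rfl⟩⟩
    · exact absurd this (by decide)
  obtain ⟨a, b, u, v, hS₁, hS₂, hc₁a, hc₁b, hc₁u, hc₁v, hau, hav, hbu, hbv⟩ : ∃ a b u v,
      HasTriple E R e a b ∧ HasTriple E R e u v ∧ c₁ a = 1 ∧ c₁ b = 0 ∧ c₁ u = 1 ∧ c₁ v = 0 ∧
      a ≠ u ∧ a ≠ v ∧ b ≠ u ∧ b ≠ v := by
    obtain ⟨a, b, u, v, hab, huv, h1, h2, h3, h4⟩ := hR
    obtain ⟨a', b', hab', ha', hb', hl⟩ := label a b hab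
    obtain ⟨u', v', huv', hu', hv', hl'⟩ := label u v huv
    refine ⟨a', b', u', v', hab', huv', ha', hb', hu', hv', ?_⟩
    rcases hl with ⟨rfl, rfl⟩ | ⟨rfl, rfl⟩ <;> rcases hl' with ⟨rfl, rfl⟩ | ⟨rfl, rfl⟩ <;>
      simp [h1, h2, h3, h4]
  obtain ⟨⟨-, haE, hbE⟩, ⟨hea, heb, hab⟩, r₁, hr₁, hr₁e, hr₁a, hr₁b, hr₁0⟩ := id hS₁
  obtain ⟨⟨-, huE, hvE⟩, ⟨heu, hev, huv⟩, r₂, hr₂, hr₂e, hr₂u, hr₂v, hr₂0⟩ := id hS₂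
  have hpq' : ∀ i ∈ E, i ≠ e → c₁ i = 1 → i = p ∨ i = q := by
    intro i hi hie h1
    by_contra! hcon
    rw [hc₁0 i hi hie hcon.1 hcon.2] at h1
    exact zero_ne_one h1
  have hst' : ∀ i ∈ E, i ≠ e → c₂ i = 1 → i = s ∨ i = t := by
    intro i hi hie h1
    by_contra! hcon
    rw [hc₂0 i hi hie hcon.1 hcon.2] at h1
    exact zero_ne_one h1
  have hapq := hpq' a haE hea.symm hc₁a
  have hupq := hpq' u huE heu.symm hc₁u
  have hc₁0' : ∀ i ∈ E, i ≠ e → i ≠ a → i ≠ u → c₁ i = 0 := by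
    intro i hi hie hia hiu
    refine hc₁0 i hi hie ?_ ?_ <;> rintro rfl <;> grind
  have hc₂0a : c₂ a = 0 := hc₂0 a haE hea.symm (by grind) (by grind)
  have hc₂0u : c₂ u = 0 := hc₂0 u huE heu.symm (by grind) (by grind)
  have hc₂b : c₂ b = 1 := by
    have := h.triple_orth hS₁ hc₂
    rw [hc₂e, hc₂0a] at this
    revert this
    generalize c₂ b = z
    revert z
    decide
  have hc₂v : c₂ v = 1 := by
    have := h.triple_orth hS₂ hc₂
    rw [hc₂e, hc₂0u] at this
    revert this
    generalize c₂ v = z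
    revert z
    decide
  have hbst := hst' b hbE heb.symm hc₂b
  have hvst := hst' v hvE hev.symm hc₂v
  have hc₂0' : ∀ i ∈ E, i ≠ e → i ≠ b → i ≠ v → c₂ i = 0 := by
    intro i hi hie hib hiv
    refine hc₂0 i hi hie ?_ ?_ <;> rintro rfl <;> grind
  -- the triangle through `a` that avoids `e` contains `b` and a new element `f`
  obtain ⟨f, hT₃, hfe⟩ : ∃ f, HasTriple E C a b f ∧ f ≠ e := by
    have main : ∀ m n, HasTriple E C a m n → m ≠ e → n ≠ e → ∃ f, HasTriple E C a b f ∧ f ≠ e := by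
      intro m n hT hme hne
      obtain ⟨-, -, c, hc, hca, -, -, hc0⟩ := id hT
      have := h.triple_orth hS₁ hc
      rw [hc0 e he hea hme.symm hne.symm, hca] at this
      by_cases hbm : b = m
      · exact ⟨n, hbm ▸ hT, hne⟩
      by_cases hbn : b = n
      · exact ⟨m, hbn ▸ hT.swap, hme⟩
      rw [hc0 b hbE hab.symm hbm hbn] at this
      exact absurd this (by decide)
    -- The two triangles share only `a`, so at most one of them contains `e`.
    obtain ⟨m, n, m', n', hT, hT', h1, h2, h3, h4⟩ := hC a haE
    by_cases hme : m = e
    · exact main m' n' hT' (hme ▸ h1.symm) (hme ▸ h2.symm)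
    by_cases hne : n = e
    · exact main m' n' hT' (hne ▸ h3.symm) (hne ▸ h4.symm)
    exact main m n hT hme hne
  obtain ⟨⟨-, -, hfE⟩, ⟨-, haf, hbf⟩, c₃, hc₃, hc₃a, hc₃b, hc₃f, hc₃0⟩ := id hT₃
  have hc₃e : c₃ e = 0 := hc₃0 e he hea heb hfe.symm
  have huv₃ := h.triple_orth hS₂ hc₃
  rw [hc₃e, zero_add] at huv₃
  have hfu : f ≠ u := by
    rintro rfl
    rw [hc₃f, hc₃0 v hvE hav.symm hbv.symm huv.symm] at huv₃
    exact absurd huv₃ (by decide)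
  have hfv : f ≠ v := by
    rintro rfl
    rw [hc₃f, hc₃0 u huE hau.symm hbu.symm huv] at huv₃
    exact absurd huv₃ (by decide)
  obtain ⟨r₀, hr₀, hr₀f⟩ := h.exists_eq_one hfE (hno f)
  have horth₁ := h.symm.triple_orth ⟨⟨he, haE, huE⟩, ⟨hea, heu, hau⟩, c₁, hc₁, hc₁e, hc₁a, hc₁u,
    hc₁0'⟩ hr₀
  have horth₂ := h.symm.triple_orth ⟨⟨he, hbE, hvE⟩, ⟨heb, hev, hbv⟩, c₂, hc₂, hc₂e, hc₂b, hc₂v,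
    hc₂0'⟩ hr₀
  have horth₃ := h.symm.triple_orth hT₃ hr₀
  -- The coefficient of `r₁` makes the value at `b` zero, and then that of `r₂` makes the value at
  -- `e` zero. Orthogonality to the three triangles together with `r₀ f = 1` determines the values
  -- at `a`, `u`, `v`.
  let r₃ : α → ZMod 2 := r₀ + (r₀ b • r₁ + (r₀ e + r₀ b) • r₂)
  have hr₃ : r₃ ∈ R := h.symm.add_mem hr₀
    (h.symm.add_mem (h.symm.smul_mem _ hr₁) (h.symm.smul_mem _ hr₂))
  have hr₁u := hr₁0 u huE heu.symm hau.symm hbu.symm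
  have hr₁v := hr₁0 v hvE hev.symm hav.symm hbv.symm
  have hr₁f := hr₁0 f hfE hfe haf.symm hbf.symm
  have hr₂a := hr₂0 a haE hea.symm hau hav
  have hr₂b := hr₂0 b hbE heb.symm hbu hbv
  have hr₂f := hr₂0 f hfE hfe hfu hfv
  have hr₃_apply : ∀ i, r₃ i = r₀ i + (r₀ b * r₁ i + (r₀ e + r₀ b) * r₂ i) := fun i ↦ rfl
  have hvals : r₃ e = 0 ∧ r₃ a = 1 ∧ r₃ b = 0 ∧ r₃ u = 1 ∧ r₃ v = 0 ∧ r₃ f = 1 := by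
    simp only [hr₃_apply, hr₁e, hr₁a, hr₁b, hr₁u, hr₁v, hr₁f, hr₂e, hr₂a, hr₂b, hr₂u, hr₂v, hr₂f,
      hr₀f]
    rw [hr₀f] at horth₃
    revert horth₁ horth₂ horth₃
    generalize r₀ e = e', r₀ a = a', r₀ b = b', r₀ u = u', r₀ v = v'
    revert e' a' b' u' v'
    decide
  obtain ⟨hr₃e, hr₃a, hr₃b, hr₃u, hr₃v, hr₃f⟩ := hvals
  refine ⟨![e, a, b, u, v, f], ![c₁, c₂, c₃], ![r₁, r₂, r₃], ?_, ?_, ?_, ?_, ?_, ?_, ?_⟩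
  · intro i j hij
    fin_cases i <;> fin_cases j <;> simp at hij ⊢ <;> grind
  · simp [Fin.forall_fin_succ, he, haE, hbE, huE, hvE, hfE]
  · simp [Fin.forall_fin_succ, hc₁, hc₂, hc₃]
  · simp [Fin.forall_fin_succ, hr₁, hr₂, hr₃]
  · simp [Fin.forall_fin_succ, k4Cycles, hc₁e, hc₁a, hc₁b, hc₁u, hc₁v, hc₂e, hc₂b, hc₂v, hc₂0a,
      hc₂0u, hc₃a, hc₃b, hc₃f, hc₃e, hc₁0' f hfE hfe haf.symm hfu, hc₂0' f hfE hfe hbf.symm hfv,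
      hc₃0 u huE hau.symm hbu.symm hfu.symm, hc₃0 v hvE hav.symm hbv.symm hfv.symm]
  · simp [Fin.forall_fin_succ, k4Cocycles, hr₁e, hr₁a, hr₁b, hr₁u, hr₁v, hr₁f, hr₂e, hr₂a, hr₂b,
      hr₂u, hr₂v, hr₂f, hr₃e, hr₃a, hr₃b, hr₃u, hr₃v, hr₃f]
  · intro i hi hix
    simp only [Matrix.range_cons, Matrix.range_empty, union_empty, mem_union,
      mem_singleton_iff, not_or] at hix
    obtain ⟨h1, h2, h3, h4, h5, h6⟩ := hix
    left
    simp [Fin.forall_fin_succ, hc₁0' i hi h1 h2 h4, hc₂0' i hi h1 h3 h5, hc₃0 i hi h2 h3 h6]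

/-- A binary matroid with at least three elements and without `M(K₄)`-minor has a circuit or
cocircuit with at most two elements that avoids a given element. -/
theorem hasShortVectorAvoiding [DecidableEq α] (h : OrthoPair E C R) (hK : ¬ HasK4Certificate E C R)
    (hE : 3 ≤ E.card) (hx : x ∈ E) : HasShortVectorAvoiding E C R x := by
  obtain ⟨n, hn⟩ : ∃ n, E.card = n := ⟨_, rfl⟩
  rw [hn] at hE
  -- The freedom to prescribe the avoided element is what the inductive step consumes: it keeps the
  -- new short vector away from a given one, and it makes the second triad disjoint from the first
  -- outside `e`.
  induction n, hE using Nat.le_induction generalizing E C R x with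
  | base => exact h.hasShortVectorAvoiding_of_card_eq_three hn hx
  | succ n hle ih =>
    have hdel : ∀ {C R : Set (α → ZMod 2)}, OrthoPair E C R → ¬ HasK4Certificate E C R →
        ∀ e ∈ E, ∀ y ∈ E.erase e, HasShortVectorAvoiding (E.erase e) (shortenCode C {e})
          (punctureCode R {e}) y := fun hp hK e he y hy ↦
      ih (hp.delete_singleton he) (fun h ↦ hK h.of_delete) hy
        (by rw [Finset.card_erase_of_mem he, hn]; rfl)
    have hK' : ¬ HasK4Certificate E R C := fun h ↦ hK h.symm
    have hcard : 1 < E.card := by omega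
    have hpar : ∀ {C R : Set (α → ZMod 2)}, OrthoPair E C R → ¬ HasK4Certificate E C R →
        ∀ a b, HasShortVector E C a b → HasShortVectorAvoiding E C R x := by
      intro C R hp hK a b hab
      by_cases hax : a = x
      · subst hax
        exact hp.hasShortVectorAvoiding_of_hasShortVector hcard hab (hdel hp hK a hx)
      by_cases hbx : b = x
      · subst hbx
        exact hp.hasShortVectorAvoiding_of_hasShortVector hcard hab.symm (hdel hp hK b hx)
      exact ⟨a, b, hax, hbx, Or.inl hab⟩
    by_contra hcon
    have hno : ∀ a b, ¬ HasShortVector E C a b ∧ ¬ HasShortVector E R a b := fun a b ↦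
      ⟨fun hab ↦ hcon (hpar h hK a b hab), fun hab ↦ hcon (hpar h.symm hK' a b hab).symm⟩
    exact hK (h.hasK4Certificate_of_triples hx (fun a ↦ (hno a a).1)
      (h.exists_triples hx hno hcard (hdel h hK x hx))
      fun e he ↦ h.symm.exists_triples he (fun a b ↦ (hno a b).symm) hcard (hdel h.symm hK' e he))

/-- With fewer than three elements, every nonzero vector is short, and either `C` or `R` has a
vector that is nonzero at `x`. -/
theorem exists_hasShortVector [DecidableEq α] (h : OrthoPair E C R) (hK : ¬ HasK4Certificate E C R)
    (hE : E.Nonempty) : ∃ a b, HasShortVector E C a b ∨ HasShortVector E R a b := by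
  obtain ⟨x, hx⟩ := hE
  rcases le_or_gt 3 E.card with h3 | h3
  · obtain ⟨a, b, -, -, hab⟩ := h.hasShortVectorAvoiding hK h3 hx
    exact ⟨a, b, hab⟩
  by_cases hxx : HasShortVector E C x x
  · exact ⟨x, x, Or.inl hxx⟩
  obtain ⟨r, hr, hrx⟩ := h.exists_eq_one hx hxx
  by_cases hy : ∃ y ∈ E, y ≠ x ∧ r y = 1
  · obtain ⟨y, hy, hyx, hry⟩ := hy
    refine ⟨x, y, Or.inr ⟨hx, hy, r, hr, hrx, hry, fun i hi hix hiy ↦ ?_⟩⟩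
    have : ({x, y, i} : Finset α).card ≤ E.card := Finset.card_le_card (by
      simp [Finset.insert_subset_iff, hx, hy, hi])
    rw [Finset.card_eq_three.2 ⟨x, y, i, hyx.symm, Ne.symm hix, Ne.symm hiy, rfl⟩] at this
    omega
  · push Not at hy
    exact ⟨x, x, Or.inr ⟨hx, hx, r, hr, hrx, hrx, fun i hi hix _ ↦
      (ZMod.eq_zero_or_eq_one_of_two _).resolve_right (hy i hi hix)⟩⟩

end OrthoPair

/-! ### Independent sets of a binary code -/

/-- `I` contains the support of no nonzero vector of `C`, that is, `I` is independent in the binary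
matroid on `E` with cycle space `C`. -/
def CodeIndep {α : Type*} (E : Finset α) (C : Set (α → ZMod 2)) (I : Set α) : Prop :=
  ∀ c ∈ C, (∀ i ∈ E, c i ≠ 0 → i ∈ I) → ∀ i ∈ E, c i = 0

section

variable {α : Type*} {E : Finset α} {C R : Set (α → ZMod 2)} {I I' : Set α} {a b e : α}

theorem CodeIndep.mono (h : CodeIndep E C I) (hI : ∀ i ∈ E, i ∈ I' → i ∈ I) : CodeIndep E C I' :=
  fun c hc hs ↦ h c hc fun i hi h0 ↦ hI i hi (hs i hi h0)

theorem not_codeIndep_of_hasShortVector (h : HasShortVector E C a b) (ha : a ∈ I) (hb : b ∈ I) :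
    ¬ CodeIndep E C I := by
  obtain ⟨haE, hbE, c, hc, hca, hcb, h0⟩ := h
  intro hI
  have := hI c hc (fun i hi hne ↦ ?_) a haE
  · rw [hca] at this
    exact one_ne_zero this
  · by_cases hia : i = a
    · exact hia ▸ ha
    by_cases hib : i = b
    · exact hib ▸ hb
    exact (hne (h0 i hi hia hib)).elim

theorem codeIndep_delete_iff [DecidableEq α] (heE : e ∈ E) (he : e ∉ I) :
    CodeIndep (E.erase e) (shortenCode C {e}) I ↔ CodeIndep E C I := by
  constructor
  · intro h c hc hs i hi
    have h0 : c e = 0 := by_contra fun hne ↦ he (hs e heE hne)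
    by_cases hie : i = e
    · rw [hie, h0]
    · exact h c ⟨c, hc, fun j hj ↦ (show j = e from hj) ▸ h0, fun _ _ ↦ rfl⟩
        (fun j hj ↦ hs j (Finset.mem_of_mem_erase hj)) i (Finset.mem_erase.2 ⟨hie, hi⟩)
  · rintro h c ⟨c', hc', h0, hcc⟩ hs i hi
    rw [← hcc i (Finset.ne_of_mem_erase hi)]
    refine h c' hc' (fun j hj hne ↦ ?_) i (Finset.mem_of_mem_erase hi)
    by_cases hje : j = e
    · exact (hne (h0 j hje)).elim
    · exact hs j (Finset.mem_erase.2 ⟨hje, hj⟩) (by rwa [← hcc j hje])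

theorem codeIndep_contract_iff [DecidableEq α] (heE : e ∈ E) (hloop : ¬ HasShortVector E C e e) :
    CodeIndep (E.erase e) (punctureCode C {e}) I ↔ CodeIndep E C (insert e I) := by
  constructor
  · intro h c hc hs
    have h0 : ∀ i ∈ E.erase e, c i = 0 := h c ⟨c, hc, fun _ _ ↦ rfl⟩ fun j hj hne ↦
      (hs j (Finset.mem_of_mem_erase hj) hne).resolve_left (Finset.ne_of_mem_erase hj)
    have h1 : c e = 0 := (ZMod.eq_zero_or_eq_one_of_two _).resolve_right fun h1 ↦
      hloop ⟨heE, heE, c, hc, h1, h1, fun i hi hie _ ↦ h0 i (Finset.mem_erase.2 ⟨hie, hi⟩)⟩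
    intro i hi
    by_cases hie : i = e
    · rw [hie, h1]
    · exact h0 i (Finset.mem_erase.2 ⟨hie, hi⟩)
  · rintro h c ⟨c', hc', hcc⟩ hs i hi
    rw [← hcc i (Finset.ne_of_mem_erase hi)]
    refine h c' hc' (fun j hj hne ↦ ?_) i (Finset.mem_of_mem_erase hi)
    by_cases hje : j = e
    · exact Or.inl hje
    · exact Or.inr (hs j (Finset.mem_erase.2 ⟨hje, hj⟩) (by rwa [← hcc j hje]))

namespace OrthoPair

theorem codeIndep_insert_of_parallel (h : OrthoPair E C R) (hab : HasShortVector E C a b)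
    (ha : a ∉ I) (hI : CodeIndep E C (insert a I)) :
    CodeIndep E C (insert b I) := by
  by_cases hne : a = b
  · exact hne ▸ hI
  obtain ⟨haE, hbE, c₀, hc₀, h₀a, h₀b, h₀⟩ := hab
  intro c hc hs
  have hca : c a = 0 := by_contra fun h ↦ (hs a haE h).elim hne ha
  have hval : ∀ i, (c + c b • c₀) i = c i + c b * c₀ i := fun i ↦ rfl
  -- Adding the short vector `c₀` when `c b = 1` moves the support from `b` to `a`; independence of
  -- `insert a I` makes the sum zero.
  have h2 := hI (c + c b • c₀) (h.add_mem hc (h.smul_mem _ hc₀)) fun i hi hi0 ↦ by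
    by_cases hia : i = a
    · exact Or.inl hia
    by_cases hib : i = b
    · rw [hval, hib, h₀b, mul_one] at hi0
      exact (hi0 (CharTwo.add_self_eq_zero _)).elim
    rw [hval, h₀ i hi hia hib, mul_zero, add_zero] at hi0
    exact Or.inr ((hs i hi hi0).resolve_left hib)
  have hcb : c b = 0 := by
    have := h2 a haE
    rwa [hval, hca, h₀a, mul_one, zero_add] at this
  intro i hi
  have := h2 i hi
  rwa [hval, hcb, zero_mul, add_zero] at this

/-- A binary matroid without `M(K₄)`-minor has a matching representation. -/
theorem isMatchingRepresentable [DecidableEq α] (h : OrthoPair E C R)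
    (hK : ¬ HasK4Certificate E C R) : IsMatchingRepresentable (E : Set α) (CodeIndep E C) := by
  induction E using Finset.strongInduction generalizing C R with
  | H E ih =>
    rcases E.eq_empty_or_nonempty with rfl | hE
    · refine ⟨Unit, Empty, inferInstance, fun _ ↦ ∅, fun _ ↦ (), by simp, fun I hI ↦ ?_⟩
      refine ⟨fun _ ↦ ⟨fun j ↦ j.elim, fun j ↦ j.elim, fun j ↦ j.elim, fun j ↦ j.elim⟩, ?_⟩
      intro _ c _ _ i hi
      simp at hi
    have hins : ∀ e ∈ E, (insert e (E.erase e : Finset α) : Set α) = E := fun e he ↦ by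
      rw [← Finset.coe_insert, Finset.insert_erase he]
    have hdel : ∀ e ∈ E, IsMatchingRepresentable (E.erase e : Finset α)
        (CodeIndep (E.erase e) (shortenCode C {e})) := fun e he ↦
      ih _ (Finset.erase_ssubset he) (h.delete_singleton he) fun h ↦ hK h.of_delete
    have hcon : ∀ e ∈ E, IsMatchingRepresentable (E.erase e : Finset α)
        (CodeIndep (E.erase e) (punctureCode C {e})) := fun e he ↦
      ih _ (Finset.erase_ssubset he) (h.contract_singleton he) fun h ↦
        hK (h.symm.of_delete).symm
    obtain ⟨a, b, hab | hab⟩ := h.exists_hasShortVector hK hE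
    · by_cases hne : a = b
      · subst hne
        rw [← hins a hab.1]
        refine (hdel a hab.1).loop_extension fun I _ ↦ ?_
        by_cases haI : a ∈ I
        · simp [haI, not_codeIndep_of_hasShortVector hab haI haI]
        · simp [haI, codeIndep_delete_iff hab.1 haI]
      · rw [← hins b hab.2.1]
        refine (hdel b hab.2.1).parallel_extension (a := a) (by simp) (by simp [hab.1, hne])
          fun I _ ↦ ?_
        by_cases hbI : b ∈ I
        · by_cases haI : a ∈ I
          · simp [haI, hbI, not_codeIndep_of_hasShortVector hab haI hbI]
          have haI' : a ∉ I \ {b} := fun h ↦ haI h.1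
          have hbI' : b ∉ I \ {b} := fun h ↦ h.2 rfl
          have hbI'' : b ∉ insert a (I \ {b}) := by simp [Ne.symm hne]
          have hIb : insert b (I \ {b}) = I := insert_sdiff_self_of_mem hbI
          rw [codeIndep_delete_iff hab.2.1 hbI'']
          simp only [hbI, haI, not_true_eq_false, not_false_eq_true, false_and, true_and, false_or]
          refine ⟨fun hI ↦ ?_, fun hI ↦ ?_⟩
          · exact h.codeIndep_insert_of_parallel hab.symm hbI' (hIb.symm ▸ hI)
          · exact hIb ▸ h.codeIndep_insert_of_parallel hab haI' hI
        · simp [hbI, codeIndep_delete_iff hab.2.1 hbI]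
    · by_cases hne : a = b
      · subst hne
        rw [← hins a hab.1]
        refine (hdel a hab.1).coloop_extension fun I _ ↦ ?_
        rw [codeIndep_delete_iff hab.1 fun h ↦ h.2 rfl]
        refine ⟨fun hI ↦ hI.mono fun i _ hi ↦ hi.1, fun hI c hc hs ↦ hI c hc fun i hi h0 ↦ ?_⟩
        refine ⟨hs i hi h0, fun hia ↦ h0 ?_⟩
        rw [show i = a from hia]
        exact h.symm.loop_orth hab hc
      · have hb := hab.2.1
        have hloop : ¬ HasShortVector E C b b := by
          intro hbb
          obtain ⟨-, -, r, hr, -, hrb, -⟩ := hab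
          have := h.loop_orth hbb hr
          rw [hrb] at this
          exact one_ne_zero this
        have heq : ∀ c ∈ C, c a = c b := fun c hc ↦
          CharTwo.add_eq_zero.1 (h.symm.shortVector_orth hab hne hc)
        rw [← hins b hb]
        refine (hcon b hb).series_extension (a := a) (by simp) (by simp [hab.1, hne]) fun I _ ↦ ?_
        rw [codeIndep_contract_iff hb hloop, codeIndep_contract_iff hb hloop]
        by_cases hI : a ∈ I ∧ b ∈ I
        · simp [hI]
        · simp only [hI, not_false_eq_true, true_and]
          -- All vectors of `C` agree at `a` and `b`. If `J` misses one of the two, a vector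
          -- supported in `J` vanishes at both, so they can be removed without affecting
          -- independence.
          have hcollapse : ∀ J : Set α, J ⊆ insert b I ∪ I → ¬ (a ∈ J ∧ b ∈ J) →
              CodeIndep E C (I \ {a, b}) → CodeIndep E C J := by
            intro J hJI hJ hind c hc hs
            have hb0 : c b = 0 := by
              by_contra hne0
              exact hJ ⟨hs a hab.1 (by rwa [heq c hc]), hs b hb hne0⟩
            refine hind c hc fun i hi h0 ↦ ?_
            have hib : i ≠ b := fun h ↦ h0 (h ▸ hb0)
            have hia : i ≠ a := fun h ↦ h0 (by rw [h, heq c hc, hb0])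
            refine ⟨?_, fun h ↦ h.elim hia hib⟩
            rcases hJI (hs i hi h0) with (h | h) | h
            exacts [(hib h).elim, h, h]
          have hsub : I \ {a, b} ⊆ I := sdiff_subset
          constructor
          · intro hind
            refine Or.inr (hcollapse _ ?_ ?_ (hind.mono fun i _ hi ↦ hi.1))
            · exact (insert_subset_insert hsub).trans subset_union_left
            · simp [hne]
          · rintro (⟨h1, h2, -⟩ | hind)
            · exact (hI ⟨h1, h2⟩).elim
            · exact hcollapse _ subset_union_right hI (hind.mono fun i _ hi ↦ Or.inr hi)

end OrthoPair

end

/-! ### Binary matroids and their codes -/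

theorem shortenCode_insert {α : Type*} (C : Set (α → ZMod 2)) (D : Set α) {e : α} (he : e ∉ D) :
    shortenCode C (insert e D) = shortenCode (shortenCode C D) {e} := by
  classical
  ext c
  constructor
  · rintro ⟨c', hc', h0, hcc⟩
    refine ⟨Function.update c e 0, ⟨c', hc', fun i hi ↦ h0 i (Or.inr hi), fun i hi ↦ ?_⟩,
      fun i hi ↦ ?_, fun i hi ↦ Function.update_of_ne hi ..⟩
    · by_cases hie : i = e
      · rw [hie, Function.update_self, h0 e (Or.inl rfl)]
      · rw [Function.update_of_ne hie, hcc i fun h ↦ h.elim hie hi]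
    · rw [show i = e from hi, Function.update_self]
  · rintro ⟨c', ⟨c'', hc, h0, hcc⟩, h0', hcc'⟩
    refine ⟨c'', hc, ?_, fun i hi ↦ ?_⟩
    · rintro i (rfl | hi)
      · rw [hcc i he, h0' i rfl]
      · exact h0 i hi
    · rw [hcc i fun h ↦ hi (Or.inr h), hcc' i fun h ↦ hi (Or.inl h)]

theorem punctureCode_insert {α : Type*} (C : Set (α → ZMod 2)) (D : Set α) (e : α) :
    punctureCode C (insert e D) = punctureCode (punctureCode C D) {e} := by
  classical
  ext c
  constructor
  · rintro ⟨c', hc', hcc⟩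
    refine ⟨Function.update c e (c' e), ⟨c', hc', fun i hi ↦ ?_⟩,
      fun i hi ↦ Function.update_of_ne hi ..⟩
    by_cases hie : i = e
    · rw [hie, Function.update_self]
    · rw [Function.update_of_ne hie, hcc i fun h ↦ h.elim hie hi]
  · rintro ⟨c', ⟨c'', hc, hcc⟩, hcc'⟩
    exact ⟨c'', hc, fun i hi ↦ by
      rw [hcc i fun h ↦ hi (Or.inr h), hcc' i fun h ↦ hi (Or.inl h)]⟩

namespace Matroid

/-- `M` is the binary matroid on `E` with cycle space `C` and cocycle space `R`. -/
structure HasCode {α : Type*} (M : Matroid α) (E : Finset α) (C R : Set (α → ZMod 2)) : Prop where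
  ground : M.E = E
  orthoPair : OrthoPair E C R
  indep_iff : ∀ I, M.Indep I ↔ I ⊆ E ∧ CodeIndep E C I

namespace HasCode

variable {α : Type*} [DecidableEq α] {M : Matroid α} {E : Finset α} {C R : Set (α → ZMod 2)}
  {e : α}

theorem delete_singleton (h : M.HasCode E C R) (he : e ∈ E) :
    (M ＼ {e}).HasCode (E.erase e) (shortenCode C {e}) (punctureCode R {e}) := by
  refine ⟨by rw [delete_ground, h.ground, Finset.coe_erase], h.orthoPair.delete_singleton he,
    fun I ↦ ?_⟩
  rw [delete_indep_iff, h.indep_iff, Finset.coe_erase, subset_sdiff,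
    disjoint_singleton_right]
  by_cases heI : e ∈ I
  · simp [heI]
  · rw [codeIndep_delete_iff he heI]
    tauto

/-- If `e` is not a loop, this is the usual description of independence in a contraction. If `e` is
a loop, contraction is deletion, and puncturing `C` equals shortening it, since the loop vector can
be added to clear the coordinate `e`. -/
theorem contract_singleton (h : M.HasCode E C R) (he : e ∈ E) :
    (M ／ {e}).HasCode (E.erase e) (punctureCode C {e}) (shortenCode R {e}) := by
  refine ⟨by rw [contract_ground, h.ground, Finset.coe_erase], h.orthoPair.contract_singleton he,
    fun I ↦ ?_⟩
  have hsingle : M.Indep {e} ↔ ¬ HasShortVector E C e e := by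
    rw [h.indep_iff]
    constructor
    · exact fun hi hs ↦ not_codeIndep_of_hasShortVector hs (mem_singleton e) (mem_singleton e) hi.2
    · intro hs
      refine ⟨by simpa using he, fun c hc hsupp i hi ↦ ?_⟩
      by_contra hne
      obtain rfl : i = e := hsupp i hi hne
      exact hs ⟨he, he, c, hc, (ZMod.ne_zero_iff_of_two _).1 hne, (ZMod.ne_zero_iff_of_two _).1 hne,
        fun j hj hji _ ↦ by_contra fun hj0 ↦ hji (hsupp j hj hj0)⟩
  by_cases hs : HasShortVector E C e e
  · have hloop : {e} ⊆ M.loops := by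
      rw [singleton_subset_iff]
      refine (singleton_dep.1 ⟨fun hi ↦ hsingle.1 hi hs, ?_⟩ : M.IsLoop e)
      rw [h.ground]
      simpa using he
    rw [contract_eq_delete_of_subset_loops hloop, (h.delete_singleton he).indep_iff]
    have hcode : punctureCode C {e} = shortenCode C {e} := by
      ext c
      constructor
      · rintro ⟨c', hc', hcc⟩
        obtain ⟨-, -, c₀, hc₀, h₀, -, h0⟩ := hs
        have : Function.update c' e 0 ∈ C := by
          refine h.orthoPair.congr_mem
            (h.orthoPair.add_mem hc' (h.orthoPair.smul_mem (c' e) hc₀)) fun i hi ↦ ?_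
          change c' i + c' e * c₀ i = _
          by_cases hie : i = e
          · rw [hie, h₀, mul_one, Function.update_self]
            exact CharTwo.add_self_eq_zero _
          · rw [h0 i hi hie hie, Function.update_of_ne hie, mul_zero, add_zero]
        refine ⟨_, this, fun i hi ↦ ?_, fun i hi ↦ ?_⟩
        · rw [show i = e from hi, Function.update_self]
        · rw [Function.update_of_ne hi, hcc i hi]
      · rintro ⟨c', hc', -, hcc⟩
        exact ⟨c', hc', hcc⟩
    rw [hcode]
  · rw [(indep_singleton.1 (hsingle.2 hs)).contractElem_indep_iff, h.indep_iff,
      codeIndep_contract_iff he hs, Finset.coe_erase, subset_sdiff,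
      disjoint_singleton_right, insert_subset_iff]
    simp only [Finset.mem_coe, he, true_and]
    tauto

theorem delete (h : M.HasCode E C R) (D : Finset α) (hD : D ⊆ E) :
    (M ＼ D).HasCode (E \ D) (shortenCode C D) (punctureCode R D) := by
  induction D using Finset.induction_on with
  | empty => simpa [shortenCode, punctureCode, ← funext_iff] using h
  | insert e D he ih =>
    obtain ⟨heE, hDE⟩ := Finset.insert_subset_iff.1 hD
    have := (ih hDE).delete_singleton (e := e) (Finset.mem_sdiff.2 ⟨heE, he⟩)
    have herase : (E \ D).erase e = E \ insert e D := by
      ext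
      simp only [Finset.mem_erase, Finset.mem_sdiff, Finset.mem_insert]
      tauto
    rwa [delete_delete, union_singleton, herase, ← shortenCode_insert _ _ (by simpa using he),
      ← punctureCode_insert, ← Finset.coe_insert] at this

theorem contract (h : M.HasCode E C R) (K : Finset α) (hK : K ⊆ E) :
    (M ／ K).HasCode (E \ K) (punctureCode C K) (shortenCode R K) := by
  induction K using Finset.induction_on with
  | empty => simpa [shortenCode, punctureCode, ← funext_iff] using h
  | insert e K he ih =>
    obtain ⟨heE, hKE⟩ := Finset.insert_subset_iff.1 hK
    have := (ih hKE).contract_singleton (e := e) (Finset.mem_sdiff.2 ⟨heE, he⟩)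
    have herase : (E \ K).erase e = E \ insert e K := by
      ext
      simp only [Finset.mem_erase, Finset.mem_sdiff, Finset.mem_insert]
      tauto
    rwa [contract_contract, union_singleton, herase, ← shortenCode_insert _ _ (by simpa using he),
      ← punctureCode_insert, ← Finset.coe_insert] at this

/-- Contracting `K` and deleting `D`. -/
theorem minor (h : M.HasCode E C R) (K D : Finset α) (hK : K ⊆ E) (hD : D ⊆ E)
    (hKD : Disjoint K D) :
    (M ／ K ＼ D).HasCode ((E \ K) \ D) (shortenCode (punctureCode C K) D)
      (punctureCode (shortenCode R K) D) :=
  (h.contract K hK).delete D (Finset.subset_sdiff.2 ⟨hD, hKD.symm⟩)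

end HasCode

/-- The cycle space of a vector matroid over `GF(2)`: the linear relations between the columns. -/
def relationCode {α m : Type*} (A : Matrix m α (ZMod 2)) (E : Finset α) : Set (α → ZMod 2) :=
  {c | ∀ i, ∑ e ∈ E, A i e * c e = 0}

/-- The orthogonal complement of a code. -/
def dualCode {α : Type*} (E : Finset α) (C : Set (α → ZMod 2)) : Set (α → ZMod 2) :=
  {r | ∀ c ∈ C, ∑ e ∈ E, r e * c e = 0}

theorem hasCode_vectorMatroid {α m : Type*} (A : Matrix m α (ZMod 2)) (E : Finset α) :
    (vectorMatroid A (E : Set α)).HasCode E (relationCode A E) (dualCode E (relationCode A E)) := by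
  classical
  -- The rows of `A` are themselves in the dual code, so a vector orthogonal to the dual satisfies
  -- all the defining relations.
  refine ⟨rfl, ⟨fun c ↦ ⟨fun hc r hr ↦ hr c hc, fun hc i ↦ hc (A i) fun c hc ↦ hc i⟩,
    fun r ↦ Iff.rfl⟩, fun I ↦ ?_⟩
  rw [vectorMatroid_indep_iff, linearIndepOn_zmod_two_iff]
  refine and_congr_right fun hI ↦ ⟨fun h c hc hs ↦ ?_, fun h S hS hsum ↦ ?_⟩
  · have hS := h (E.filter fun e ↦ c e ≠ 0) (fun e he ↦ ?_) ?_
    · intro i hi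
      by_contra hne
      have : i ∈ E.filter fun e ↦ c e ≠ 0 := Finset.mem_filter.2 ⟨hi, hne⟩
      simp [hS] at this
    · obtain ⟨h1, h2⟩ := Finset.mem_filter.1 he
      exact hs e h1 h2
    · funext i
      rw [Finset.sum_apply, Finset.sum_filter]
      refine Eq.trans ?_ (hc i)
      refine Finset.sum_congr rfl fun e _ ↦ ?_
      rcases ZMod.eq_zero_or_eq_one_of_two (c e) with h0 | h0 <;> simp [h0]
  · have hSE : S ⊆ E := by exact_mod_cast hS.trans hI
    have := h (fun e ↦ if e ∈ S then 1 else 0) (fun i ↦ ?_) (fun i _ hi ↦ ?_)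
    · rw [Finset.eq_empty_iff_forall_notMem]
      intro e he
      simpa [he] using this e (hSE he)
    · simp only [mul_ite, mul_one, mul_zero]
      rw [← Finset.sum_filter, Finset.filter_mem_eq_inter, Finset.inter_eq_right.2 hSE]
      simpa using congrFun hsum i
    · by_contra hiS
      exact hi (if_neg fun h ↦ hiS (hS h))

theorem isBinary_vectorMatroid {α m : Type*} [Finite m] (A : Matrix m α (ZMod 2)) (E : Set α) :
    (vectorMatroid A E).IsBinary := by
  obtain ⟨n, ⟨σ⟩⟩ := Finite.exists_equiv_fin m
  refine ⟨n, A.submatrix σ.symm id, Matroid.ext_indep rfl fun I _ ↦ ?_⟩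
  simp only [vectorMatroid_indep_iff, linearIndepOn_zmod_two_iff, funext_iff, Finset.sum_apply,
    vectorMatroid_ground, σ.symm.forall_congr_left, Equiv.symm_symm, Matrix.submatrix_apply, id,
    Equiv.symm_apply_apply, Pi.zero_apply]

/-- A finite binary matroid and its splitting by `H` have codes; a cycle of the splitting is a
cycle of the matroid that meets `H` in an even number of elements. -/
theorem exists_hasCode_splitting {α : Type*} {M : Matroid α} (hM : M.IsBinary)
    (hfin : M.E.Finite) (H : Set α) [DecidablePred (· ∈ H)] :
    (M.splitting hM H).IsBinary ∧ ∃ (E : Finset α) (C R C' R' : Set (α → ZMod 2)),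
      M.HasCode E C R ∧ (M.splitting hM H).HasCode E C' R' ∧
      ∀ c, c ∈ C' ↔ c ∈ C ∧ ∑ e ∈ E, (if e ∈ H then 1 else 0) * c e = 0 := by
  obtain ⟨m, A, hA⟩ := id hM
  have hE : (hfin.toFinset : Set α) = M.E := hfin.coe_toFinset
  rw [splitting_eq M hM H A hA]
  refine ⟨isBinary_vectorMatroid _ _, hfin.toFinset, relationCode A hfin.toFinset,
    dualCode hfin.toFinset (relationCode A hfin.toFinset),
    relationCode (splittingMatrix A H) hfin.toFinset,
    dualCode hfin.toFinset (relationCode (splittingMatrix A H) hfin.toFinset), ?_, ?_, fun c ↦ ?_⟩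
  · have := hasCode_vectorMatroid A hfin.toFinset
    rwa [hE, ← hA] at this
  · have := hasCode_vectorMatroid (splittingMatrix A H) hfin.toFinset
    rwa [hE] at this
  · simp only [relationCode, mem_ofPred_eq, Sum.forall, splittingMatrix, Matrix.fromRows_apply_inl,
      Matrix.fromRows_apply_inr, Matrix.of_apply, forall_const]
    congr!

end Matroid

/-- Adding the parity check `h` to a code enlarges its dual by the translates by `h`. -/
theorem OrthoPair.mem_right_or_add_mem {α : Type*} {E : Finset α} {C R C' R' : Set (α → ZMod 2)}
    (hp : OrthoPair E C R) (hp' : OrthoPair E C' R') (h : α → ZMod 2)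
    (hC : ∀ c, c ∈ C' ↔ c ∈ C ∧ ∑ e ∈ E, h e * c e = 0) (r : α → ZMod 2) :
    r ∈ R' ↔ r ∈ R ∨ r + h ∈ R := by
  have hadd : ∀ r c : α → ZMod 2, ∑ e ∈ E, (r + h) e * c e =
      ∑ e ∈ E, r e * c e + ∑ e ∈ E, h e * c e := fun r c ↦ by
    simp only [Pi.add_apply, add_mul, Finset.sum_add_distrib]
  have hadd' : ∀ r c c' : α → ZMod 2, ∑ e ∈ E, r e * (c + c') e =
      ∑ e ∈ E, r e * c e + ∑ e ∈ E, r e * c' e := fun r c c' ↦ by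
    simp only [Pi.add_apply, mul_add, Finset.sum_add_distrib]
  constructor
  · intro hr
    -- Here `C'` has index at most two in `C`. A vector of `R'` vanishes on `C'` and is constant on
    -- the other coset: if the constant is `0` it lies in `R`, and if it is `1` adding `h` corrects
    -- it.
    by_cases hex : ∃ c₀ ∈ C, ∑ e ∈ E, h e * c₀ e = 1
    · obtain ⟨c₀, hc₀, h₀⟩ := hex
      have key : ∀ c ∈ C, ∑ e ∈ E, h e * c e = 1 →
          ∑ e ∈ E, r e * c e = ∑ e ∈ E, r e * c₀ e := by
        intro c hc h1
        have := hp'.sum_eq_zero hr ((hC (c + c₀)).2 ⟨hp.add_mem hc hc₀, by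
          rw [hadd', h1, h₀]; rfl⟩)
        rw [hadd'] at this
        exact CharTwo.add_eq_zero.1 this
      rcases ZMod.eq_zero_or_eq_one_of_two (∑ e ∈ E, r e * c₀ e) with h2 | h2
      · refine Or.inl ((hp.mem_right r).2 fun c hc ↦ ?_)
        rcases ZMod.eq_zero_or_eq_one_of_two (∑ e ∈ E, h e * c e) with h1 | h1
        · exact hp'.sum_eq_zero hr ((hC c).2 ⟨hc, h1⟩)
        · rw [key c hc h1, h2]
      · refine Or.inr ((hp.mem_right _).2 fun c hc ↦ ?_)
        rw [hadd]
        rcases ZMod.eq_zero_or_eq_one_of_two (∑ e ∈ E, h e * c e) with h1 | h1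
        · rw [h1, hp'.sum_eq_zero hr ((hC c).2 ⟨hc, h1⟩), add_zero]
        · rw [key c hc h1, h2, h1]
          rfl
    · push Not at hex
      exact Or.inl ((hp.mem_right r).2 fun c hc ↦ hp'.sum_eq_zero hr ((hC c).2
        ⟨hc, (ZMod.eq_zero_or_eq_one_of_two _).resolve_right (hex c hc)⟩))
  · rintro (hr | hr)
    · exact (hp'.mem_right r).2 fun c hc ↦ hp.sum_eq_zero hr ((hC c).1 hc).1
    · refine (hp'.mem_right r).2 fun c hc ↦ ?_
      have := hp.sum_eq_zero hr ((hC c).1 hc).1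
      rwa [hadd, ((hC c).1 hc).2, add_zero] at this

/-! ### The matroids `M(K₄)`, `M(Q₂)`, `M(Q₃)` and `M(Q₄)` -/

/-- The vectors in the kernel of `k4Cocycles` modulo `t`: the cycle space of the quotient of
`M(K₄)` by the point `t` of the projective plane over `GF(2)`. -/
def k4QuotientCode (t : Fin 3 → ZMod 2) : Set (Fin 6 → ZMod 2) :=
  {v | ∃ s, ∀ k, ∑ j, k4Cocycles k j * v j = s * t k}

/-- The incidence matrix of `Q₂`. -/
def incQ2 : Matrix (Fin 3) (Fin 6) (ZMod 2) :=
  ![![0, 1, 1, 1, 1, 0], ![1, 1, 1, 0, 0, 0], ![1, 0, 0, 1, 1, 0]]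

/-- The incidence matrix of `Q₄`. -/
def incQ4 : Matrix (Fin 3) (Fin 6) (ZMod 2) :=
  ![![0, 0, 1, 1, 1, 1], ![1, 1, 1, 1, 0, 0], ![1, 1, 0, 0, 1, 1]]

theorem Graph.cycleMatroid_ofEnds_eq_vectorMatroid {V E : Type*} (ends : E → Sym2 V)
    (A : Matrix V E (ZMod 2))
    (hA : ∀ e, ∃ x y, ends e = s(x, y) ∧
      ∀ w, A w e = Finsupp.single x 1 w + Finsupp.single y 1 w) :
    (Graph.ofEnds ends).cycleMatroid = Matroid.vectorMatroid A univ := by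
  refine Matroid.ext_indep rfl fun I _ ↦ ?_
  rw [cycleMatroid_indep_iff, isForest_iff, Matroid.vectorMatroid_indep_iff,
    Matroid.linearIndepOn_zmod_two_iff, Matroid.linearIndepOn_zmod_two_iff]
  have hcol : ∀ e w, (Graph.ofEnds ends).incVec e w = A w e := by
    intro e w
    obtain ⟨x, y, h, hxy⟩ := hA e
    rw [incVec_eq (show (Graph.ofEnds ends).IsLink e x y from h), hxy, Finsupp.add_apply]
  refine and_congr Iff.rfl (forall_congr' fun S ↦ forall_congr' fun _ ↦ imp_congr ?_ Iff.rfl)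
  rw [Finsupp.ext_iff, funext_iff]
  simp only [Finsupp.finsetSum_apply, hcol, Finset.sum_apply, Finsupp.zero_apply, Pi.zero_apply]

theorem cycleMatroid_graphQ2 : graphQ2.cycleMatroid = Matroid.vectorMatroid incQ2 univ := by
  refine Graph.cycleMatroid_ofEnds_eq_vectorMatroid _ _ fun e ↦ ?_
  simp only [Finsupp.single_apply]
  revert e
  simp only [Fin.forall_fin_succ]
  refine ⟨⟨1, 2, rfl, ?_⟩, ⟨0, 1, rfl, ?_⟩, ⟨0, 1, rfl, ?_⟩, ⟨0, 2, rfl, ?_⟩, ⟨0, 2, rfl, ?_⟩,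
    ⟨0, 0, rfl, ?_⟩, ?_⟩ <;> decide

/-- A loop has zero incidence vector at whichever vertex it sits, so the incidence matrix of `Q₂`
also serves here. -/
theorem cycleMatroid_graphQ3 : graphQ3.cycleMatroid = Matroid.vectorMatroid incQ2 univ := by
  refine Graph.cycleMatroid_ofEnds_eq_vectorMatroid _ _ fun e ↦ ?_
  simp only [Finsupp.single_apply]
  revert e
  simp only [Fin.forall_fin_succ]
  refine ⟨⟨1, 2, rfl, ?_⟩, ⟨0, 1, rfl, ?_⟩, ⟨0, 1, rfl, ?_⟩, ⟨0, 2, rfl, ?_⟩, ⟨0, 2, rfl, ?_⟩,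
    ⟨2, 2, rfl, ?_⟩, ?_⟩ <;> decide

theorem cycleMatroid_graphQ4 : graphQ4.cycleMatroid = Matroid.vectorMatroid incQ4 univ := by
  refine Graph.cycleMatroid_ofEnds_eq_vectorMatroid _ _ fun e ↦ ?_
  simp only [Finsupp.single_apply]
  revert e
  simp only [Fin.forall_fin_succ]
  refine ⟨⟨1, 2, rfl, ?_⟩, ⟨1, 2, rfl, ?_⟩, ⟨0, 1, rfl, ?_⟩, ⟨0, 1, rfl, ?_⟩, ⟨0, 2, rfl, ?_⟩,
    ⟨0, 2, rfl, ?_⟩, ?_⟩ <;> decide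

set_option synthInstance.maxSize 2000 in
set_option synthInstance.maxHeartbeats 200000 in
set_option maxRecDepth 10000 in
/-- Each of the seven quotients of `M(K₄)` by a point of the plane is `M(Q₂)` or `M(Q₄)`. -/
theorem k4QuotientCode_cases (t : Fin 3 → ZMod 2) (ht : t ≠ 0) :
    ∃ τ : Fin 6 → Fin 6, τ.Injective ∧
      ((¬ (t 0 = 1 ∧ t 1 = 1 ∧ t 2 = 1) ∧
          ∀ v, v ∈ k4QuotientCode t ↔ v ∘ τ ∈ Matroid.relationCode incQ2 Finset.univ) ∨
        (t 0 = 1 ∧ t 1 = 1 ∧ t 2 = 1) ∧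
          ∀ v, v ∈ k4QuotientCode t ↔ v ∘ τ ∈ Matroid.relationCode incQ4 Finset.univ) := by
  have hval : ∀ v, v ∈ k4QuotientCode t ↔ v ∈ k4QuotientCode ![t 0, t 1, t 2] := by
    have : t = ![t 0, t 1, t 2] := by
      ext i
      fin_cases i <;> rfl
    rw [← this]
    exact fun v ↦ Iff.rfl
  have ht' : ¬ (t 0 = 0 ∧ t 1 = 0 ∧ t 2 = 0) := by
    rintro ⟨h0, h1, h2⟩
    refine ht ?_
    ext i
    fin_cases i <;> assumption
  simp only [hval]
  clear hval ht
  revert ht'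
  generalize t 0 = t₀, t 1 = t₁, t 2 = t₂
  intro ht'
  have h2 := ZMod.eq_zero_or_eq_one_of_two
  have hmem : ∀ v, v ∈ k4QuotientCode ![t₀, t₁, t₂] ↔ ∃ s : ZMod 2,
      v 0 + v 1 + v 2 = s * t₀ ∧ v 0 + v 3 + v 4 = s * t₁ ∧ v 1 + v 3 + v 5 = s * t₂ := by
    intro v
    simp [k4QuotientCode, Fin.forall_fin_succ, Fin.sum_univ_succ, k4Cocycles, add_assoc]
  have hmem2 : ∀ v, v ∈ Matroid.relationCode incQ2 Finset.univ ↔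
      v 1 + v 2 + v 3 + v 4 = 0 ∧ v 0 + v 1 + v 2 = 0 ∧ v 0 + v 3 + v 4 = 0 := by
    intro v
    simp [Matroid.relationCode, Fin.forall_fin_succ, Fin.sum_univ_succ, incQ2, add_assoc]
  have hmem4 : ∀ v, v ∈ Matroid.relationCode incQ4 Finset.univ ↔
      v 2 + v 3 + v 4 + v 5 = 0 ∧ v 0 + v 1 + v 2 + v 3 = 0 ∧ v 0 + v 1 + v 4 + v 5 = 0 := by
    intro v
    simp [Matroid.relationCode, Fin.forall_fin_succ, Fin.sum_univ_succ, incQ4, add_assoc]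
  simp only [hmem, hmem2, hmem4, Function.comp_apply]
  -- The columns of `k4Cocycles` are the nonzero vectors other than `(1,1,1)`. If `t` is a column,
  -- its index is `τ 5`, which becomes the loop. The pairs `τ 1, τ 2` and `τ 3, τ 4` have column sum
  -- `t`, and the column `τ 0` is collinear with `t` and `(1,1,1)`. For `t = (1,1,1)` the pairs with
  -- column sum `t` are `05`, `14`, `23`.
  rcases h2 t₀ with rfl | rfl <;> rcases h2 t₁ with rfl | rfl <;> rcases h2 t₂ with rfl | rfl
  · simp at ht'
  · refine ⟨![0, 1, 2, 3, 4, 5], by decide, Or.inl ⟨by decide, fun v ↦ ?_⟩⟩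
    simp
    generalize v 0 = a, v 1 = b, v 2 = c, v 3 = d, v 4 = e, v 5 = f
    revert a b c d e f
    decide
  · refine ⟨![1, 0, 2, 3, 5, 4], by decide, Or.inl ⟨by decide, fun v ↦ ?_⟩⟩
    simp
    generalize v 0 = a, v 1 = b, v 2 = c, v 3 = d, v 4 = e, v 5 = f
    revert a b c d e f
    decide
  · refine ⟨![2, 0, 1, 4, 5, 3], by decide, Or.inl ⟨by decide, fun v ↦ ?_⟩⟩
    simp
    generalize v 0 = a, v 1 = b, v 2 = c, v 3 = d, v 4 = e, v 5 = f
    revert a b c d e f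
    decide
  · refine ⟨![3, 0, 4, 1, 5, 2], by decide, Or.inl ⟨by decide, fun v ↦ ?_⟩⟩
    simp
    generalize v 0 = a, v 1 = b, v 2 = c, v 3 = d, v 4 = e, v 5 = f
    revert a b c d e f
    decide
  · refine ⟨![4, 0, 3, 2, 5, 1], by decide, Or.inl ⟨by decide, fun v ↦ ?_⟩⟩
    simp
    generalize v 0 = a, v 1 = b, v 2 = c, v 3 = d, v 4 = e, v 5 = f
    revert a b c d e f
    decide
  · refine ⟨![5, 1, 3, 2, 4, 0], by decide, Or.inl ⟨by decide, fun v ↦ ?_⟩⟩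
    simp
    generalize v 0 = a, v 1 = b, v 2 = c, v 3 = d, v 4 = e, v 5 = f
    revert a b c d e f
    decide
  · refine ⟨![0, 5, 1, 4, 2, 3], by decide, Or.inr ⟨by decide, fun v ↦ ?_⟩⟩
    simp
    generalize v 0 = a, v 1 = b, v 2 = c, v 3 = d, v 4 = e, v 5 = f
    revert a b c d e f
    decide

/-! ### Codes determined by independent sets, and relabelling -/

namespace OrthoPair

variable {α β : Type*} {E : Finset α} {C R : Set (α → ZMod 2)}

/-- A binary code is determined by its independent sets. -/
theorem mem_of_codeIndep_iff [DecidableEq α] {C₁ R₁ C₂ R₂ : Set (α → ZMod 2)}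
    (h₁ : OrthoPair E C₁ R₁) (h₂ : OrthoPair E C₂ R₂)
    (h : ∀ I ⊆ (E : Set α), CodeIndep E C₁ I ↔ CodeIndep E C₂ I) {c : α → ZMod 2} (hc : c ∈ C₁) :
    c ∈ C₂ := by
  obtain ⟨n, hn⟩ : ∃ n, (E.filter fun i ↦ c i ≠ 0).card = n := ⟨_, rfl⟩
  induction n using Nat.strong_induction_on generalizing c with
  | _ n ih =>
    have hsupp : ∀ d : α → ZMod 2, {i | i ∈ E ∧ d i ≠ 0} ⊆ (E : Set α) := fun d i hi ↦ hi.1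
    -- if `d` is nonzero in one of the codes, the support of `d` contains that of a vector of the other
    have descend : ∀ {C C' : Set (α → ZMod 2)},
        (∀ I ⊆ (E : Set α), CodeIndep E C I ↔ CodeIndep E C' I) → ∀ d ∈ C, (∃ i ∈ E, d i ≠ 0) →
        ∃ u ∈ C', (∀ i ∈ E, u i ≠ 0 → d i ≠ 0) ∧ ∃ i ∈ E, u i ≠ 0 := by
      intro C C' h d hd ⟨i, hi, hne⟩
      have hdep : ¬ CodeIndep E C' {i | i ∈ E ∧ d i ≠ 0} := by
        rw [← h _ (hsupp d)]
        exact fun hind ↦ hne (hind d hd (fun j hj hj0 ↦ ⟨hj, hj0⟩) i hi)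
      unfold CodeIndep at hdep
      push Not at hdep
      obtain ⟨u, hu, hs, j, hj, huj⟩ := hdep
      exact ⟨u, hu, fun i hi hu0 ↦ (hs i hi hu0).2, j, hj, huj⟩
    by_cases hc0 : ∃ i ∈ E, c i ≠ 0
    · obtain ⟨d, hd, hdc, hd0⟩ := descend h c hc hc0
      obtain ⟨u, hu, hud, j, hj, huj⟩ := descend (fun I hI ↦ (h I hI).symm) d hd hd0
      -- The supports satisfy `supp u ⊆ supp d ⊆ supp c`, with `c`, `u` in `C₁` and `d` in `C₂`. If
      -- all are equal, `c` agrees with `d`; otherwise `u` and `c + u` have smaller supports than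
      -- `c`, and induction applies to both.
      by_cases huc : ∀ i ∈ E, c i ≠ 0 → u i ≠ 0
      · refine h₂.congr_mem hd fun i hi ↦ ?_
        have h1 := hdc i hi
        have h2 := hud i hi
        have h3 := huc i hi
        rcases ZMod.eq_zero_or_eq_one_of_two (c i) with hci | hci <;>
          rcases ZMod.eq_zero_or_eq_one_of_two (d i) with hdi | hdi <;> simp_all
      push Not at huc
      obtain ⟨i, hi, hci, hui⟩ := huc
      have hu₂ : u ∈ C₂ := by
        refine ih _ ?_ hu rfl
        rw [← hn]
        refine Finset.card_lt_card (Finset.ssubset_iff_subset_ne.2 ⟨fun k hk ↦ ?_, fun heq ↦ ?_⟩)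
        · rw [Finset.mem_filter] at hk ⊢
          exact ⟨hk.1, hdc k hk.1 (hud k hk.1 hk.2)⟩
        · have : i ∈ E.filter fun i ↦ u i ≠ 0 := by
            rw [heq]
            exact Finset.mem_filter.2 ⟨hi, hci⟩
          exact (Finset.mem_filter.1 this).2 hui
      have hcu₂ : c + u ∈ C₂ := by
        refine ih _ ?_ (h₁.add_mem hc hu) rfl
        rw [← hn]
        refine Finset.card_lt_card (Finset.ssubset_iff_subset_ne.2 ⟨fun k hk ↦ ?_, fun heq ↦ ?_⟩)
        · rw [Finset.mem_filter] at hk ⊢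
          refine ⟨hk.1, fun hck ↦ hk.2 ?_⟩
          have huk : u k = 0 := by_contra fun huk ↦ hdc k hk.1 (hud k hk.1 huk) hck
          rw [Pi.add_apply, hck, huk, add_zero]
        · have hjc := hdc j hj (hud j hj huj)
          have : j ∈ E.filter fun i ↦ (c + u) i ≠ 0 := by
            rw [heq]
            exact Finset.mem_filter.2 ⟨hj, hjc⟩
          refine (Finset.mem_filter.1 this).2 ?_
          rw [Pi.add_apply, (ZMod.ne_zero_iff_of_two _).1 hjc, (ZMod.ne_zero_iff_of_two _).1 huj]
          rfl
      refine h₂.congr_mem (h₂.add_mem hcu₂ hu₂) fun k _ ↦ ?_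
      rw [Pi.add_apply, Pi.add_apply, add_assoc, CharTwo.add_self_eq_zero, add_zero]
    · push Not at hc0
      exact h₂.congr_mem h₂.zero_mem fun i hi ↦ (hc0 i hi).symm

theorem comap [Fintype β] [DecidableEq α] {C R : Set (β → ZMod 2)}
    (h : OrthoPair Finset.univ C R) {x : β → α} (hx : x.Injective) :
    OrthoPair (Finset.univ.image x) {c | c ∘ x ∈ C} {r | r ∘ x ∈ R} := by
  have hsum : ∀ r c : α → ZMod 2, ∑ i ∈ Finset.univ.image x, r i * c i =
      ∑ j, (r ∘ x) j * (c ∘ x) j := fun r c ↦ Finset.sum_image fun i _ j _ hij ↦ hx hij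
  constructor
  · intro c
    rw [mem_ofPred_eq, h.mem_left]
    refine ⟨fun hc r hr ↦ (hsum r c).trans (hc _ hr), fun hc r hr ↦ ?_⟩
    have hrx : Function.extend x r 0 ∘ x = r := Function.extend_comp hx ..
    have := hc (Function.extend x r 0) (by rwa [mem_ofPred_eq, hrx])
    rwa [hsum, hrx] at this
  · intro r
    rw [mem_ofPred_eq, h.mem_right]
    refine ⟨fun hr c hc ↦ (hsum r c).trans (hr _ hc), fun hr c hc ↦ ?_⟩
    have hcx : Function.extend x c 0 ∘ x = c := Function.extend_comp hx ..
    have := hr (Function.extend x c 0) (by rwa [mem_ofPred_eq, hcx])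
    rwa [hsum, hcx] at this

end OrthoPair

theorem codeIndep_comap_iff {α β : Type*} [Fintype β] [DecidableEq α] (C : Set (β → ZMod 2))
    {x : β → α} (hx : x.Injective) (S : Set β) :
    CodeIndep (Finset.univ.image x) {c | c ∘ x ∈ C} (x '' S) ↔ CodeIndep Finset.univ C S := by
  constructor
  · intro h v hv hs j _
    have hvx : Function.extend x v 0 ∘ x = v := Function.extend_comp hx ..
    have := h (Function.extend x v 0) (by rwa [mem_ofPred_eq, hvx]) (fun i hi hi0 ↦ ?_) (x j)
      (by simp)
    · rwa [hx.extend_apply] at this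
    · obtain ⟨k, -, rfl⟩ := Finset.mem_image.1 hi
      rw [hx.extend_apply] at hi0
      exact ⟨k, hs k (Finset.mem_univ _) hi0, rfl⟩
  · intro h c hc hs i hi
    obtain ⟨j, -, rfl⟩ := Finset.mem_image.1 hi
    refine h (c ∘ x) hc (fun k _ hk ↦ ?_) j (Finset.mem_univ _)
    exact hx.mem_set_image.1 (hs (x k) (by simp) hk)

namespace Matroid

variable {α β : Type*} {M N : Matroid α}

theorem hasMinorIso_iff {Q : Matroid β} (hQ : Q.E = univ) :
    M.HasMinorIso Q ↔ ∃ N, N ≤m M ∧ ∃ x : β → α, x.Injective ∧ N.E = range x ∧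
      ∀ S, N.Indep (x '' S) ↔ Q.Indep S := by
  have himage : ∀ (N : Matroid α) (e : N.E ≃ Q.E) (S : Set β),
      Subtype.val '' (e.symm '' (Subtype.val ⁻¹' S)) = (fun j ↦ (e.symm ⟨j, hQ ▸ mem_univ j⟩ : α)) '' S := by
    intro N e S
    ext i
    constructor
    · rintro ⟨_, ⟨y, hy, rfl⟩, rfl⟩
      exact ⟨y, hy, rfl⟩
    · rintro ⟨y, hy, rfl⟩
      exact ⟨_, ⟨⟨y, _⟩, hy, rfl⟩, rfl⟩
  constructor
  · rintro ⟨N, hN, e, he⟩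
    refine ⟨N, hN, fun j ↦ e.symm ⟨j, hQ ▸ mem_univ j⟩, fun i j hij ↦ ?_, ?_, fun S ↦ ?_⟩
    · exact congrArg Subtype.val (e.symm.injective (Subtype.ext hij))
    · ext i
      constructor
      · intro hi
        exact ⟨e ⟨i, hi⟩, by simp⟩
      · rintro ⟨j, rfl⟩
        exact (e.symm _).2
    · have := mapSetEquiv_indep_iff N e (I := S)
      rw [he, himage] at this
      simpa [hQ] using this.symm
  · rintro ⟨N, hN, x, hx, hE, hind⟩
    let e : N.E ≃ Q.E := ((Equiv.setCongr hE).trans (Equiv.ofInjective x hx).symm).trans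
      ((Equiv.Set.univ β).symm.trans (Equiv.setCongr hQ.symm))
    refine ⟨N, hN, e, Matroid.ext_indep rfl fun S _ ↦ ?_⟩
    rw [mapSetEquiv_indep_iff, himage, ← hind S]
    simp only [hQ, subset_univ, and_true]
    rfl

/-- `N` is the binary matroid on the range of `x` whose cycle space, with the elements labelled by
`x`, is `C`. -/
theorem HasCode.indep_image_iff [DecidableEq α] [Fintype β] {C' R' : Set (α → ZMod 2)} {x : β → α}
    (hx : x.Injective) (h : N.HasCode (Finset.univ.image x) C' R') {C : Set (β → ZMod 2)}
    (hC : ∀ c, c ∈ C' ↔ c ∘ x ∈ C) (S : Set β) :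
    N.Indep (x '' S) ↔ CodeIndep Finset.univ C S := by
  obtain rfl : C' = {c | c ∘ x ∈ C} := ext hC
  rw [h.indep_iff, codeIndep_comap_iff C hx]
  refine and_iff_right ?_
  rw [Finset.coe_image, Finset.coe_univ]
  exact image_mono (subset_univ S)

/-- An isomorphism is given only by independent sets; since these determine a binary code, the cycle
space of `Q` carries over to `N`. -/
theorem HasCode.mem_iff_of_indep_iff [DecidableEq α] [Fintype β] {C' R' : Set (α → ZMod 2)}
    {x : β → α} (hx : x.Injective) (h : N.HasCode (Finset.univ.image x) C' R')
    {C R : Set (β → ZMod 2)} {Q : Matroid β} (hQ : Q.HasCode Finset.univ C R)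
    (hind : ∀ S, N.Indep (x '' S) ↔ Q.Indep S) (c : α → ZMod 2) : c ∈ C' ↔ c ∘ x ∈ C := by
  have hcomap := hQ.orthoPair.comap hx
  have heq : ∀ I ⊆ ((Finset.univ.image x : Finset α) : Set α),
      CodeIndep (Finset.univ.image x) C' I ↔
        CodeIndep (Finset.univ.image x) {c | c ∘ x ∈ C} I := by
    intro I hI
    obtain ⟨S, rfl⟩ : ∃ S, x '' S = I := by
      rw [← subset_range_iff_exists_image_eq]
      simpa using hI
    rw [codeIndep_comap_iff C hx]
    have := hind S
    rw [h.indep_iff, hQ.indep_iff] at this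
    simpa [hI] using this
  exact ⟨fun hc ↦ h.orthoPair.mem_of_codeIndep_iff hcomap heq hc,
    fun hc ↦ hcomap.mem_of_codeIndep_iff h.orthoPair (fun I hI ↦ (heq I hI).symm) hc⟩

theorem HasInjectiveExchange.of_isMinor (h : M.HasInjectiveExchange) (hN : N ≤m M) :
    N.HasInjectiveExchange := by
  obtain ⟨K, D, rfl⟩ := hN
  exact (h.contract K).delete D

/-- `M(K₄)` does not have the injective exchange property. -/
theorem HasCode.not_hasInjectiveExchange [DecidableEq α] {C R : Set (α → ZMod 2)} {x : Fin 6 → α}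
    (hx : x.Injective) (h : N.HasCode (Finset.univ.image x) C R)
    {c r : Fin 3 → α → ZMod 2} (hc : ∀ k, c k ∈ C) (hr : ∀ k, r k ∈ R)
    (hcx : ∀ k j, c k (x j) = k4Cycles k j) (hrx : ∀ k j, r k (x j) = k4Cocycles k j) :
    ¬ N.HasInjectiveExchange := by
  have hindep : ∀ S : Set (Fin 6), (∀ v : Fin 6 → ZMod 2,
      (∀ k, ∑ j, k4Cocycles k j * v j = 0) → (∀ j, j ∉ S → v j = 0) → ∀ j, v j = 0) →
      N.Indep (x '' S) := by
    intro S hS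
    rw [h.indep_iff]
    refine ⟨by rw [Finset.coe_image, Finset.coe_univ]; exact image_mono (subset_univ S),
      fun d hd hs i hi ↦ ?_⟩
    obtain ⟨j, -, rfl⟩ := Finset.mem_image.1 hi
    refine hS (d ∘ x) (fun k ↦ ?_) (fun j hj ↦ ?_) j
    · rw [← h.orthoPair.sum_eq_zero (hr k) hd, Finset.sum_image fun i _ j _ hij ↦ hx hij]
      simp only [hrx, Function.comp_apply]
    · by_contra hne
      exact hj (hx.mem_set_image.1 (hs (x j) (by simp) hne))
  have hdep : ∀ d ∈ C, ∀ S : Set α, (∀ j, d (x j) ≠ 0 → x j ∈ S) → (∃ j, d (x j) ≠ 0) →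
      ¬ N.Indep S := by
    intro d hd S hS ⟨j, hj⟩ hi
    refine hj (((h.indep_iff S).1 hi).2 d hd (fun i hi ↦ ?_) (x j) (by simp))
    obtain ⟨k, -, rfl⟩ := Finset.mem_image.1 hi
    exact hS k
  have hT₀ : ∀ S : Set α, x 0 ∈ S → x 1 ∈ S → x 3 ∈ S → ¬ N.Indep S := fun S h0 h1 h3 ↦
    hdep (c 0) (hc 0) S (by simp [Fin.forall_fin_succ, hcx, k4Cycles, h0, h1]; exact h3)
      ⟨0, by rw [hcx]; decide⟩
  have hT₁ : ∀ S : Set α, x 0 ∈ S → x 2 ∈ S → x 4 ∈ S → ¬ N.Indep S := fun S h0 h2 h4 ↦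
    hdep (c 1) (hc 1) S (by simp [Fin.forall_fin_succ, hcx, k4Cycles, h0]; exact ⟨h2, h4⟩)
      ⟨0, by rw [hcx]; decide⟩
  have hT₂ : ∀ S : Set α, x 1 ∈ S → x 2 ∈ S → x 5 ∈ S → ¬ N.Indep S := fun S h1 h2 h5 ↦
    hdep (c 2) (hc 2) S (by simp [Fin.forall_fin_succ, hcx, k4Cycles, h1]; exact ⟨h2, h5⟩)
      ⟨1, by rw [hcx]; decide⟩
  have hT₃ : ∀ S : Set α, x 3 ∈ S → x 4 ∈ S → x 5 ∈ S → ¬ N.Indep S := fun S h3 h4 h5 ↦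
    hdep (c 0 + c 1 + c 2) (h.orthoPair.add_mem (h.orthoPair.add_mem (hc 0) (hc 1)) (hc 2)) S
      (by
        have hval : ∀ j, (c 0 + c 1 + c 2) (x j) = k4Cycles 0 j + k4Cycles 1 j + k4Cycles 2 j :=
          fun j ↦ by simp only [Pi.add_apply, hcx]
        intro j
        rw [hval]
        fin_cases j
        · exact fun h ↦ (h (by decide)).elim
        · exact fun h ↦ (h (by decide)).elim
        · exact fun h ↦ (h (by decide)).elim
        exacts [fun _ ↦ h3, fun _ ↦ h4, fun _ ↦ h5])
      ⟨3, by simp only [Pi.add_apply, hcx]; decide⟩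
  -- The sets `{0, 1, 5}` and `{2, 3, 4}` are complementary spanning trees of `K₄`. The four
  -- triangles above leave `4` as the only possible partner of both `0` and `5`.
  have hI : N.Indep (x '' {0, 1, 5}) := by
    refine hindep _ fun v hv hS ↦ ?_
    have h2 := hS 2 (by decide)
    have h3 := hS 3 (by decide)
    have h4 := hS 4 (by decide)
    simp [Fin.forall_fin_succ, Fin.sum_univ_succ, k4Cocycles, h2, h3, h4] at hv
    simp [Fin.forall_fin_succ, h2, h3, h4]
    grind
  have hJ : N.Indep (x '' {2, 3, 4}) := by
    refine hindep _ fun v hv hS ↦ ?_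
    have h0 := hS 0 (by decide)
    have h1 := hS 1 (by decide)
    have h5 := hS 5 (by decide)
    simp [Fin.forall_fin_succ, Fin.sum_univ_succ, k4Cocycles, h0, h1, h5] at hv
    simp [Fin.forall_fin_succ, h0, h1, h5]
    grind
  intro hex
  obtain ⟨ψ, hψ, hex⟩ := hex _ _ hI hJ
  have hmem : ∀ j S, x j ∈ x '' S ↔ j ∈ S := fun j S ↦ hx.mem_set_image
  have h0 : x 0 ∈ x '' {0, 1, 5} \ x '' {2, 3, 4} := by simp [hmem]
  have h5 : x 5 ∈ x '' {0, 1, 5} \ x '' {2, 3, 4} := by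
    rw [mem_sdiff, hmem, hmem]
    decide
  have hd0 : ¬ N.Indep (insert (x 0) (x '' {2, 3, 4})) :=
    hT₁ _ (mem_insert _ _) (by simp [hmem]) (by simp [hmem])
  have hd5 : ¬ N.Indep (insert (x 5) (x '' {2, 3, 4})) :=
    hT₃ _ (by simp [hmem]) (by simp [hmem]) (mem_insert _ _)
  have hψ0 : ψ (x 0) = x 4 := by
    obtain ⟨⟨⟨j, hj, hjx⟩, -⟩, h1, h2⟩ := hex _ h0 hd0
    rw [← hjx] at h1 h2 ⊢
    rcases hj with rfl | rfl | rfl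
    · refine (hT₂ _ ?_ ?_ ?_ h1).elim <;> simp [hmem, hx.eq_iff]
    · refine (hT₁ _ ?_ ?_ ?_ h2).elim <;> simp [hmem, hx.eq_iff]
    · rfl
  have hψ5 : ψ (x 5) = x 4 := by
    obtain ⟨⟨⟨j, hj, hjx⟩, -⟩, h1, h2⟩ := hex _ h5 hd5
    rw [← hjx] at h1 h2 ⊢
    rcases hj with rfl | rfl | rfl
    · refine (hT₃ _ ?_ ?_ ?_ h2).elim <;> simp [hmem, hx.eq_iff]
    · refine (hT₀ _ ?_ ?_ ?_ h1).elim <;> simp [hmem, hx.eq_iff]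
    · rfl
  have h05 := hx (hψ (show _ ∧ _ from ⟨h0, hd0⟩) (show _ ∧ _ from ⟨h5, hd5⟩) (hψ0.trans hψ5.symm))
  exact absurd h05 (by decide)

end Matroid

/-! ### Splitting and minors -/

theorem mem_shortenCode_punctureCode {α : Type*} {C : Set (α → ZMod 2)} {K D : Set α}
    {c : α → ZMod 2} (hc : c ∈ C) (h0 : ∀ i ∈ D, c i = 0) :
    c ∈ shortenCode (punctureCode C K) D :=
  ⟨c, ⟨c, hc, fun _ _ ↦ rfl⟩, h0, fun _ _ ↦ rfl⟩

theorem mem_punctureCode_shortenCode {α : Type*} {R : Set (α → ZMod 2)} {K D : Set α}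
    {r : α → ZMod 2} (hr : r ∈ R) (h0 : ∀ i ∈ K, r i = 0) :
    r ∈ punctureCode (shortenCode R K) D :=
  ⟨r, ⟨r, hr, h0, fun _ _ ↦ rfl⟩, fun _ _ ↦ rfl⟩

theorem exists_of_mem_shortenCode_punctureCode {α : Type*} {C : Set (α → ZMod 2)} {K D : Set α}
    (hKD : Disjoint K D) {c : α → ZMod 2} (hc : c ∈ shortenCode (punctureCode C K) D) :
    ∃ c' ∈ C, (∀ i ∈ D, c' i = 0) ∧ ∀ i, i ∉ K → i ∉ D → c' i = c i := by
  obtain ⟨c', ⟨c'', hc'', h1⟩, h0, h2⟩ := hc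
  refine ⟨c'', hc'', fun i hi ↦ ?_, fun i hK hD ↦ by rw [h1 i hK, h2 i hD]⟩
  rw [h1 i (disjoint_right.1 hKD hi), h0 i hi]

theorem exists_of_mem_punctureCode_shortenCode {α : Type*} {R : Set (α → ZMod 2)} {K D : Set α}
    {r : α → ZMod 2} (hr : r ∈ punctureCode (shortenCode R K) D) :
    ∃ r' ∈ R, (∀ i ∈ K, r' i = 0) ∧ ∀ i, i ∉ K → i ∉ D → r' i = r i := by
  obtain ⟨r', ⟨r'', hr'', h0, h1⟩, h2⟩ := hr
  exact ⟨r'', hr'', h0, fun i hK hD ↦ by rw [h1 i hK, h2 i hD]⟩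

/-- The sets to be contracted and deleted according to a certificate. -/
theorem exists_contract_delete {α : Type*} [DecidableEq α] {E : Finset α} {x : Fin 6 → α}
    (hxE : ∀ j, x j ∈ E) {c r : Fin 3 → α → ZMod 2}
    (h0 : ∀ i ∈ E, i ∉ range x → (∀ k, c k i = 0) ∨ ∀ k, r k i = 0) :
    ∃ K D : Finset α, K ⊆ E ∧ D ⊆ E ∧ Disjoint K D ∧ (E \ K) \ D = Finset.univ.image x ∧
      (∀ k, ∀ i ∈ D, c k i = 0) ∧ ∀ k, ∀ i ∈ K, r k i = 0 := by
  classical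
  refine ⟨E.filter fun i ↦ i ∉ range x ∧ ∀ k, r k i = 0,
    E.filter fun i ↦ i ∉ range x ∧ ¬ ∀ k, r k i = 0, Finset.filter_subset _ _,
    Finset.filter_subset _ _, ?_, ?_, fun k i hi ↦ ?_, fun k i hi ↦ ?_⟩
  · rw [Finset.disjoint_left]
    intro i hi hi'
    exact (Finset.mem_filter.1 hi').2.2 (Finset.mem_filter.1 hi).2.2
  · ext i
    have : i ∈ Finset.univ.image x ↔ i ∈ range x := by simp
    rw [this]
    simp only [Finset.mem_sdiff, Finset.mem_filter]
    constructor
    · tauto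
    · rintro ⟨j, rfl⟩
      have := hxE j
      have : x j ∈ range x := ⟨j, rfl⟩
      tauto
  · obtain ⟨hiE, hix, hr⟩ := Finset.mem_filter.1 hi
    exact (h0 i hiE hix).resolve_right hr k
  · exact (Finset.mem_filter.1 hi).2.2 k

theorem sum_k4Cocycles_mul_k4Cycles :
    ∀ k l, ∑ j, k4Cocycles k j * k4Cycles l j = 0 := by decide

theorem exists_eq_sum_k4Cycles (v : Fin 6 → ZMod 2) (hv : ∀ k, ∑ j, k4Cocycles k j * v j = 0) :
    ∃ s : Fin 3 → ZMod 2, ∀ j, v j = ∑ k, s k * k4Cycles k j := by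
  -- Each of the edges `3`, `4`, `5` lies in exactly one of the three triangles, so the coefficients
  -- can be read off there.
  refine ⟨![v 3, v 4, v 5], ?_⟩
  simp [Fin.forall_fin_succ, Fin.sum_univ_succ, k4Cocycles] at hv
  simp [Fin.forall_fin_succ, Fin.sum_univ_succ, k4Cycles]
  grind

namespace Matroid

variable {α : Type*} {M N : Matroid α} {E : Finset α} {C R : Set (α → ZMod 2)}

/-- Contracting and deleting as the certificate prescribes leaves the six elements with the
triangles and stars of `K₄` in the two codes, and injective exchange would pass to this minor. -/
theorem HasCode.not_hasInjectiveExchange_of_certificate [DecidableEq α] (h : M.HasCode E C R)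
    (hK : HasK4Certificate E C R) : ¬ M.HasInjectiveExchange := by
  obtain ⟨x, c, r, hx, hxE, hc, hr, hcx, hrx, h0⟩ := hK
  obtain ⟨K, D, hKE, hDE, hKD, himage, hcD, hrK⟩ := exists_contract_delete hxE h0
  have hN := h.minor K D hKE hDE hKD
  rw [himage] at hN
  exact fun hex ↦ hN.not_hasInjectiveExchange hx
    (fun k ↦ mem_shortenCode_punctureCode (hc k) (hcD k))
    (fun k ↦ mem_punctureCode_shortenCode (hr k) (hrK k)) hcx hrx
    (hex.of_isMinor (contract_delete_isMinor M K D))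

/-- If adding the parity check `h` to the cycle space of `M` creates an `M(K₄)`-minor, then `M` has
a minor that is the quotient of `M(K₄)` by a point. -/
theorem HasCode.exists_minor_of_certificate [DecidableEq α] (hM : M.HasCode E C R)
    {C' R' : Set (α → ZMod 2)} (hp' : OrthoPair E C' R') (h : α → ZMod 2)
    (hC' : ∀ c, c ∈ C' ↔ c ∈ C ∧ ∑ e ∈ E, h e * c e = 0) (hK : ¬ HasK4Certificate E C R)
    (hK' : HasK4Certificate E C' R') :
    ∃ N, N ≤m M ∧ ∃ x : Fin 6 → α, x.Injective ∧ ∃ t ≠ 0, ∃ C₁ R₁,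
      N.HasCode (Finset.univ.image x) C₁ R₁ ∧ ∀ c, c ∈ C₁ ↔ c ∘ x ∈ k4QuotientCode t := by
  have hp := hM.orthoPair
  obtain ⟨x, c, r, hx, hxE, hc, hr, hcx, hrx, h0⟩ := hK'
  have hcC : ∀ k, c k ∈ C := fun k ↦ ((hC' _).1 (hc k)).1
  -- The cocycle space of the splitting is `R ∪ (R + h)`, so each star lies in `R` after adding a
  -- multiple of `h`. If all the multiples were zero, the certificate would be one for `M`.
  have ht : ∀ k, ∃ t : ZMod 2, r k + t • h ∈ R := by
    intro k
    rcases (hp.mem_right_or_add_mem hp' h hC' (r k)).1 (hr k) with h1 | h1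
    · exact ⟨0, by simpa using h1⟩
    · exact ⟨1, by simpa using h1⟩
  choose t ht using ht
  have ht0 : t ≠ 0 := by
    rintro rfl
    exact hK ⟨x, c, r, hx, hxE, hcC, fun k ↦ by simpa using ht k, hcx, hrx, h0⟩
  obtain ⟨k₀, hk₀⟩ : ∃ k, t k = 1 := by
    by_contra! hcon
    exact ht0 (funext fun k ↦ (ZMod.eq_zero_or_eq_one_of_two _).resolve_right (hcon k))
  -- Adding `t k` times the vector for `k₀`, where `t k₀ = 1`, cancels `h`.
  have hrt : ∀ k, r k + t k • r k₀ ∈ R := by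
    intro k
    refine hp.symm.congr_mem (hp.symm.add_mem (ht k) (hp.symm.smul_mem (t k) (ht k₀))) fun i _ ↦ ?_
    simp only [hk₀, one_smul, Pi.add_apply, Pi.smul_apply, smul_add, smul_eq_mul]
    rw [add_add_add_comm, CharTwo.add_self_eq_zero, add_zero]
  obtain ⟨K, D, hKE, hDE, hKD, himage, hcD, hrK⟩ := exists_contract_delete hxE h0
  have hN := hM.minor K D hKE hDE hKD
  rw [himage] at hN
  have hsum : ∀ r d : α → ZMod 2, ∑ i ∈ Finset.univ.image x, r i * d i = ∑ j, r (x j) * d (x j) :=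
    fun r d ↦ Finset.sum_image fun i _ j _ hij ↦ hx hij
  have hcN : ∀ k, c k ∈ shortenCode (punctureCode C K) D := fun k ↦
    mem_shortenCode_punctureCode (hcC k) (hcD k)
  have hquot : ∀ d ∈ shortenCode (punctureCode C K) D, ∀ k,
      ∑ j, k4Cocycles k j * d (x j) = (∑ j, k4Cocycles k₀ j * d (x j)) * t k := by
    intro d hd k
    have hmem : r k + t k • r k₀ ∈ punctureCode (shortenCode R K) D :=
      mem_punctureCode_shortenCode (hrt k) fun i hi ↦ by
        simp [hrK k i hi, hrK k₀ i hi]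
    have := hN.orthoPair.sum_eq_zero hmem hd
    rw [hsum] at this
    simp only [Pi.add_apply, Pi.smul_apply, smul_eq_mul, hrx, add_mul, Finset.sum_add_distrib,
      mul_assoc, ← Finset.mul_sum] at this
    rw [CharTwo.add_eq_zero.1 this, mul_comm]
  have hspan : ∀ d : α → ZMod 2, (∀ k, ∑ j, k4Cocycles k j * d (x j) = 0) →
      d ∈ shortenCode (punctureCode C K) D := by
    intro d hd
    obtain ⟨s, hs⟩ := exists_eq_sum_k4Cycles (d ∘ x) hd
    have hadd := hN.orthoPair.add_mem (hN.orthoPair.add_mem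
      (hN.orthoPair.smul_mem (s 0) (hcN 0)) (hN.orthoPair.smul_mem (s 1) (hcN 1)))
      (hN.orthoPair.smul_mem (s 2) (hcN 2))
    refine hN.orthoPair.congr_mem hadd fun i hi ↦ ?_
    obtain ⟨j, -, rfl⟩ := Finset.mem_image.1 hi
    have := hs j
    simp only [Function.comp_apply, Fin.sum_univ_three] at this
    simp only [Pi.add_apply, Pi.smul_apply, smul_eq_mul, hcx, this]
  -- If every cycle of the minor were orthogonal to the star `k₀`, then by `hquot` all three stars
  -- would be cocycles of the minor; lifting them to `R` would give a certificate for `M`. So the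
  -- cycle space is strictly larger than that of `M(K₄)`.
  obtain ⟨d₀, hd₀, hd₀1⟩ : ∃ d ∈ shortenCode (punctureCode C K) (D : Set α),
      ∑ j, k4Cocycles k₀ j * d (x j) = 1 := by
    by_contra! hcon
    have hrN : ∀ k, r k ∈ punctureCode (shortenCode R K) D := by
      intro k
      refine (hN.orthoPair.mem_right _).2 fun d hd ↦ ?_
      rw [hsum]
      simp only [hrx]
      rw [hquot d hd k, (ZMod.eq_zero_or_eq_one_of_two _).resolve_right (hcon d hd), zero_mul]
    choose r' hr' hr'K hr'x using fun k ↦ exists_of_mem_punctureCode_shortenCode (hrN k)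
    have hnot : ∀ j, x j ∉ K ∧ x j ∉ D := by
      intro j
      have : x j ∈ (E \ K) \ D := by
        rw [himage]
        simp
      simp only [Finset.mem_sdiff] at this
      exact ⟨this.1.2, this.2⟩
    refine hK ⟨x, c, r', hx, hxE, hcC, hr', hcx, fun k j ↦ ?_, fun i hi hix ↦ ?_⟩
    · rw [hr'x k (x j) (hnot j).1 (hnot j).2, hrx]
    · by_cases hiK : i ∈ K
      · exact Or.inr fun k ↦ hr'K k i hiK
      · refine Or.inl fun k ↦ hcD k i ?_
        by_contra hiD
        have : i ∈ (E \ K) \ D := by simp [hi, hiK, hiD]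
        rw [himage] at this
        exact hix (by simpa using this)
  refine ⟨_, contract_delete_isMinor M K D, x, hx, t, ht0, _, _, hN, fun d ↦ ⟨fun hd ↦
    ⟨_, hquot d hd⟩, ?_⟩⟩
  rintro ⟨s, hs⟩
  -- The vector `d₀` has star values `t`, so adding `s` times it brings `d` into the span of the
  -- triangles.
  have hmem : d + s • d₀ ∈ shortenCode (punctureCode C K) (D : Set α) := by
    refine hspan _ fun k ↦ ?_
    have h1 := hs k
    have h2 := hquot d₀ hd₀ k
    rw [hd₀1, one_mul] at h2
    simp only [Function.comp_apply] at h1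
    simp only [Pi.add_apply, Pi.smul_apply, smul_eq_mul, mul_add, Finset.sum_add_distrib, h1,
      mul_left_comm _ s, ← Finset.mul_sum, h2]
    exact CharTwo.add_self_eq_zero _
  refine hN.orthoPair.congr_mem
    (hN.orthoPair.add_mem hmem (hN.orthoPair.smul_mem s hd₀)) fun i _ ↦ ?_
  simp only [Pi.add_apply]
  rw [add_assoc, CharTwo.add_self_eq_zero, add_zero]

/-- If `M` has a minor that is the quotient of `M(K₄)` by a point, then splitting along a suitable
set creates an `M(K₄)`-minor. -/
theorem exists_certificate_splitting (hbin : M.IsBinary) (hfin : M.E.Finite) (hN : N ≤m M)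
    [DecidableEq α] {x : Fin 6 → α} (hx : x.Injective) (hE : N.E = range x) {t : Fin 3 → ZMod 2}
    {k₀ : Fin 3} (ht : t k₀ = 1)
    (hcode : ∀ C₁ R₁, N.HasCode (Finset.univ.image x) C₁ R₁ →
      ∀ c, c ∈ C₁ ↔ c ∘ x ∈ k4QuotientCode t) :
    ∃ E C R, (M.splitting hbin (x '' {j | k4Cocycles k₀ j = 1})).HasCode E C R ∧
      HasK4Certificate E C R := by
  classical
  obtain ⟨-, E, C, R, C', R', hM, hM', hC'⟩ :=
    exists_hasCode_splitting hbin hfin (x '' {j | k4Cocycles k₀ j = 1})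
  have hp := hM.orthoPair
  have hp' := hM'.orthoPair
  refine ⟨E, C', R', hM', ?_⟩
  set h : α → ZMod 2 := fun e ↦ if e ∈ x '' {j | k4Cocycles k₀ j = 1} then 1 else 0 with hdef
  have hhx : ∀ j, h (x j) = k4Cocycles k₀ j := by
    intro j
    simp only [hdef, hx.mem_set_image, mem_ofPred_eq]
    rcases ZMod.eq_zero_or_eq_one_of_two (k4Cocycles k₀ j) with h0 | h0 <;> simp [h0]
  have hh0 : ∀ i, i ∉ range x → h i = 0 := fun i hi ↦
    if_neg fun hi' ↦ hi (image_subset_range _ _ hi')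
  obtain ⟨K₀, D₀, hK₀, hD₀, hKD₀, rfl⟩ := hN.exists_eq_contract_delete_disjoint
  rw [hM.ground] at hK₀ hD₀
  obtain ⟨K, rfl⟩ : ∃ K : Finset α, (K : Set α) = K₀ :=
    ⟨(E.finite_toSet.subset hK₀).toFinset, by simp⟩
  obtain ⟨D, rfl⟩ : ∃ D : Finset α, (D : Set α) = D₀ :=
    ⟨(E.finite_toSet.subset hD₀).toFinset, by simp⟩
  have hKE : K ⊆ E := by exact_mod_cast hK₀
  have hDE : D ⊆ E := by exact_mod_cast hD₀
  have hN' := hM.minor K D hKE hDE (by exact_mod_cast hKD₀)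
  have himage : (E \ K) \ D = Finset.univ.image x := by
    rw [← Finset.coe_inj, ← hN'.ground, hE]
    simp
  rw [himage] at hN'
  have hcode := hcode _ _ hN'
  have hmem : ∀ i ∈ E, i ∉ K → i ∉ D → i ∈ range x := by
    intro i hi hiK hiD
    have : i ∈ (E \ K) \ D := by simp [hi, hiK, hiD]
    rw [himage] at this
    simpa using this
  have hxmem : ∀ j, x j ∈ E ∧ x j ∉ K ∧ x j ∉ D := by
    intro j
    have : x j ∈ (E \ K) \ D := by
      rw [himage]
      simp
    simp only [Finset.mem_sdiff] at this
    exact ⟨this.1.1, this.1.2, this.2⟩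
  have hKx : ∀ i ∈ K, i ∉ range x := by
    rintro _ hi ⟨j, rfl⟩
    exact (hxmem j).2.1 hi
  -- Since `h` is supported on the six elements, its parity check reads only the star `k₀` there;
  -- triangles therefore survive the splitting, whatever their lifts are on contracted elements.
  have hsum : ∀ d : α → ZMod 2, ∑ e ∈ E, h e * d e = ∑ j, k4Cocycles k₀ j * d (x j) := by
    intro d
    have hsub : Finset.univ.image x ⊆ E := by
      rw [← himage]
      exact Finset.sdiff_subset.trans Finset.sdiff_subset
    rw [← Finset.sum_subset hsub, Finset.sum_image fun i _ j _ hij ↦ hx hij]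
    · simp only [hhx]
    · intro i _ hi
      rw [hh0 i (by simpa using hi), zero_mul]
  have hc : ∀ k, ∃ c ∈ C', (∀ i ∈ D, c i = 0) ∧ ∀ j, c (x j) = k4Cycles k j := by
    intro k
    have hext : ∀ j, Function.extend x (k4Cycles k) 0 (x j) = k4Cycles k j := hx.extend_apply _ _
    obtain ⟨c, hc, hcD, hcx⟩ := exists_of_mem_shortenCode_punctureCode hKD₀
      ((hcode (Function.extend x (k4Cycles k) 0)).2 ⟨0, fun l ↦ by
        simp only [Function.comp_apply, hext, zero_mul]
        exact sum_k4Cocycles_mul_k4Cycles l k⟩)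
    have hcx' : ∀ j, c (x j) = k4Cycles k j := fun j ↦ by
      rw [hcx (x j) (hxmem j).2.1 (hxmem j).2.2, hext]
    refine ⟨c, (hC' c).2 ⟨hc, ?_⟩, hcD, hcx'⟩
    rw [hsum]
    simp only [hcx']
    exact sum_k4Cocycles_mul_k4Cycles k₀ k
  have hr : ∀ k, ∃ r ∈ R', (∀ i ∈ K, r i = 0) ∧ ∀ j, r (x j) = k4Cocycles k j := by
    intro k
    -- As `t k₀ = 1`, the vector `w` annihilates the quotient code and is thus a cocycle of `N`.
    -- Adding `t k` times `h`, which becomes available in `R'`, turns it back into the star `k`.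
    let w : Fin 6 → ZMod 2 := fun j ↦ k4Cocycles k j + t k * k4Cocycles k₀ j
    have hext : ∀ j, Function.extend x w 0 (x j) = w j := hx.extend_apply _ _
    obtain ⟨r, hr, hrK, hrx⟩ := exists_of_mem_punctureCode_shortenCode
      ((hN'.orthoPair.mem_right (Function.extend x w 0)).2 fun d hd ↦ by
        obtain ⟨s, hs⟩ := (hcode d).1 hd
        simp only [Function.comp_apply] at hs
        rw [Finset.sum_image fun i _ j _ hij ↦ hx hij]
        simp only [hext, w, add_mul, Finset.sum_add_distrib, mul_assoc, ← Finset.mul_sum, hs, ht,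
          mul_one]
        rw [mul_comm]
        exact CharTwo.add_self_eq_zero _)
    refine ⟨r + t k • h, ?_, fun i hi ↦ ?_, fun j ↦ ?_⟩
    · refine (hp.mem_right_or_add_mem hp' h hC' _).2 ?_
      rcases ZMod.eq_zero_or_eq_one_of_two (t k) with h1 | h1
      · exact Or.inl (by simpa [h1] using hr)
      · refine Or.inr (hp.symm.congr_mem hr fun i _ ↦ ?_)
        rw [h1, one_smul, Pi.add_apply, Pi.add_apply, add_assoc, CharTwo.add_self_eq_zero, add_zero]
    · rw [Pi.add_apply, hrK i hi, Pi.smul_apply, hh0 i (hKx i hi), smul_zero, add_zero]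
    · rw [Pi.add_apply, Pi.smul_apply, hrx (x j) (hxmem j).2.1 (hxmem j).2.2, hext, hhx,
        smul_eq_mul, add_assoc, CharTwo.add_self_eq_zero, add_zero]
  choose c hcC hcD hcx using hc
  choose r hrR hrK hrx using hr
  refine ⟨x, c, r, hx, fun j ↦ (hxmem j).1, hcC, hrR, hcx, hrx, fun i hi hix ↦ ?_⟩
  by_cases hiK : i ∈ K
  · exact Or.inr fun k ↦ hrK k i hiK
  · exact Or.inl fun k ↦ hcD k i (by_contra fun hiD ↦ hix (hmem i hi hiK hiD))

/-- A splitting of `M` fails to be a gammoid if `M` has a minor that is a quotient of `M(K₄)`. -/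
theorem exists_splitting_not_isGammoid [DecidableEq α] (hbin : M.IsBinary) (hfin : M.E.Finite)
    {A : Matrix (Fin 3) (Fin 6) (ZMod 2)} (hA : M.HasMinorIso (vectorMatroid A univ))
    {t : Fin 3 → ZMod 2} {k₀ : Fin 3} (ht : t k₀ = 1) {τ : Fin 6 → Fin 6} (hτ : τ.Injective)
    (hcode : ∀ v, v ∈ k4QuotientCode t ↔ v ∘ τ ∈ relationCode A Finset.univ) :
    ∃ H ⊆ M.E, 2 ≤ H.ncard ∧ ¬ (M.splitting hbin H).IsGammoid := by
  obtain ⟨N, hN, x, hx, hE, hind⟩ := (hasMinorIso_iff rfl).1 hA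
  let σ := Equiv.ofBijective τ (Finite.injective_iff_bijective.1 hτ)
  have hQ := hasCode_vectorMatroid A Finset.univ
  rw [Finset.coe_univ] at hQ
  have hy : (x ∘ σ.symm).Injective := hx.comp σ.symm.injective
  have hrange : range (x ∘ σ.symm) = range x := EquivLike.range_comp x σ.symm
  have himage : Finset.univ.image (x ∘ σ.symm) = Finset.univ.image x := by
    rw [← Finset.coe_inj]
    simp only [Finset.coe_image, Finset.coe_univ, image_univ, hrange]
  obtain ⟨E, C, R, hcodeM, hK⟩ := exists_certificate_splitting hbin hfin hN hy
    (hE.trans hrange.symm) ht fun C₁ R₁ hC₁ c ↦ by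
      rw [himage] at hC₁
      rw [hC₁.mem_iff_of_indep_iff hx hQ hind, hcode, Function.comp_assoc, Function.comp_assoc]
      have : σ.symm ∘ τ = id := funext fun j ↦ σ.symm_apply_apply j
      rw [this, Function.comp_id]
  refine ⟨_, ?_, ?_, fun hgam ↦
    hcodeM.not_hasInjectiveExchange_of_certificate hK hgam.hasInjectiveExchange⟩
  · refine (image_subset_range _ _).trans ?_
    rw [hrange, ← hE]
    exact hN.subset
  · have hcard : ∀ k, 2 ≤ {j | k4Cocycles k j = 1}.ncard := by
      intro k
      rw [ncard_eq_toFinset_card']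
      revert k
      decide
    rw [ncard_image_of_injective _ hy]
    exact hcard k₀

end Matroid

/-! ### The corollary -/

theorem corollary3p2 {α : Type*} (M : Matroid α) (hbin : M.IsBinary) (hgam : M.IsGammoid) :
    (∀ H : Set α, H ⊆ M.E → 2 ≤ H.ncard →
      (M.splitting hbin H).IsBinary ∧ (M.splitting hbin H).IsGammoid) ↔
    (¬ M.HasMinorIso graphQ2.cycleMatroid ∧ ¬ M.HasMinorIso graphQ3.cycleMatroid ∧
      ¬ M.HasMinorIso graphQ4.cycleMatroid) := by
  classical
  have hfin := hgam.finite_ground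
  rw [cycleMatroid_graphQ2, cycleMatroid_graphQ3, cycleMatroid_graphQ4]
  constructor
  · intro h
    have hQ2 : ¬ M.HasMinorIso (Matroid.vectorMatroid incQ2 univ) := by
      intro hQ
      -- Any point other than `(1,1,1)` would serve to realise `M(Q₂)` as a quotient of `M(K₄)`;
      -- below, `(1,1,1)` is the only choice for `M(Q₄)`.
      obtain ⟨τ, hτ, ⟨-, hcode⟩ | ⟨h1, -⟩⟩ := k4QuotientCode_cases ![1, 0, 0] (by decide)
      · obtain ⟨H, hH, h2, hn⟩ := Matroid.exists_splitting_not_isGammoid hbin hfin hQ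
          (k₀ := 0) rfl hτ hcode
        exact hn (h H hH h2).2
      · exact absurd h1 (by decide)
    have hQ4 : ¬ M.HasMinorIso (Matroid.vectorMatroid incQ4 univ) := by
      intro hQ
      obtain ⟨τ, hτ, ⟨h1, -⟩ | ⟨-, hcode⟩⟩ := k4QuotientCode_cases ![1, 1, 1] (by decide)
      · exact absurd h1 (by decide)
      · obtain ⟨H, hH, h2, hn⟩ := Matroid.exists_splitting_not_isGammoid hbin hfin hQ
          (k₀ := 0) rfl hτ hcode
        exact hn (h H hH h2).2
    exact ⟨hQ2, hQ2, hQ4⟩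
  · rintro ⟨hQ2, -, hQ4⟩ H - -
    obtain ⟨hbinH, E, C, R, C', R', hM, hM', hC'⟩ :=
      Matroid.exists_hasCode_splitting hbin hfin H
    refine ⟨hbinH, .of_isMatchingRepresentable ?_⟩
    -- That `M` itself is a gammoid enters here: an `M(K₄)`-minor of the splitting must then really
    -- be created by `h`, which forces `t ≠ 0`.
    have hK : ¬ HasK4Certificate E C R := fun hK ↦
      hM.not_hasInjectiveExchange_of_certificate hK hgam.hasInjectiveExchange
    have hK' : ¬ HasK4Certificate E C' R' := by
      intro hK'
      obtain ⟨N, hN, x, hx, t, ht, C₁, R₁, hN₁, hcode⟩ :=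
        hM.exists_minor_of_certificate hM'.orthoPair _ hC' hK hK'
      have main : ∀ (A : Matrix (Fin 3) (Fin 6) (ZMod 2)) (τ : Fin 6 → Fin 6), τ.Injective →
          (∀ v, v ∈ k4QuotientCode t ↔ v ∘ τ ∈ Matroid.relationCode A Finset.univ) →
          M.HasMinorIso (Matroid.vectorMatroid A univ) := by
        intro A τ hτ hA
        let σ := Equiv.ofBijective τ (Finite.injective_iff_bijective.1 hτ)
        have hrange : range (x ∘ τ) = range x := EquivLike.range_comp x σ
        have himage : Finset.univ.image (x ∘ τ) = Finset.univ.image x := by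
          rw [← Finset.coe_inj]
          simp only [Finset.coe_image, Finset.coe_univ, image_univ, hrange]
        refine (Matroid.hasMinorIso_iff rfl).2 ⟨N, hN, x ∘ τ, hx.comp hτ, ?_, fun S ↦ ?_⟩
        · rw [hN₁.ground, hrange]
          simp
        · have hQ := Matroid.hasCode_vectorMatroid A Finset.univ
          rw [Finset.coe_univ] at hQ
          rw [← himage] at hN₁
          rw [hN₁.indep_image_iff (hx.comp hτ) (C := Matroid.relationCode A Finset.univ)
            fun c ↦ (hcode c).trans (hA _), hQ.indep_iff]
          simp
      obtain ⟨τ, hτ, ⟨-, h2⟩ | ⟨-, h4⟩⟩ := k4QuotientCode_cases t ht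
      · exact hQ2 (main _ τ hτ h2)
      · exact hQ4 (main _ τ hτ h4)
    obtain ⟨V, J, hV, A, φ, hφ, h⟩ := hM'.orthoPair.isMatchingRepresentable hK'
    refine ⟨V, J, hV, A, φ, hM'.ground ▸ hφ, fun I hI ↦ ?_⟩
    rw [hM'.ground] at hI
    rw [hM'.indep_iff, and_iff_right hI, h I hI]
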